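/- Access points (APs) form a homogeneous Poisson point process $\Phi_W$ of intensity $\lambda_W>0$ in $\mathbb R^2$, and LTE base stations (eNBs) form an independent homogeneous Poisson point process $\Phi_L$ of intensity $\lambda_L>0$. Transmit powers are $P_W,P_L>0$, sensing thresholds are $\Gamma_{cs},\Gamma_{ed},\Gamma^L>0$, and the path loss is $l(d)=(4\pi/\lambda_c)^2 d^{\alpha}$ with $\lambda_c,\alpha>0$. The fading variables $G^{W}_{ji}$ (AP $x_j$ to AP $x_i$), $G^{LW}_{mi}$ (eNB $y_m$ to AP $x_i$), $G^{WL}_{jk}$ (AP $x_j$ to eNB $y_k$), $G^{L}_{mk}$ (eNB $y_m$ to eNB $y_k$) are exponential with parameter $\mu>0$; the back-off timers $t^W_i$ of the APs and $t^L_k$ of the eNBs are uniform on $[0,1]$ (listen-before-talk with window $(a,b)=(0,1)$); all these variables are mutually independent and independent of $\Phi_W,\Phi_L$. AP $x_i$ transmits ($e_i^W=1$) iff $G^W_{ji}/l(\|x_j-x_i\|)\le \Gamma_{cs}/P_W$ for every other AP $x_j$ with $t^W_j<t^W_i$ and $G^{LW}_{mi}/l(\|y_m-x_i\|)\le\Gamma_{ed}/P_L$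 for every eNB $y_m$ with $t^L_m<t^W_i$. eNB $y_k$ transmits ($e_k^L=1$) iff $G^{WL}_{jk}/l(\|x_j-y_k\|)\le \Gamma^L/P_W$ for every AP $x_j$ with $t^W_j<t^L_k$ and $G^{L}_{mk}/l(\|y_m-y_k\|)\le\Gamma^L/P_L$ for every other eNB $y_m$ with $t^L_m<t^L_k$. The tagged eNB is the eNB closest to the origin $o$. Let $B(0,r)$ be the closed disc and define $$N^L_0(y,r,\Gamma)=\lambda_L\int_{\mathbb R^2\setminus B(0,r)}e^{-\mu\frac{\Gamma}{P_L}l(\|x-y\|)}dx,\qquad C^L_0(y_1,\Gamma_1,y_2,\Gamma_2)=\lambda_L\int_{\mathbb R^2\setminus B(0,\|y_2\|)}e^{-\mu\frac{\Gamma_1}{P_L}l(\|x-y_1\|)-\mu\frac{\Gamma_2}{P_L}l(\|x-y_2\|)}dx,$$ and $N^W_0$, $C^W_0$ in the same way with $\lambda_W,P_W$ in place of $\lambda_L,P_L$; further $$M(N_1,N_2,N_3)=\frac{1}{N_2-N_3}\left(\frac{1-e^{-N_1}}{N_1}-\frac{1-e^{-N_1-N_2+N_3}}{N_1+N_2-N_3}\right),$$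 $$V(x,s_1,s_2,N_1,N_2,N_3)=(1-e^{-\mu s_1 l(\|x\|)})M(N_1,N_2,N_3)+(1-e^{-\mu s_2 l(\|x\|)})M(N_2,N_1,N_3),$$ $$U(x,s,N_1)=\frac{1-e^{-N_1}}{N_1}-e^{-\mu s l(\|x\|)}\left(\frac{1-e^{-N_1}}{N_1^2}-\frac{e^{-N_1}}{N_1}\right).$$ **Claim.** Let $r_0>0$, $y_0=(r_0,0)$ and $x_i\in\mathbb R^2\setminus B(0,r_0)$. Under the Palm distribution of the network given an AP at $x_i$ and an eNB at $y_0$, the event that the eNB at $y_0$ is the tagged eNB and transmits has positive probability, and conditionally on this event the AP at $x_i$ transmits with probability $$h_3^W(r_0,x_i)=\frac{V\left(x_i-y_0,\frac{\Gamma^L}{P_W},\frac{\Gamma_{ed}}{P_L},N_1,N_2,N_3\right)}{U\left(x_i-y_0,\frac{\Gamma^L}{P_W},N_1\right)},$$ where $N_1=N^W_0(o,0,\Gamma^L)+N^L_0(y_0,r_0,\Gamma^L)$, $N_2=N^W_0(o,0,\Gamma_{cs})+N^L_0(x_i,r_0,\Gamma_{ed})$ and $N_3=C^W_0(y_0-x_i,\Gamma^L,o,\Gamma_{cs})+C^L_0(x_i,\Gamma_{ed},y_0,\Gamma^L)$.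 -/

import Mathlib

open MeasureTheory ProbabilityTheory
open scoped ENNReal

noncomputable section

namespace Coexist

/-- The Euclidean plane `ℝ²`. -/
abbrev Plane := EuclideanSpace ℝ (Fin 2)

/-! ### System parameters and path loss -/

/-- System parameters: AP and eNB intensities, transmit powers, the Wi-Fi carrier-sense threshold,
the Wi-Fi energy-detection threshold, the LTE sensing threshold, the Rayleigh fading parameter, the
path loss exponent and the carrier wavelength. -/
structure Params where
  lamW : ℝ
  lamL : ℝ
  PW : ℝ
  PL : ℝ
  thrCS : ℝ
  thrED : ℝ
  thrL : ℝ
  mu : ℝ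
  alpha : ℝ
  wavelength : ℝ
  lamW_pos : 0 < lamW
  lamL_pos : 0 < lamL
  PW_pos : 0 < PW
  PL_pos : 0 < PL
  thrCS_pos : 0 < thrCS
  thrED_pos : 0 < thrED
  thrL_pos : 0 < thrL
  mu_pos : 0 < mu
  alpha_pos : 0 < alpha
  wavelength_pos : 0 < wavelength

/-- Free space path loss with reference distance one metre, on the linear scale; in decibels it
reads `20 log₁₀ (4π / λ_c) + 10 α log₁₀ d`. -/
def Params.loss (p : Params) (d : ℝ) : ℝ :=
  (4 * Real.pi / p.wavelength) ^ 2 * d ^ p.alpha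

/-! ### The special functions -/

/-- Mean number of eNBs outside `B(0,r)` whose power received at `y` exceeds `G`. -/
def Params.NL0 (p : Params) (y : Plane) (r G : ℝ) : ℝ :=
  p.lamL * ∫ x in (Metric.closedBall (0 : Plane) r)ᶜ,
    Real.exp (-(p.mu * (G / p.PL) * p.loss ‖x - y‖))

/-- Mean number of APs outside `B(0,r)` whose power received at `y` exceeds `G`. -/
def Params.NW0 (p : Params) (y : Plane) (r G : ℝ) : ℝ :=
  p.lamW * ∫ x in (Metric.closedBall (0 : Plane) r)ᶜ,
    Real.exp (-(p.mu * (G / p.PW) * p.loss ‖x - y‖))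

/-- `N^L_1(r, G)`: the value of `N^L_0(y, r, G)` at `y = (r, 0)`. -/
def Params.NL1 (p : Params) (r G : ℝ) : ℝ := p.NL0 !₂[r, 0] r G

/-- `N^W_3(G) = N^W_0(o, 0, G)`. -/
def Params.NW3 (p : Params) (G : ℝ) : ℝ := p.NW0 0 0 G

/-- `N^W = N^W_0(o, 0, Γ_cs)`. -/
def Params.NW (p : Params) : ℝ := p.NW0 0 0 p.thrCS

/-- Mean number of eNBs outside `B(0,‖y₂‖)` whose powers received at `y₁` and `y₂` exceed `G₁` and
`G₂` respectively. -/
def Params.CL0 (p : Params) (y₁ : Plane) (G₁ : ℝ) (y₂ : Plane) (G₂ : ℝ) : ℝ :=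
  p.lamL * ∫ x in (Metric.closedBall (0 : Plane) ‖y₂‖)ᶜ,
    Real.exp (-(p.mu * (G₁ / p.PL) * p.loss ‖x - y₁‖) - p.mu * (G₂ / p.PL) * p.loss ‖x - y₂‖)

/-- Mean number of APs outside `B(0,‖y₂‖)` whose powers received at `y₁` and `y₂` exceed `G₁` and
`G₂` respectively. -/
def Params.CW0 (p : Params) (y₁ : Plane) (G₁ : ℝ) (y₂ : Plane) (G₂ : ℝ) : ℝ :=
  p.lamW * ∫ x in (Metric.closedBall (0 : Plane) ‖y₂‖)ᶜ,
    Real.exp (-(p.mu * (G₁ / p.PW) * p.loss ‖x - y₁‖) - p.mu * (G₂ / p.PW) * p.loss ‖x - y₂‖)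

/-- The function `M(N₁, N₂, N₃)`. -/
def M (N₁ N₂ N₃ : ℝ) : ℝ :=
  ((1 - Real.exp (-N₁)) / N₁ - (1 - Real.exp (-N₁ - N₂ + N₃)) / (N₁ + N₂ - N₃)) / (N₂ - N₃)

/-- The function `V(x, s₁, s₂, N₁, N₂, N₃)`. -/
def Params.V (p : Params) (x : Plane) (s₁ s₂ N₁ N₂ N₃ : ℝ) : ℝ :=
  (1 - Real.exp (-(p.mu * s₁ * p.loss ‖x‖))) * M N₁ N₂ N₃
    + (1 - Real.exp (-(p.mu * s₂ * p.loss ‖x‖))) * M N₂ N₁ N₃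

/-- The function `U(x, s, N₁)`. -/
def Params.U (p : Params) (x : Plane) (s N₁ : ℝ) : ℝ :=
  (1 - Real.exp (-N₁)) / N₁
    - Real.exp (-(p.mu * s * p.loss ‖x‖)) *
      ((1 - Real.exp (-N₁)) / N₁ ^ 2 - Real.exp (-N₁) / N₁)

/-! ### Poisson point processes -/

/-- The number of points of the (enumerated) point process `X` in the set `B`. -/
def count {Ω E : Type*} (X : ℕ → Ω → E) (B : Set E) (ω : Ω) : ℝ≥0∞ :=
  ∑' n, B.indicator (fun _ => (1 : ℝ≥0∞)) (X n ω)

/-- `X` enumerates the points of a Poisson point process with intensity measure `ν`: the number of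
points in a set of finite measure is Poisson distributed, and the numbers of points in pairwise
disjoint sets are independent. -/
structure IsPoissonProcess {Ω E : Type*} [MeasurableSpace Ω] [MeasurableSpace E]
    (P : Measure Ω) (X : ℕ → Ω → E) (ν : Measure E) : Prop where
  measurable : ∀ n, Measurable (X n)
  law : ∀ B : Set E, MeasurableSet B → ν B ≠ ∞ →
    HasLaw (count X B) ((poissonMeasure (ν B).toNNReal).map (fun k : ℕ => (k : ℝ≥0∞))) P
  indep : ∀ (n : ℕ) (B : Fin n → Set E), (∀ i, MeasurableSet (B i)) →
    Pairwise (fun i j => Disjoint (B i) (B j)) → iIndepFun (fun i => count X (B i)) P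

/-! ### The network -/

/-- Names of the random marks: the back-off timers of the APs and eNBs and the fading variables of
the directed channels. `fadeW j i` is the channel from AP `j` to AP `i`, `fadeL m k` from eNB `m` to
eNB `k`, `fadeLW m i` from eNB `m` to AP `i`, and `fadeWL j k` from AP `j` to eNB `k`. -/
inductive Mark
  | timerW (i : ℕ)
  | timerL (k : ℕ)
  | fadeW (j i : ℕ)
  | fadeL (m k : ℕ)
  | fadeLW (m i : ℕ)
  | fadeWL (j k : ℕ)

/-- A realization of the network: positions of the APs, positions of the eNBs, and the marks. -/
abbrev Snapshot := (ℕ → Plane) × (ℕ → Plane) × (Mark → ℝ)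

/-- Position of AP `i`. -/
def Snapshot.ap (s : Snapshot) (i : ℕ) : Plane := s.1 i

/-- Position of eNB `k`. -/
def Snapshot.enb (s : Snapshot) (k : ℕ) : Plane := s.2.1 k

/-- Value of a mark. -/
def Snapshot.mark (s : Snapshot) (m : Mark) : ℝ := s.2.2 m

/-- Translate all APs by `u` and all eNBs by `v`; every node and every channel keeps its marks. -/
def Snapshot.translate (s : Snapshot) (u v : Plane) : Snapshot :=
  (fun i => s.1 i + u, fun k => s.2.1 k + v, s.2.2)

/-- The medium access indicator of AP `i` equals one under listen-before-talk: no AP (resp. eNB) with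
a smaller timer is received by AP `i` with a power exceeding `Γ_cs` (resp. `Γ_ed`). -/
def apTransmits (p : Params) (s : Snapshot) (i : ℕ) : Prop :=
  (∀ j, j ≠ i → s.mark (.timerW j) < s.mark (.timerW i) →
    s.mark (.fadeW j i) / p.loss ‖s.ap j - s.ap i‖ ≤ p.thrCS / p.PW) ∧
  (∀ m, s.mark (.timerL m) < s.mark (.timerW i) →
    s.mark (.fadeLW m i) / p.loss ‖s.enb m - s.ap i‖ ≤ p.thrED / p.PL)

/-- The medium access indicator of eNB `k` equals one under listen-before-talk: no AP or eNB with a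
smaller timer is received by eNB `k` with a power exceeding `Γ^L`. -/
def enbTransmits (p : Params) (s : Snapshot) (k : ℕ) : Prop :=
  (∀ j, s.mark (.timerW j) < s.mark (.timerL k) →
    s.mark (.fadeWL j k) / p.loss ‖s.enb k - s.ap j‖ ≤ p.thrL / p.PW) ∧
  (∀ m, m ≠ k → s.mark (.timerL m) < s.mark (.timerL k) →
    s.mark (.fadeL m k) / p.loss ‖s.enb m - s.enb k‖ ≤ p.thrL / p.PL)

/-- eNB `k` is the tagged eNB: it is the closest one to the typical user, who is at the origin. -/
def IsTagged (s : Snapshot) (k : ℕ) : Prop := ∀ m, ‖s.enb k‖ ≤ ‖s.enb m‖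

/-- The network model with LTE back-off window `(a,b)`: APs and eNBs form independent homogeneous
Poisson processes; the marks are mutually independent and independent of all positions; AP timers
are uniform on `[0,1]`, eNB timers are uniform on `[a,b]`, and all fading variables are exponential
with parameter `μ`. -/
structure IsLBTNetwork (p : Params) (a b : ℝ) {Ω : Type*} [MeasurableSpace Ω] (P : Measure Ω)
    (ap enb : ℕ → Ω → Plane) (mark : Mark → Ω → ℝ) : Prop where
  poisson_ap : IsPoissonProcess P ap (ENNReal.ofReal p.lamW • volume)
  poisson_enb : IsPoissonProcess P enb (ENNReal.ofReal p.lamL • volume)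
  measurable_mark : ∀ m, Measurable (mark m)
  indep_positions : IndepFun (fun ω n => ap n ω) (fun ω n => enb n ω) P
  indep_marks : IndepFun (fun ω => ((fun n => ap n ω), (fun n => enb n ω))) (fun ω m => mark m ω) P
  iIndep_marks : iIndepFun mark P
  timerW_law : ∀ i, pdf.IsUniform (mark (.timerW i)) (Set.Icc 0 1) P
  timerL_law : ∀ k, pdf.IsUniform (mark (.timerL k)) (Set.Icc a b) P
  fadeW_law : ∀ j i, HasLaw (mark (.fadeW j i)) (expMeasure p.mu) P
  fadeL_law : ∀ m k, HasLaw (mark (.fadeL m k)) (expMeasure p.mu) P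
  fadeLW_law : ∀ m i, HasLaw (mark (.fadeLW m i)) (expMeasure p.mu) P
  fadeWL_law : ∀ j k, HasLaw (mark (.fadeWL j k)) (expMeasure p.mu) P

/-- The Palm distribution of the network given an AP at `x` and an eNB at `y`, as a measure on
realizations together with the indices `(i, k)` of the AP at `x` and of the eNB at `y`.

For a stationary point process `Φ` of intensity `lam` the Palm distribution at `x` is
`E ↦ (lam |A|)⁻¹ 𝔼 ∑_{z ∈ Φ ∩ A} 1{Φ - z + x ∈ E}`, where `A` is any window of finite positive area.
Here this is done for the two independent stationary processes of APs and eNBs, with windows `A` and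
`B`, and every node and channel keeps its marks. -/
def palm (p : Params) {Ω : Type*} [MeasurableSpace Ω] (P : Measure Ω)
    (ap enb : ℕ → Ω → Plane) (mark : Mark → Ω → ℝ) (A B : Set Plane) (x y : Plane) :
    Measure (Snapshot × ℕ × ℕ) :=
  (ENNReal.ofReal p.lamW * volume A * (ENNReal.ofReal p.lamL * volume B))⁻¹ •
    Measure.sum (fun ik : ℕ × ℕ =>
      (P.restrict {ω | ap ik.1 ω ∈ A ∧ enb ik.2 ω ∈ B}).map (fun ω =>
        (Snapshot.translate ((fun n => ap n ω), (fun n => enb n ω), (fun m => mark m ω))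
          (x - ap ik.1 ω) (y - enb ik.2 ω), ik)))

/-- The event that the AP at the Palm point `x` transmits. -/
def apEvent (p : Params) : Set (Snapshot × ℕ × ℕ) := {q | apTransmits p q.1 q.2.1}

/-- The event that the eNB at the Palm point `y` is the tagged eNB and transmits. -/
def taggedEnbEvent (p : Params) : Set (Snapshot × ℕ × ℕ) :=
  {q | IsTagged q.1 q.2.2 ∧ enbTransmits p q.1 q.2.2}

/-- The conditional medium access probability `h₃^W(r₀, x)`. -/
def h3W (p : Params) (r₀ : ℝ) (x : Plane) : ℝ :=
  let y₀ : Plane := !₂[r₀, 0]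
  let N₁ := p.NW3 p.thrL + p.NL1 r₀ p.thrL
  let N₂ := p.NW + p.NL0 x r₀ p.thrED
  let N₃ := p.CW0 (y₀ - x) p.thrL 0 p.thrCS + p.CL0 x p.thrED y₀ p.thrL
  p.V (x - y₀) (p.thrL / p.PW) (p.thrED / p.PL) N₁ N₂ N₃ / p.U (x - y₀) (p.thrL / p.PW) N₁

end Coexist

end

namespace Coexist

/-! ### Infinite products of numbers in `[0,1]` -/

/-! Fix the timers `t` of the AP at `x` and `s` of the eNB at `y`, together with the fading between
these two nodes. Every inequality in the joint event then involves at most one further node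
(`jointEvent_iff`). Hence, for frozen positions, the conditional probability of the event is an
infinite product over the other nodes of the probability that the node does not block. The marks of
one node are a single uniform timer and two independent exponential fadings, so by
inclusion-exclusion it blocks with probability `t * p + s * q - min t s * p * q`, where `p` and `q`
are the probabilities that its two channels exceed their thresholds (`nodeLaw_good`). The
requirement that the eNB at `y` be tagged is absorbed by letting every eNB strictly inside the disc
of radius `‖y‖` block with probability one.

Averaging such a product over a Poisson process seen from one of its points is Slivnyak's theorem
combined with the generating functional: the result is the exponential of minus the integrated
blocking probability (`palmCampbell_blockProb`). It is derived here from the law and independence of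
the counts alone. Step functions reduce to `𝔼[N c ^ (N - 1)]` and `𝔼[c ^ N]` for Poisson `N`;
measurable functions follow by monotone limits (`IsPoissonProcess.campbell_eq`). The translation
that moves the random point to a fixed place is handled by cutting the window into small cells, on
which the translation is almost constant (`IsPoissonProcess.palmCampbell_eq`).

Both processes together give the void probability of the disc times `exp (-(t * N₂ + s * N₁ - min t
s * N₃))` (`clearProb_eq`). Between the two Palm nodes only the one with the smaller timer can block
the other, which adds a factor `1 - exp (-μ θ l)` depending on the order of `t` and `s`. Integration
over the two triangles of the unit square produces the two `M` terms of `V`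
(`lintegral_mutualProb_both`). Dropping the requirement on the AP, encoded by `b = false`, produces
`U` (`lintegral_mutualProb_right`). The void probability is common to both and cancels in the
quotient; positivity of `U` makes the conditioning legitimate. -/

/-- The infinite product of a family in `[0,1]`, as the infimum of its finite subproducts. -/
noncomputable def infProd {ι : Type*} (a : ι → ℝ≥0∞) : ℝ≥0∞ := ⨅ s : Finset ι, ∏ j ∈ s, a j

/-- The infinite product over all indices other than `i`. -/
noncomputable def redProd (a : ℕ → ℝ≥0∞) (i : ℕ) : ℝ≥0∞ := infProd (Function.update a i 1)

lemma infProd_mono {ι : Type*} {a b : ι → ℝ≥0∞} (h : ∀ j, a j ≤ b j) : infProd a ≤ infProd b :=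
  iInf_mono fun _ => Finset.prod_le_prod' fun j _ => h j

lemma infProd_le_one {ι : Type*} (a : ι → ℝ≥0∞) : infProd a ≤ 1 :=
  (iInf_le _ ∅).trans (by simp)

lemma update_one_mono {a b : ℕ → ℝ≥0∞} (h : ∀ j, a j ≤ b j) (i j : ℕ) :
    Function.update a i 1 j ≤ Function.update b i 1 j := by
  by_cases hj : j = i
  · subst hj; simp
  · simp [Function.update_of_ne hj, h]

lemma redProd_mono {a b : ℕ → ℝ≥0∞} (h : ∀ j, a j ≤ b j) (i : ℕ) : redProd a i ≤ redProd b i :=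
  infProd_mono (update_one_mono h i)

/-- Factors at most one can only lower a subproduct, so the infimum is reached on any finite set
that carries all the factors different from one. -/
lemma infProd_eq_prod {ι : Type*} {a : ι → ℝ≥0∞} (h1 : ∀ j, a j ≤ 1) (T : Finset ι)
    (hT : ∀ j ∉ T, a j = 1) : infProd a = ∏ j ∈ T, a j := by
  classical
  refine le_antisymm (iInf_le _ T) (le_iInf fun s => ?_)
  calc ∏ j ∈ T, a j = ∏ j ∈ T ∪ s, a j :=
        Finset.prod_subset Finset.subset_union_left fun j _ hj => hT j hj
    _ ≤ ∏ j ∈ s, a j :=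
        Finset.prod_le_prod_of_subset_of_le_one' Finset.subset_union_right fun j _ _ => h1 j

lemma measurable_infProd {ι α : Type*} [Countable ι] [MeasurableSpace α] {a : α → ι → ℝ≥0∞}
    (h : ∀ j, Measurable fun x => a x j) : Measurable fun x => infProd (a x) :=
  Measurable.iInf fun _ => Finset.measurable_fun_prod _ fun j _ => h j

lemma measurable_redProd {α : Type*} [MeasurableSpace α] {a : α → ℕ → ℝ≥0∞}
    (h : ∀ j, Measurable fun x => a x j) (i : ℕ) : Measurable fun x => redProd (a x) i := by
  refine measurable_infProd fun j => ?_
  by_cases hj : j = i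
  · subst hj; simp
  · simpa [Function.update_of_ne hj] using h j

/-- The two infima commute, and a finite product is continuous along decreasing sequences of finite
values. This is what lets the Campbell formula pass to decreasing limits. -/
lemma infProd_iInf {ι : Type*} {a : ℕ → ι → ℝ≥0∞} (ha : Antitone a) (h1 : ∀ n j, a n j ≤ 1) :
    infProd (fun j => ⨅ n, a n j) = ⨅ n, infProd (a n) := by
  unfold infProd
  rw [iInf_comm]
  refine iInf_congr fun s => ?_
  have hne : ∀ j, ⨅ n, a n j ≠ ∞ := fun j =>
    ne_top_of_le_ne_top ENNReal.one_ne_top ((iInf_le _ 0).trans (h1 0 j))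
  have h2 := ENNReal.tendsto_finsetProd_of_ne_top (f := fun j n => a n j) s
    (fun j _ => tendsto_atTop_iInf (f := fun n => a n j) fun m n h => ha h j) fun j _ => hne j
  exact tendsto_nhds_unique h2 (tendsto_atTop_iInf fun m n h =>
    Finset.prod_le_prod' fun j _ => ha h j)

lemma redProd_iInf {a : ℕ → ℕ → ℝ≥0∞} (ha : Antitone a) (h1 : ∀ n j, a n j ≤ 1) (i : ℕ) :
    redProd (fun j => ⨅ n, a n j) i = ⨅ n, redProd (a n) i := by
  unfold redProd
  rw [← infProd_iInf (fun m n h j => update_one_mono (fun j => ha h j) i j)]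
  · congr 1
    funext j
    by_cases hj : j = i
    · subst hj; simp
    · simp [Function.update_of_ne hj]
  · intro n j
    by_cases hj : j = i
    · subst hj; simp
    · simp [Function.update_of_ne hj, h1]

/-- A finite set of indices in a sum type is a pair of finite sets, so the infimum over it is an
iterated infimum. It separates the APs from the eNBs; the bound on `a` excludes products `0 * ∞`. -/
lemma infProd_sum {ι κ : Type*} {a : ι → ℝ≥0∞} {b : κ → ℝ≥0∞} (ha : ∀ j, a j ≤ 1) :
    infProd (Sum.elim a b) = infProd a * infProd b := by
  classical
  have hs : ∀ (u : Finset ι) (v : Finset κ),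
      ∏ j ∈ u.disjSum v, Sum.elim a b j = (∏ j ∈ u, a j) * ∏ j ∈ v, b j := by
    intro u v; simp [Finset.prod_disjSum]
  have key : ∀ {X : Type _} (c : X → ℝ≥0∞), (∀ j, c j ≤ 1) → ∀ u : Finset X, ∏ j ∈ u, c j ≠ ∞ :=
    fun c hc u => ne_top_of_le_ne_top ENNReal.one_ne_top (Finset.prod_le_one' fun j _ => hc j)
  apply le_antisymm
  · unfold infProd
    rw [ENNReal.iInf_mul' (fun h => absurd h ?_) ?_]
    · refine le_iInf fun u => ?_
      rw [ENNReal.mul_iInf' (fun h => absurd h ?_) ?_]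
      · refine le_iInf fun v => ?_
        rw [← hs]; exact iInf_le _ _
      · exact fun _ => ⟨∅⟩
      · exact key a ha u
    · exact fun _ => ⟨∅⟩
    · exact ne_top_of_le_ne_top ENNReal.one_ne_top (infProd_le_one b)
  · refine le_iInf fun s => ?_
    have : s = s.toLeft.disjSum s.toRight := Finset.toLeft_disjSum_toRight.symm
    rw [this, hs]
    exact mul_le_mul' (iInf_le _ _) (iInf_le _ _)

/-! ### Poisson expectations -/

/-- `exp (-a)` for an extended nonnegative real `a`, which is assumed finite. -/
noncomputable def expNeg (a : ℝ≥0∞) : ℝ≥0∞ := ENNReal.ofReal (Real.exp (-a.toReal))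

lemma expNeg_add {a b : ℝ≥0∞} (ha : a ≠ ∞) (hb : b ≠ ∞) : expNeg (a + b) = expNeg a * expNeg b := by
  rw [expNeg, expNeg, expNeg, ENNReal.toReal_add ha hb, neg_add, Real.exp_add,
    ENNReal.ofReal_mul (Real.exp_nonneg _)]

@[simp] lemma expNeg_zero : expNeg 0 = 1 := by simp [expNeg]

lemma expNeg_sum {ι : Type*} (s : Finset ι) {a : ι → ℝ≥0∞} (ha : ∀ i ∈ s, a i ≠ ∞) :
    expNeg (∑ i ∈ s, a i) = ∏ i ∈ s, expNeg (a i) := by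
  classical
  induction s using Finset.induction_on with
  | empty => simp
  | insert i s hi ih =>
    rw [Finset.sum_insert hi, Finset.prod_insert hi,
      expNeg_add (ha i (Finset.mem_insert_self _ _))
        (ENNReal.sum_ne_top.2 fun j hj => ha j (Finset.mem_insert_of_mem hj)),
      ih fun j hj => ha j (Finset.mem_insert_of_mem hj)]

lemma lintegral_poissonMeasure (r : NNReal) (ψ : ℕ → ℝ≥0∞) :
    ∫⁻ k, ψ k ∂(poissonMeasure r)
      = ∑' k : ℕ, ENNReal.ofReal (Real.exp (-r) * r ^ k / k.factorial) * ψ k := by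
  rw [poissonMeasure, lintegral_sum_measure]
  simp [lintegral_smul_measure, lintegral_dirac]

/-- The generating function of the Poisson law, from the exponential series at `r * c`. -/
lemma lintegral_poissonMeasure_pow (r c : NNReal) (hc : c ≤ 1) :
    ∫⁻ k, (c : ℝ≥0∞) ^ k ∂(poissonMeasure r) = expNeg (r * (1 - c)) := by
  rw [lintegral_poissonMeasure]
  have h := (NormedSpace.expSeries_div_hasSum_exp ((r : ℝ) * c)).mul_left (Real.exp (-r))
  rw [← Real.exp_eq_exp_ℝ, ← Real.exp_add] at h
  have e : expNeg ((r : ℝ≥0∞) * (1 - c)) = ENNReal.ofReal (Real.exp (-r + r * c)) := by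
    rw [expNeg, ENNReal.toReal_mul, ENNReal.toReal_sub_of_le (by exact_mod_cast hc) (by simp)]
    simp only [ENNReal.coe_toReal, ENNReal.toReal_one]
    congr 2; ring
  rw [e, ← h.tsum_eq, ENNReal.ofReal_tsum_of_nonneg (fun n => by positivity) h.summable]
  refine tsum_congr fun k => ?_
  rw [← ENNReal.ofReal_coe_nnreal, ← ENNReal.ofReal_pow (by positivity),
    ← ENNReal.ofReal_mul (by positivity)]
  congr 1
  rw [mul_pow]; ring

/-- The shift `k * r ^ k / k! = r * r ^ (k - 1) / (k - 1)!` reduces this to the generating function.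
The factor `k` counts the choices of a distinguished point and the power weights the others, so this
is Slivnyak's formula for a single cell. -/
lemma lintegral_poissonMeasure_mul_pow (r c : NNReal) (hc : c ≤ 1) :
    ∫⁻ k, (k : ℝ≥0∞) * (c : ℝ≥0∞) ^ (k - 1) ∂(poissonMeasure r) = r * expNeg (r * (1 - c)) := by
  rw [← lintegral_poissonMeasure_pow r c hc, lintegral_poissonMeasure, lintegral_poissonMeasure,
    tsum_eq_zero_add' ENNReal.summable, ← ENNReal.tsum_mul_left]
  simp only [Nat.cast_zero, zero_mul, mul_zero, zero_add, Nat.add_sub_cancel]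
  refine tsum_congr fun k => ?_
  rw [← mul_assoc, ← mul_assoc, ← ENNReal.ofReal_coe_nnreal (p := r),
    ← ENNReal.ofReal_natCast (k + 1),
    ← ENNReal.ofReal_mul (by positivity), ← ENNReal.ofReal_mul (by positivity)]
  congr 2
  rw [Nat.factorial_succ]; push_cast
  field_simp
  ring

section
set_option linter.unusedSectionVars false

variable {Ω E : Type*} [MeasurableSpace Ω] [MeasurableSpace E] {P : Measure Ω}
  {X : ℕ → Ω → E} {ν : Measure E}

lemma IsPoissonProcess.measurable_count (hX : IsPoissonProcess P X ν) {B : Set E}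
    (hB : MeasurableSet B) : Measurable (count X B) :=
  Measurable.tsum fun n => (measurable_const.indicator hB).comp (hX.measurable n)

lemma IsPoissonProcess.lintegral_count (hX : IsPoissonProcess P X ν) {B : Set E}
    (hB : MeasurableSet B) (hB' : ν B ≠ ∞) {ψ : ℝ≥0∞ → ℝ≥0∞} (hψ : Measurable ψ) :
    ∫⁻ ω, ψ (count X B ω) ∂P = ∫⁻ k : ℕ, ψ k ∂(poissonMeasure (ν B).toNNReal) := by
  rw [(hX.law B hB hB').lintegral_comp hψ.aemeasurable,
    lintegral_map hψ (measurable_of_countable _)]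

lemma IsPoissonProcess.count_ne_top (hX : IsPoissonProcess P X ν) {B : Set E}
    (hB : MeasurableSet B) (hB' : ν B ≠ ∞) : ∀ᵐ ω ∂P, count X B ω ≠ ∞ := by
  have h := (hX.law B hB hB').ae_iff (p := fun a => a ≠ ∞)
    (measurableSet_setOfPred.1 (measurableSet_singleton ∞).compl)
  refine h.2 ((ae_map_iff (measurable_of_countable _).aemeasurable
    (measurableSet_singleton ∞).compl).2 ?_)
  simp

/-! ### The reduced Campbell formula for step functions -/

open Classical in
/-- The function equal to `c l` on the set `C l` and to `1` outside all these sets. -/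
noncomputable def stepFun {ι : Type*} [Fintype ι] (C : ι → Set E) (c : ι → ℝ≥0∞) (z : E) : ℝ≥0∞ :=
  ∏ l, if z ∈ C l then c l else 1

/-- Only indices whose point lies in some cell contribute, and there are finitely many. Omitting `i`
lowers the exponent of its own cell by one and, by disjointness, no other; that cell contains `x i`,
so the truncated subtraction is a true one. -/
lemma redProd_stepFun {ι : Type*} [Fintype ι] [DecidableEq ι] {C : ι → Set E} {c : ι → ℝ≥0∞}
    (hC : Pairwise fun l l' => Disjoint (C l) (C l')) (hc : ∀ l, c l ≤ 1) {x : ℕ → E}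
    (hfin : ∀ l, {j | x j ∈ C l}.Finite) {l₀ : ι} {i : ℕ} (hi : x i ∈ C l₀) :
    redProd (fun j => stepFun C c (x j)) i
      = ∏ l, c l ^ (if l = l₀ then {j | x j ∈ C l}.ncard - 1 else {j | x j ∈ C l}.ncard) := by
  classical
  have h1 : ∀ z, stepFun C c z ≤ 1 := fun z => Finset.prod_le_one' fun l _ => by
    split_ifs
    · exact hc l
    · exact le_rfl
  set T : Finset ℕ := Finset.univ.biUnion fun l => (hfin l).toFinset with hT
  have hTm : ∀ j l, x j ∈ C l → j ∈ T := fun j l h => by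
    simp only [hT, Finset.mem_biUnion, Finset.mem_univ, true_and, Set.Finite.mem_toFinset]
    exact ⟨l, h⟩
  unfold redProd
  rw [infProd_eq_prod _ (T.erase i)]
  · have : ∀ j ∈ T.erase i, Function.update (fun j => stepFun C c (x j)) i 1 j
        = ∏ l, if x j ∈ C l then c l else 1 := fun j hj => by
      rw [Function.update_of_ne (Finset.ne_of_mem_erase hj)]; rfl
    rw [Finset.prod_congr rfl this, Finset.prod_comm]
    refine Finset.prod_congr rfl fun l _ => ?_
    rw [Finset.prod_ite, Finset.prod_const, Finset.prod_const_one, mul_one]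
    congr 1
    have hf : (T.erase i).filter (fun j => x j ∈ C l) = (hfin l).toFinset.erase i := by
      ext j
      simp only [Finset.mem_filter, Finset.mem_erase, Set.Finite.mem_toFinset]
      exact ⟨fun h => ⟨h.1.1, h.2⟩, fun h => ⟨⟨h.1, hTm j l h.2⟩, h.2⟩⟩
    rw [hf, Set.ncard_eq_toFinset_card _ (hfin l)]
    split_ifs with hl
    · subst hl
      exact Finset.card_erase_of_mem (by simpa using hi)
    · congr 1
      refine Finset.erase_eq_of_notMem fun h => ?_
      exact (Set.disjoint_left.1 (hC hl)) (by simpa using h) hi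
  · intro j hj
    by_cases hji : j = i
    · subst hji; simp
    · rw [Function.update_of_ne hji]
      refine Finset.prod_eq_one fun l _ => if_neg fun h => hj ?_
      exact Finset.mem_erase.2 ⟨hji, hTm j l h⟩
  · intro j
    by_cases hj : j = i
    · subst hj; simp
    · simpa [Function.update_of_ne hj] using h1 _

/-- The sum over the points of the process in `A` of the product of `f` over all other points,
in expectation. -/
noncomputable def campbell (P : Measure Ω) (X : ℕ → Ω → E) (A : Set E) (f : E → ℝ≥0∞) : ℝ≥0∞ :=
  ∑' i, ∫⁻ ω, A.indicator 1 (X i ω) * redProd (fun j => f (X j ω)) i ∂P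

/-- The count is a sum of ones over indices, so its finiteness is finiteness of the index set. This
converts almost sure finiteness of Poisson counts into honest finite products. -/
lemma count_eq_ncard {B : Set E} {ω : Ω} (h : count X B ω ≠ ∞) :
    {j | X j ω ∈ B}.Finite ∧ count X B ω = ({j | X j ω ∈ B}.ncard : ℝ≥0∞) := by
  have h1 : count X B ω = ({j | X j ω ∈ B}.encard : ℝ≥0∞) := by
    rw [← ENNReal.tsum_set_one, tsum_subtype {j | X j ω ∈ B} fun _ => (1 : ℝ≥0∞)]
    rfl
  have hf : {j | X j ω ∈ B}.Finite := by
    rw [← Set.encard_ne_top_iff]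
    intro ht
    rw [h1, ht] at h
    simp at h
  refine ⟨hf, ?_⟩
  rw [h1, ← hf.cast_ncard_eq]
  simp

lemma IsPoissonProcess.iIndepFun_count (hX : IsPoissonProcess P X ν) {ι : Type*} [Fintype ι]
    {C : ι → Set E} (hCm : ∀ l, MeasurableSet (C l))
    (hC : Pairwise fun l l' => Disjoint (C l) (C l')) :
    iIndepFun (fun l => count X (C l)) P := by
  have e := Fintype.equivFin ι
  have h := hX.indep (Fintype.card ι) (fun i => C (e.symm i)) (fun i => hCm _)
    fun i j hij => hC (e.symm.injective.ne hij)
  have h2 := h.precomp e.injective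
  simpa [Function.comp_def] using h2

lemma measurable_stepFun {ι : Type*} [Fintype ι] {C : ι → Set E} {c : ι → ℝ≥0∞}
    (hCm : ∀ l, MeasurableSet (C l)) : Measurable (stepFun C c) :=
  Finset.measurable_fun_prod _ fun l _ => Measurable.ite (hCm l) measurable_const measurable_const

lemma IsPoissonProcess.measurable_campbell_term (hX : IsPoissonProcess P X ν) {A : Set E}
    (hA : MeasurableSet A) {f : E → ℝ≥0∞} (hf : Measurable f) (i : ℕ) :
    Measurable fun ω => A.indicator 1 (X i ω) * redProd (fun j => f (X j ω)) i :=
  ((measurable_one.indicator hA).comp (hX.measurable i)).mul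
    (measurable_redProd (fun j => hf.comp (hX.measurable j)) i)

/-- Summing the reduced product over the points in `C l₀` gives `N * c ^ (N - 1)` for that cell
times `c ^ N` for each other cell. The counts are independent and Poisson, so the expectation
factors. -/
lemma IsPoissonProcess.campbell_stepFun (hX : IsPoissonProcess P X ν) {ι : Type*} [Fintype ι]
    {C : ι → Set E} {c : ι → ℝ≥0∞} (hCm : ∀ l, MeasurableSet (C l)) (hCν : ∀ l, ν (C l) ≠ ∞)
    (hC : Pairwise fun l l' => Disjoint (C l) (C l')) (hc : ∀ l, c l ≤ 1) (l₀ : ι) :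
    campbell P X (C l₀) (stepFun C c) = ν (C l₀) * expNeg (∑ l, ν (C l) * (1 - c l)) := by
  classical
  -- Counts take values in `ℝ≥0∞`; the floor recovers the natural exponent and keeps each factor a
  -- measurable function of its count, as independence requires.
  let ψ : ι → ℝ≥0∞ → ℝ≥0∞ := fun l N =>
    (if l = l₀ then N else 1) * c l ^ (if l = l₀ then ⌊N.toReal⌋₊ - 1 else ⌊N.toReal⌋₊)
  have hψ : ∀ l, Measurable (ψ l) := fun l => by
    have hfl : Measurable fun N : ℝ≥0∞ => ⌊N.toReal⌋₊ :=
      Nat.measurable_floor.comp ENNReal.measurable_toReal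
    by_cases hl : l = l₀
    · simp only [ψ, hl, if_true]
      exact measurable_id.mul
        ((measurable_from_nat (f := fun n => c l₀ ^ (n - 1))).comp hfl)
    · simp only [ψ, hl, if_false, one_mul]
      exact (measurable_from_nat (f := fun n => c l ^ n)).comp hfl
  have hsum : ∀ᵐ ω ∂P, ∑' i, (C l₀).indicator 1 (X i ω) *
      redProd (fun j => stepFun C c (X j ω)) i = ∏ l, ψ l (count X (C l) ω) := by
    filter_upwards [ae_all_iff.2 fun l => hX.count_ne_top (hCm l) (hCν l)] with ω hω
    have hfin := fun l => (count_eq_ncard (hω l)).1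
    have hN := fun l => (count_eq_ncard (hω l)).2
    have h1 : ∀ i, (C l₀).indicator 1 (X i ω) * redProd (fun j => stepFun C c (X j ω)) i
        = (C l₀).indicator (fun _ => (1 : ℝ≥0∞)) (X i ω) * ∏ l, c l ^ (if l = l₀ then
          {j | X j ω ∈ C l}.ncard - 1 else {j | X j ω ∈ C l}.ncard) := fun i => by
      by_cases hi : X i ω ∈ C l₀
      · rw [redProd_stepFun hC hc hfin hi]; rfl
      · simp [hi]
    rw [tsum_congr h1, ENNReal.tsum_mul_right]
    change count X (C l₀) ω * _ = _
    simp only [ψ, Finset.prod_mul_distrib, hN, ENNReal.toReal_natCast, Nat.floor_natCast]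
    congr 1
    simp
  have hP : ∀ l, ∫⁻ ω, ψ l (count X (C l) ω) ∂P
      = (if l = l₀ then ν (C l) else 1) * expNeg (ν (C l) * (1 - c l)) := fun l => by
    rw [hX.lintegral_count (hCm l) (hCν l) (hψ l)]
    obtain ⟨c', hc'⟩ : ∃ c' : NNReal, c l = c' :=
      ⟨(c l).toNNReal, (ENNReal.coe_toNNReal (ne_top_of_le_ne_top ENNReal.one_ne_top (hc l))).symm⟩
    have hc1 : c' ≤ 1 := by have := hc l; rw [hc'] at this; exact_mod_cast this
    by_cases hl : l = l₀
    · subst hl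
      have := lintegral_poissonMeasure_mul_pow (ν (C l)).toNNReal c' hc1
      rw [ENNReal.coe_toNNReal (hCν l)] at this
      simpa [ψ, hc'] using this
    · have := lintegral_poissonMeasure_pow (ν (C l)).toNNReal c' hc1
      rw [ENNReal.coe_toNNReal (hCν l)] at this
      simpa [ψ, hc', hl] using this
  unfold campbell
  rw [← lintegral_tsum fun i =>
      (hX.measurable_campbell_term (hCm l₀) (measurable_stepFun hCm) i).aemeasurable,
    lintegral_congr_ae hsum,
    lintegral_prod_eq_prod_lintegral_of_indepFun _ (fun l ω => ψ l (count X (C l) ω))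
      ((hX.iIndepFun_count hCm hC).comp ψ hψ)
      (fun l => (hψ l).comp (hX.measurable_count (hCm l)))]
  simp only [hP, Finset.prod_mul_distrib]
  congr 1
  · simp
  · exact (expNeg_sum _ fun l _ => ENNReal.mul_ne_top (hCν l)
      (ne_top_of_le_ne_top ENNReal.one_ne_top tsub_le_self)).symm

end

/-! ### The reduced Campbell formula for measurable functions -/

section
variable {Ω E : Type*} [MeasurableSpace Ω] [MeasurableSpace E] {P : Measure Ω}
  {X : ℕ → Ω → E} {ν : Measure E}

lemma indicator_iUnion_eq_tsum {E ι : Type*} {B : ι → Set E}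
    (hB : Pairwise fun l l' => Disjoint (B l) (B l')) (z : E) :
    (⋃ l, B l).indicator (1 : E → ℝ≥0∞) z = ∑' l, (B l).indicator 1 z := by
  by_cases hz : z ∈ ⋃ l, B l
  · obtain ⟨l, hl⟩ := Set.mem_iUnion.1 hz
    rw [tsum_eq_single l fun l' hl' => Set.indicator_of_notMem
      (fun h => (Set.disjoint_left.1 (hB hl')) h hl) _]
    simp [hz, hl]
  · rw [Set.indicator_of_notMem hz]
    have : ∀ l, (B l).indicator (1 : E → ℝ≥0∞) z = 0 := fun l =>
      Set.indicator_of_notMem (fun h => hz (Set.mem_iUnion_of_mem l h)) _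
    simp [this]

lemma IsPoissonProcess.campbell_iUnion (hX : IsPoissonProcess P X ν) {ι : Type*} [Countable ι]
    {B : ι → Set E} (hBm : ∀ l, MeasurableSet (B l))
    (hB : Pairwise fun l l' => Disjoint (B l) (B l')) {f : E → ℝ≥0∞} (hf : Measurable f) :
    campbell P X (⋃ l, B l) f = ∑' l, campbell P X (B l) f := by
  unfold campbell
  rw [ENNReal.tsum_comm]
  refine tsum_congr fun i => ?_
  simp_rw [indicator_iUnion_eq_tsum hB, ← ENNReal.tsum_mul_right]
  exact lintegral_tsum fun l => (hX.measurable_campbell_term (hBm l) hf i).aemeasurable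

lemma IsPoissonProcess.campbell_simpleFunc (hX : IsPoissonProcess P X ν) {A : Set E}
    (hA : MeasurableSet A) (hAν : ν A ≠ ∞) (g : SimpleFunc E ℝ≥0∞) (hg : ∀ z, g z ≤ 1)
    (hgν : ∫⁻ z, g z ∂ν ≠ ∞) :
    campbell P X A (fun z => 1 - g z) = ν A * expNeg (∫⁻ z, g z ∂ν) := by
  classical
  -- The cells are the level sets of `g`, cut by `A` and by its complement, so that `A` is a union
  -- of cells. The zero level outside `A` may have infinite measure; its weight would be one, so it
  -- is replaced by the empty set.
  let C : g.range × Bool → Set E := fun l =>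
    if l.1.1 = 0 ∧ l.2 = false then ∅ else g ⁻¹' {l.1.1} ∩ (if l.2 then A else Aᶜ)
  let c : g.range × Bool → ℝ≥0∞ := fun l => 1 - l.1.1
  have hsub : ∀ l, C l ⊆ g ⁻¹' {l.1.1} ∩ (if l.2 then A else Aᶜ) := fun l => by
    simp only [C]; split_ifs <;> simp
  have hCtrue : ∀ v, C (v, true) = g ⁻¹' {v.1} ∩ A := fun v => by simp [C]
  have hCm : ∀ l, MeasurableSet (C l) := fun l => by
    simp only [C]
    split_ifs
    · exact .empty
    · exact (g.measurableSet_preimage _).inter hA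
    · exact (g.measurableSet_preimage _).inter hA.compl
  have hfib : ∀ v : ℝ≥0∞, v ≠ 0 → ν (g ⁻¹' {v}) ≠ ∞ := fun v hv h => by
    apply hgν
    rw [eq_top_iff]
    calc ∞ = v * ν (g ⁻¹' {v}) := by rw [h, ENNReal.mul_top hv]
      _ = ∫⁻ z, (g ⁻¹' {v}).indicator (fun _ => v) z ∂ν :=
        (lintegral_indicator_const (g.measurableSet_preimage _) v).symm
      _ ≤ ∫⁻ z, g z ∂ν := lintegral_mono fun z => by
        by_cases hz : z ∈ g ⁻¹' {v}
        · rw [Set.indicator_of_mem hz]; exact (Set.mem_singleton_iff.1 hz).ge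
        · rw [Set.indicator_of_notMem hz]; exact zero_le
  have hCν : ∀ l, ν (C l) ≠ ∞ := by
    rintro ⟨v, b⟩
    cases b with
    | true => exact ne_top_of_le_ne_top hAν (measure_mono ((hCtrue v).trans_subset
        Set.inter_subset_right))
    | false =>
      by_cases hv : v.1 = 0
      · simp [C, hv]
      · exact ne_top_of_le_ne_top (hfib v hv) (measure_mono ((hsub _).trans Set.inter_subset_left))
  have hC : Pairwise fun l l' => Disjoint (C l) (C l') := by
    rintro ⟨v, b⟩ ⟨v', b'⟩ hne
    refine Set.disjoint_left.2 fun z hz hz' => hne ?_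
    have h1 := hsub _ hz
    have h2 := hsub _ hz'
    have hv : v = v' := Subtype.ext (h1.1.symm.trans h2.1)
    have hb : b = b' := by
      have h3 := h1.2
      have h4 := h2.2
      cases b <;> cases b' <;> simp_all
    rw [hv, hb]
  have hstep : stepFun C c = fun z => 1 - g z := by
    funext z
    have hmem : ∀ l, z ∈ C l → l = (⟨g z, g.mem_range_self z⟩, decide (z ∈ A)) := by
      rintro ⟨v, b⟩ h
      have h1 := hsub _ h
      have hv : v = ⟨g z, g.mem_range_self z⟩ := Subtype.ext h1.1.symm
      have h2 := h1.2
      cases b <;> simp_all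
    unfold stepFun
    rw [Finset.prod_eq_single (⟨g z, g.mem_range_self z⟩, decide (z ∈ A))
      (fun l _ hl => if_neg fun h => hl (hmem l h)) (fun h => absurd (Finset.mem_univ _) h)]
    by_cases hzA : z ∈ A
    · simp [C, c, hzA]
    · by_cases hz : g z = 0
      · simp [C, c, hzA, hz]
      · simp [C, c, hzA, hz]
  have hAU : A = ⋃ v : g.range, C (v, true) := by
    ext z
    simp only [hCtrue, Set.mem_iUnion, Set.mem_inter_iff, Set.mem_preimage, Set.mem_singleton_iff]
    exact ⟨fun h => ⟨⟨g z, g.mem_range_self z⟩, rfl, h⟩, fun ⟨_, h⟩ => h.2⟩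
  have hC' : Pairwise fun v v' => Disjoint (C (v, true)) (C (v', true)) := fun v v' hv =>
    hC fun h => hv (Prod.ext_iff.1 h).1
  have hint : ∑ l, ν (C l) * (1 - c l) = ∫⁻ z, g z ∂ν := by
    rw [SimpleFunc.lintegral_eq_lintegral g ν, SimpleFunc.lintegral, ← Finset.sum_coe_sort g.range,
      Fintype.sum_prod_type]
    refine Finset.sum_congr rfl fun v _ => ?_
    have hv1 : v.1 ≤ 1 := by
      obtain ⟨z, hz⟩ := SimpleFunc.mem_range.1 v.2
      rw [← hz]; exact hg z
    have hc' : ∀ b, 1 - c (v, b) = v.1 := fun b => ENNReal.sub_sub_cancel ENNReal.one_ne_top hv1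
    simp only [Fintype.sum_bool, hc']
    by_cases hv : v.1 = 0
    · simp [hv]
    · rw [← add_mul, mul_comm]
      congr 1
      simp only [C, hv, false_and, if_false, if_true, Bool.false_eq_true]
      exact measure_inter_add_sdiff _ hA
  have hcamp := fun v : g.range => hX.campbell_stepFun (c := c) hCm hCν hC
    (fun l => tsub_le_self) (v, true)
  rw [hstep, hint] at hcamp
  have hm : Measurable fun z => 1 - g z := g.measurable.const_sub 1
  conv_lhs => rw [hAU]
  rw [hX.campbell_iUnion (fun v => hCm _) hC' hm]
  simp_rw [hcamp]
  rw [ENNReal.tsum_mul_right, ← measure_iUnion hC' fun v => hCm _, ← hAU]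

lemma continuousAt_expNeg {a : ℝ≥0∞} (ha : a ≠ ∞) : ContinuousAt expNeg a :=
  (ENNReal.continuous_ofReal.comp Real.continuous_exp).continuousAt.comp
    (ENNReal.tendsto_toReal ha).neg

/-- Turning the sum over indices into an integral against the counting measure allows one monotone
convergence argument for the sum and the expectation together. -/
lemma campbell_eq_lintegral_prod [SFinite P] (hX : IsPoissonProcess P X ν) {A : Set E}
    (hA : MeasurableSet A) {f : E → ℝ≥0∞} (hf : Measurable f) :
    campbell P X A f = ∫⁻ q : ℕ × Ω, A.indicator 1 (X q.1 q.2) *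
      redProd (fun j => f (X j q.2)) q.1 ∂(Measure.count.prod P) := by
  rw [lintegral_prod _ (measurable_from_prod_countable_right
      fun i => hX.measurable_campbell_term hA hf i).aemeasurable, lintegral_count]
  rfl

/-- **Reduced Campbell formula** for a Poisson process and a multiplicative functional. -/
theorem IsPoissonProcess.campbell_eq [SFinite P] (hX : IsPoissonProcess P X ν) {A : Set E}
    (hA : MeasurableSet A) (hAν : ν A ≠ ∞) {g : E → ℝ≥0∞} (hgm : Measurable g)
    (hg : ∀ z, g z ≤ 1) (hgν : ∫⁻ z, g z ∂ν ≠ ∞) :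
    campbell P X A (fun z => 1 - g z) = ν A * expNeg (∫⁻ z, g z ∂ν) := by
  let G := SimpleFunc.eapprox g
  have hGg : ∀ n z, G n z ≤ g z := fun n z => by
    rw [← SimpleFunc.iSup_eapprox_apply hgm z]; exact le_iSup (fun n => G n z) n
  have hGν : ∀ n, ∫⁻ z, G n z ∂ν ≠ ∞ := fun n =>
    ne_top_of_le_ne_top hgν (lintegral_mono (hGg n))
  have hGm : ∀ n, Measurable fun z => 1 - G n z := fun n => (G n).measurable.const_sub 1
  have hn : ∀ n, campbell P X A (fun z => 1 - G n z) = ν A * expNeg (∫⁻ z, G n z ∂ν) := fun n =>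
    hX.campbell_simpleFunc hA hAν (G n) (fun z => (hGg n z).trans (hg z)) (hGν n)
  have hanti : Antitone fun n (z : E) => 1 - G n z := fun m n h z =>
    tsub_le_tsub_left (SimpleFunc.monotone_eapprox g h z) 1
  have hinf : ∀ z, ⨅ n, (1 - G n z) = 1 - g z := fun z => by
    rw [← ENNReal.sub_iSup (by simp), SimpleFunc.iSup_eapprox_apply hgm z]
  have hterm : ∀ n, Measurable fun q : ℕ × Ω => A.indicator 1 (X q.1 q.2) *
      redProd (fun j => 1 - G n (X j q.2)) q.1 := fun n =>
    measurable_from_prod_countable_right fun i => hX.measurable_campbell_term hA (hGm n) i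
  -- As `G n` increases to `g`, the reduced products decrease. Convergence from above needs one
  -- finite integral, and the value at `n = 0` is known from `hn 0`.
  have hlim : campbell P X A (fun z => 1 - g z) = ⨅ n, campbell P X A fun z => 1 - G n z := by
    rw [campbell_eq_lintegral_prod hX hA (hgm.const_sub 1)]
    simp_rw [fun n => campbell_eq_lintegral_prod hX hA (hGm n)]
    rw [← lintegral_iInf hterm]
    · refine lintegral_congr fun q => ?_
      rw [← ENNReal.mul_iInf' (fun h => ?_) fun _ => ⟨0⟩,
        ← redProd_iInf (a := fun n j => 1 - G n (X j q.2)) (fun m n h j => hanti h _)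
          fun n j => tsub_le_self]
      · simp_rw [hinf]
      · by_cases hq : X q.1 q.2 ∈ A <;> simp [hq] at h
    · intro m n h q
      exact mul_le_mul_right (redProd_mono (fun j => hanti h _) _) _
    · rw [← campbell_eq_lintegral_prod hX hA (hGm 0), hn 0]
      exact ENNReal.mul_ne_top hAν ENNReal.ofReal_ne_top
  rw [hlim]
  refine tendsto_nhds_unique (tendsto_atTop_iInf fun m n h => ?_) ?_
  · exact ENNReal.tsum_le_tsum fun i => lintegral_mono fun ω =>
      mul_le_mul_right (redProd_mono (fun j => hanti h _) _) _
  · simp_rw [hn]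
    refine ENNReal.Tendsto.const_mul ?_ (Or.inr hAν)
    refine (continuousAt_expNeg hgν).tendsto.comp ?_
    have := lintegral_tendsto_of_tendsto_of_monotone (μ := ν) (f := fun n z => G n z) (F := g)
      (fun n => (G n).measurable.aemeasurable)
      (.of_forall fun z m n h => SimpleFunc.monotone_eapprox g h z)
      (.of_forall fun z => SimpleFunc.tendsto_eapprox hgm z)
    exact this

end

/-! ### The reduced Campbell formula seen from the points of the process -/

section
variable {Ω E : Type*} [MeasurableSpace Ω] [NormedAddCommGroup E] [MeasurableSpace E]
  [BorelSpace E] {P : Measure Ω} {X : ℕ → Ω → E} {ν : Measure E}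

/-- By invariance of `ν` the shift `u k` leaves the exponent unchanged, so each cell contributes its
own measure times a common exponential. -/
lemma IsPoissonProcess.tsum_campbell_cells [SFinite P] [ν.IsAddRightInvariant]
    (hX : IsPoissonProcess P X ν) {A : Set E} (hAν : ν A ≠ ∞)
    {B : ℕ → Set E} (hBm : ∀ l, MeasurableSet (B l))
    (hB : Pairwise fun l l' => Disjoint (B l) (B l')) (hAB : A = ⋃ l, B l) (u : ℕ → E)
    {h : E → ℝ≥0∞} (hm : Measurable h) (h1 : ∀ z, h z ≤ 1) (hν : ∫⁻ z, h z ∂ν ≠ ∞) :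
    ∑' k, campbell P X (B k) (fun z => 1 - h (z + u k)) = ν A * expNeg (∫⁻ z, h z ∂ν) := by
  have hk : ∀ k, campbell P X (B k) (fun z => 1 - h (z + u k))
      = ν (B k) * expNeg (∫⁻ z, h z ∂ν) := fun k => by
    have hi := lintegral_add_right_eq_self (μ := ν) h (u k)
    have hBk : ν (B k) ≠ ∞ :=
      ne_top_of_le_ne_top hAν (measure_mono (hAB ▸ Set.subset_iUnion B k))
    rw [hX.campbell_eq (hBm k) hBk (g := fun z => h (z + u k))
      (hm.comp (measurable_id.add_const _)) (fun z => h1 _) (by rwa [hi]), hi]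
  simp_rw [hk]
  rw [ENNReal.tsum_mul_right, ← measure_iUnion hB hBm, ← hAB]

variable [SecondCountableTopology E]

/-- The sum over the points of the process in `A` of the product of `f` over all other points,
after the translation that moves the point to `x`, in expectation. -/
noncomputable def palmCampbell (P : Measure Ω) (X : ℕ → Ω → E) (A : Set E) (x : E)
    (f : E → ℝ≥0∞) : ℝ≥0∞ :=
  ∑' i, ∫⁻ ω, A.indicator 1 (X i ω) * redProd (fun j => f (X j ω + (x - X i ω))) i ∂P

lemma measurable_palmCampbell_term (hX : ∀ i, Measurable (X i)) {A : Set E}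
    (hA : MeasurableSet A) (x : E) {f : E → ℝ≥0∞} (hf : Measurable f) (i : ℕ) :
    Measurable fun ω => A.indicator 1 (X i ω) * redProd (fun j => f (X j ω + (x - X i ω))) i :=
  ((measurable_one.indicator hA).comp (hX i)).mul
    (measurable_redProd (fun j => hf.comp ((hX j).add ((hX i).const_sub x))) i)

/-- Balls of radius `ε` about a dense sequence cover the space; they are made disjoint and cut by
`A`. -/
lemma exists_cells (A : Set E) (hA : MeasurableSet A) {ε : ℝ} (hε : 0 < ε) :
    ∃ (B : ℕ → Set E) (d : ℕ → E), (∀ k, MeasurableSet (B k)) ∧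
      (Pairwise fun k l => Disjoint (B k) (B l)) ∧ A = ⋃ k, B k ∧
      ∀ k, ∀ z ∈ B k, dist (d k) z ≤ ε := by
  let d := TopologicalSpace.denseSeq E
  let D := disjointed fun k => Metric.ball (d k) ε
  refine ⟨fun k => A ∩ D k, d, fun k => hA.inter (.disjointed (fun k => measurableSet_ball) k),
    fun k l h => ((disjoint_disjointed _ h).mono Set.inter_subset_right Set.inter_subset_right),
    ?_, fun k z hz => ?_⟩
  · rw [← Set.inter_iUnion, iUnion_disjointed]
    refine (Set.inter_eq_left.2 fun z _ => ?_).symm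
    obtain ⟨k, hk⟩ := (TopologicalSpace.denseRange_denseSeq E).exists_dist_lt z hε
    exact Set.mem_iUnion.2 ⟨k, hk⟩
  · have := disjointed_subset _ k hz.2
    rw [dist_comm]; exact (Metric.mem_ball.1 this).le

lemma palmCampbell_iUnion (hX : ∀ i, Measurable (X i)) {B : ℕ → Set E}
    (hBm : ∀ l, MeasurableSet (B l)) (hB : Pairwise fun l l' => Disjoint (B l) (B l')) (x : E)
    {f : E → ℝ≥0∞} (hf : Measurable f) :
    palmCampbell P X (⋃ l, B l) x f = ∑' l, palmCampbell P X (B l) x f := by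
  unfold palmCampbell
  rw [ENNReal.tsum_comm]
  refine tsum_congr fun i => ?_
  simp_rw [indicator_iUnion_eq_tsum hB, ← ENNReal.tsum_mul_right]
  exact lintegral_tsum fun l => (measurable_palmCampbell_term hX (hBm l) x hf i).aemeasurable

/-- **Slivnyak's formula** for multiplicative functionals: seen from its points, a stationary
Poisson process looks like the process itself with one point added. -/
theorem IsPoissonProcess.palmCampbell_eq [SFinite P] [ν.IsAddRightInvariant]
    (hX : IsPoissonProcess P X ν) {A : Set E} (hA : MeasurableSet A) (hAν : ν A ≠ ∞) (x : E)
    {g : E → ℝ≥0∞} (hg : Measurable g) {gl gu : ℕ → E → ℝ≥0∞} (hlm : ∀ n, Measurable (gl n))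
    (hum : ∀ n, Measurable (gu n)) (hu1 : ∀ n z, gu n z ≤ 1) {ε : ℕ → ℝ} (hε : ∀ n, 0 < ε n)
    (hl : ∀ n u v, dist u v ≤ ε n → gl n u ≤ g v) (hu : ∀ n u v, dist u v ≤ ε n → g v ≤ gu n u)
    (hν : ∀ n, ∫⁻ z, gu n z ∂ν ≠ ∞)
    (hlt : Filter.Tendsto (fun n => ∫⁻ z, gl n z ∂ν) Filter.atTop (nhds (∫⁻ z, g z ∂ν)))
    (hut : Filter.Tendsto (fun n => ∫⁻ z, gu n z ∂ν) Filter.atTop (nhds (∫⁻ z, g z ∂ν))) :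
    palmCampbell P X A x (fun z => 1 - g z) = ν A * expNeg (∫⁻ z, g z ∂ν) := by
  have hgu : ∀ n z, g z ≤ gu n z := fun n z => hu n z z (by simp [(hε n).le])
  have hgl : ∀ n z, gl n z ≤ g z := fun n z => hl n z z (by simp [(hε n).le])
  have hgν : ∫⁻ z, g z ∂ν ≠ ∞ := ne_top_of_le_ne_top (hν 0) (lintegral_mono (hgu 0))
  -- The translation depends on the random point, so the Campbell formula does not apply directly.
  -- On the cell around `d k` it differs from the fixed translation by `x - d k` by at most `ε n`,
  -- and the envelopes `gl n` and `gu n` absorb this error from below and above.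
  have hmain : ∀ n, palmCampbell P X A x (fun z => 1 - g z) ≤ ν A * expNeg (∫⁻ z, gl n z ∂ν) ∧
      ν A * expNeg (∫⁻ z, gu n z ∂ν) ≤ palmCampbell P X A x (fun z => 1 - g z) := fun n => by
    obtain ⟨B, d, hBm, hB, hAB, hd⟩ := exists_cells A hA (hε n)
    have hdist : ∀ k i j ω, X i ω ∈ B k →
        dist (X j ω + (x - d k)) (X j ω + (x - X i ω)) ≤ ε n := fun k i j ω h => by
      rw [dist_add_left, dist_sub_left]; exact hd k _ h
    have hsplit : palmCampbell P X A x (fun z => 1 - g z)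
        = ∑' k, palmCampbell P X (B k) x (fun z => 1 - g z) := by
      rw [← palmCampbell_iUnion hX.measurable hBm hB x (hg.const_sub 1), ← hAB]
    constructor
    · rw [← hX.tsum_campbell_cells hAν hBm hB hAB (fun k => x - d k) (hlm n)
        (fun z => (hgl n z).trans ((hgu n z).trans (hu1 n z)))
        (ne_top_of_le_ne_top hgν (lintegral_mono (hgl n))), hsplit]
      refine ENNReal.tsum_le_tsum fun k => ENNReal.tsum_le_tsum fun i => lintegral_mono fun ω => ?_
      by_cases h : X i ω ∈ B k
      · exact mul_le_mul_right
          (redProd_mono (fun j => tsub_le_tsub_left (hl n _ _ (hdist k i j ω h)) 1) i) _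
      · simp [h]
    · rw [← hX.tsum_campbell_cells hAν hBm hB hAB (fun k => x - d k) (hum n) (hu1 n) (hν n), hsplit]
      refine ENNReal.tsum_le_tsum fun k => ENNReal.tsum_le_tsum fun i => lintegral_mono fun ω => ?_
      by_cases h : X i ω ∈ B k
      · exact mul_le_mul_right
          (redProd_mono (fun j => tsub_le_tsub_left (hu n _ _ (hdist k i j ω h)) 1) i) _
      · simp [h]
  have hT : ∀ h : ℕ → E → ℝ≥0∞,
      Filter.Tendsto (fun n => ∫⁻ z, h n z ∂ν) Filter.atTop (nhds (∫⁻ z, g z ∂ν)) →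
      Filter.Tendsto (fun n => ν A * expNeg (∫⁻ z, h n z ∂ν)) Filter.atTop
        (nhds (ν A * expNeg (∫⁻ z, g z ∂ν))) := fun h hh =>
    ENNReal.Tendsto.const_mul ((continuousAt_expNeg hgν).tendsto.comp hh) (Or.inr hAν)
  exact le_antisymm (ge_of_tendsto' (hT gl hlt) fun n => (hmain n).1)
    (le_of_tendsto' (hT gu hut) fun n => (hmain n).2)

end

/-! ### Blocking probabilities of a node as a function of its position -/

/-- `exp (-c d ^ α)`. -/
noncomputable def radVal (c α d : ℝ) : ℝ := Real.exp (-(c * d ^ α))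

/-- The probability that a channel of length `d` is received above the threshold: it agrees with
`radVal` but for the convention at `d = 0`. -/
noncomputable def sigVal (c α d : ℝ) : ℝ := if d = 0 then 0 else radVal c α d

/-- An upper bound for `sigVal` on `[d - ε, d + ε]`. -/
noncomputable def sigUp (ε c α d : ℝ) : ℝ := radVal c α (max (d - ε) 0)

/-- A lower bound for `sigVal` on `[d - ε, d + ε]`. -/
noncomputable def sigLow (ε c α d : ℝ) : ℝ := if d ≤ ε then 0 else radVal c α (d + ε)

/-- The probability that a node with a uniform timer blocks one of two nodes with timers `t` and
`s`, when its channels to them exceed the thresholds with probabilities `p` and `q`; blocking of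
the first node is weighted by `β`. -/
def mixVal (β t s p q : ℝ) : ℝ := β * t * p + s * q - β * min t s * p * q

/-! ### Envelopes of the exceedance probability and their limits. -/

section bounds
variable {c α : ℝ}

lemma radVal_nonneg (d : ℝ) : 0 ≤ radVal c α d := Real.exp_nonneg _

lemma radVal_anti (hc : 0 ≤ c) (hα : 0 ≤ α) {d d' : ℝ} (hd : 0 ≤ d) (h : d ≤ d') :
    radVal c α d' ≤ radVal c α d := by
  unfold radVal
  gcongr

lemma radVal_le_one (hc : 0 ≤ c) {d : ℝ} (hd : 0 ≤ d) : radVal c α d ≤ 1 := by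
  unfold radVal
  rw [Real.exp_le_one_iff]
  have := mul_nonneg hc (Real.rpow_nonneg hd α)
  linarith

lemma sigVal_nonneg (d : ℝ) : 0 ≤ sigVal c α d := by
  unfold sigVal; split_ifs; exacts [le_rfl, radVal_nonneg _]

lemma sigVal_le_one (hc : 0 ≤ c) {d : ℝ} (hd : 0 ≤ d) : sigVal c α d ≤ 1 := by
  unfold sigVal; split_ifs; exacts [zero_le_one, radVal_le_one hc hd]

lemma sigUp_le_one (hc : 0 ≤ c) (ε d : ℝ) : sigUp ε c α d ≤ 1 :=
  radVal_le_one hc (le_max_right _ _)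

lemma sigVal_le_sigUp (hc : 0 ≤ c) (hα : 0 ≤ α) {ε d d' : ℝ} (hd' : 0 ≤ d') (h : |d - d'| ≤ ε) :
    sigVal c α d' ≤ sigUp ε c α d := by
  unfold sigVal
  split_ifs
  · exact radVal_nonneg _
  · exact radVal_anti hc hα (le_max_right _ _) (max_le (by linarith [(abs_le.1 h).2]) hd')

lemma sigLow_le_sigVal (hc : 0 ≤ c) (hα : 0 ≤ α) {ε d d' : ℝ} (hd' : 0 ≤ d') (h : |d - d'| ≤ ε) :
    sigLow ε c α d ≤ sigVal c α d' := by
  unfold sigLow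
  split_ifs with hd
  · exact sigVal_nonneg _
  · have h0 : d' ≠ 0 := by
      rintro rfl
      exact hd (by linarith [(abs_le.1 h).2])
    rw [sigVal, if_neg h0]
    exact radVal_anti hc hα hd' (by linarith [(abs_le.1 h).1])

lemma continuous_radVal (hα : 0 ≤ α) : Continuous (radVal c α) := by
  unfold radVal
  exact Real.continuous_exp.comp (continuous_const.mul (Real.continuous_rpow_const hα)).neg

lemma measurable_sigVal (hα : 0 ≤ α) : Measurable (sigVal c α) :=
  Measurable.ite (measurableSet_singleton 0) measurable_const (continuous_radVal hα).measurable

lemma measurable_sigUp (hα : 0 ≤ α) (ε : ℝ) : Measurable (sigUp ε c α) :=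
  (continuous_radVal hα).measurable.comp ((measurable_id.sub_const ε).max measurable_const)

lemma measurable_sigLow (hα : 0 ≤ α) (ε : ℝ) : Measurable (sigLow ε c α) :=
  Measurable.ite measurableSet_Iic measurable_const
    ((continuous_radVal hα).measurable.comp (measurable_id.add_const ε))

lemma tendsto_sigUp (hα : 0 ≤ α) {d : ℝ} (hd : 0 < d) {ε : ℕ → ℝ}
    (hε : Filter.Tendsto ε Filter.atTop (nhds 0)) :
    Filter.Tendsto (fun n => sigUp (ε n) c α d) Filter.atTop (nhds (sigVal c α d)) := by
  rw [sigVal, if_neg hd.ne']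
  have h1 : Filter.Tendsto (fun n => max (d - ε n) 0) Filter.atTop (nhds (max (d - 0) 0)) :=
    (tendsto_const_nhds.sub hε).max tendsto_const_nhds
  rw [sub_zero, max_eq_left hd.le] at h1
  exact ((continuous_radVal hα).tendsto d).comp h1

lemma tendsto_sigLow (hα : 0 ≤ α) {d : ℝ} (hd : 0 < d) {ε : ℕ → ℝ}
    (hε : Filter.Tendsto ε Filter.atTop (nhds 0)) :
    Filter.Tendsto (fun n => sigLow (ε n) c α d) Filter.atTop (nhds (sigVal c α d)) := by
  rw [sigVal, if_neg hd.ne']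
  have h1 : Filter.Tendsto (fun n => d + ε n) Filter.atTop (nhds (d + 0)) :=
    tendsto_const_nhds.add hε
  rw [add_zero] at h1
  refine (((continuous_radVal hα).tendsto d).comp h1).congr' ?_
  filter_upwards [hε.eventually_lt_const hd] with n hn
  rw [sigLow, if_neg (not_le.2 hn)]; rfl

end bounds

/-! ### Dependence of the blocking probability on the channel probabilities. -/

section mix
variable {β t s p q p' q' : ℝ}

/-- The expression is affine in each of `p` and `q`, with slopes `β * (t - min t s * q)` and `s - β
* min t s * p`, both nonnegative for the probabilities in question. Envelopes of the channel
probabilities thus give envelopes of the blocking probability. -/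
lemma mixVal_mono (hβ : 0 ≤ β) (hβ1 : β ≤ 1) (ht : 0 ≤ t) (hs : 0 ≤ s)
    (hpp : p ≤ p') (hp1 : p' ≤ 1) (hqq : q ≤ q') (hq1 : q' ≤ 1) :
    mixVal β t s p q ≤ mixVal β t s p' q' := by
  have hm : 0 ≤ min t s := le_min ht hs
  have h1 : mixVal β t s p q ≤ mixVal β t s p q' := by
    have h3 : β * min t s * p ≤ s := by
      have : β * p ≤ 1 := by nlinarith
      calc β * min t s * p = (β * p) * min t s := by ring
        _ ≤ 1 * min t s := by gcongr
        _ ≤ s := by rw [one_mul]; exact min_le_right _ _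
    have h4 := mul_nonneg (sub_nonneg.2 h3) (sub_nonneg.2 hqq)
    unfold mixVal; nlinarith
  have h2 : mixVal β t s p q' ≤ mixVal β t s p' q' := by
    have h3 : min t s * q' ≤ t := by
      calc min t s * q' ≤ min t s * 1 := by gcongr
        _ ≤ t := by rw [mul_one]; exact min_le_left _ _
    have h4 := mul_nonneg (mul_nonneg hβ (sub_nonneg.2 h3)) (sub_nonneg.2 hpp)
    unfold mixVal; nlinarith
  exact h1.trans h2

lemma mixVal_nonneg (hβ : 0 ≤ β) (hβ1 : β ≤ 1) (ht : 0 ≤ t) (hs : 0 ≤ s)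
    (hp : 0 ≤ p) (hp1 : p ≤ 1) (hq : 0 ≤ q) (hq1 : q ≤ 1) : 0 ≤ mixVal β t s p q := by
  have := mixVal_mono (p := 0) (q := 0) hβ hβ1 ht hs hp hp1 hq hq1
  simpa [mixVal] using this

/-- The union bound; it supplies an integrable majorant for dominated convergence. -/
lemma mixVal_le_add (hβ : 0 ≤ β) (hβ1 : β ≤ 1) (ht : 0 ≤ t) (ht1 : t ≤ 1) (hs : 0 ≤ s)
    (hs1 : s ≤ 1) (hp : 0 ≤ p) (hq : 0 ≤ q) : mixVal β t s p q ≤ p + q := by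
  have hm : 0 ≤ β * min t s * p * q := by
    have : 0 ≤ min t s := le_min ht hs
    positivity
  have h1 : β * t * p ≤ 1 * p := by
    gcongr; exact mul_le_one₀ hβ1 ht ht1
  have h2 : s * q ≤ 1 * q := by gcongr
  unfold mixVal; linarith

lemma mixVal_le_one (hβ : 0 ≤ β) (hβ1 : β ≤ 1) (ht : 0 ≤ t) (ht1 : t ≤ 1) (hs : 0 ≤ s)
    (hs1 : s ≤ 1) (hp1 : p ≤ 1) (hq1 : q ≤ 1) : mixVal β t s p q ≤ 1 := by
  refine (mixVal_mono hβ hβ1 ht hs hp1 le_rfl hq1 le_rfl).trans ?_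
  unfold mixVal
  rcases le_total t s with h | h
  · rw [min_eq_left h]; linarith
  · rw [min_eq_right h]; nlinarith [mul_nonneg hβ (sub_nonneg.2 h)]

end mix

lemma integrable_radVal {c α : ℝ} (hc : 0 < c) (hα : 0 < α) (x : Plane) :
    Integrable (fun w : Plane => radVal c α ‖w - x‖) := by
  suffices h : Integrable (fun w : Plane => radVal c α ‖w‖) from h.comp_sub_right x
  rw [integrable_fun_norm_addHaar volume (f := radVal c α)]
  -- The power `s := 1` is the Jacobian of polar coordinates in dimension two.
  have h := integrableOn_rpow_mul_exp_neg_mul_rpow (s := 1) (p := α) (b := c) (by norm_num) hα hc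
  refine h.congr_fun (fun y hy => ?_) measurableSet_Ioi
  simp [radVal]

/-- For `d ≥ 2` one has `d - ε ≥ d / 2`. For `d ≤ 2` the exponent `c * (d / 2) ^ α` is at most `c`,
and the constant `exp c` compensates for it. The bound is uniform in `ε ≤ 1` and integrable in the
plane. -/
lemma sigUp_le {c α : ℝ} (hc : 0 ≤ c) (hα : 0 ≤ α) {ε d : ℝ} (hε : ε ≤ 1) (hd : 0 ≤ d) :
    sigUp ε c α d ≤ Real.exp c * radVal (c * (1 / 2) ^ α) α d := by
  rw [radVal, ← Real.exp_add, sigUp, radVal, Real.exp_le_exp, mul_assoc,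
    ← Real.mul_rpow (by norm_num) hd]
  rcases le_total d 2 with h | h
  · have h1 : (1 / 2 * d) ^ α ≤ 1 := Real.rpow_le_one (by positivity) (by linarith) hα
    have h2 : 0 ≤ c * max (d - ε) 0 ^ α := mul_nonneg hc (Real.rpow_nonneg (le_max_right _ _) _)
    nlinarith
  · have h1 : (1 / 2 * d) ^ α ≤ max (d - ε) 0 ^ α :=
      Real.rpow_le_rpow (by positivity) ((by linarith : 1 / 2 * d ≤ d - ε).trans (le_max_left _ _))
        hα
    nlinarith

/-! ### Slivnyak's formula for the blocking probabilities -/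

/-- The probability that a node at `w` blocks the node at `x` or the node at `y`; a node in the open
disc of radius `r` always does. -/
noncomputable def blockProb (α c₁ c₂ r : ℝ) (x y : Plane) (β t s : ℝ) (w : Plane) : ℝ :=
  if ‖w‖ < r then 1 else mixVal β t s (sigVal c₁ α ‖w - x‖) (sigVal c₂ α ‖w - y‖)

/-- The integral of `blockProb` outside the disc of radius `r`. -/
noncomputable def meanVal (α c₁ c₂ r : ℝ) (x y : Plane) (β t s : ℝ) : ℝ :=
  β * t * (∫ w in (Metric.closedBall (0 : Plane) r)ᶜ, radVal c₁ α ‖w - x‖)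
    + s * (∫ w in (Metric.closedBall (0 : Plane) r)ᶜ, radVal c₂ α ‖w - y‖)
    - β * min t s * ∫ w in (Metric.closedBall (0 : Plane) r)ᶜ,
      radVal c₁ α ‖w - x‖ * radVal c₂ α ‖w - y‖

section
variable {α c₁ c₂ r β t s : ℝ} {x y : Plane}

lemma measurable_mixVal_comp {T : Type*} [MeasurableSpace T] {b t s p q : T → ℝ}
    (hb : Measurable b) (ht : Measurable t) (hs : Measurable s) (hp : Measurable p)
    (hq : Measurable q) : Measurable fun a => mixVal (b a) (t a) (s a) (p a) (q a) := by
  unfold mixVal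
  fun_prop

lemma measurable_blockProb (hα : 0 ≤ α) (x y : Plane) (β : ℝ) :
    Measurable fun a : (ℝ × ℝ) × Plane => blockProb α c₁ c₂ r x y β a.1.1 a.1.2 a.2 := by
  refine Measurable.ite (measurableSet_lt measurable_snd.norm measurable_const) measurable_const ?_
  exact measurable_mixVal_comp measurable_const measurable_fst.fst measurable_fst.snd
    ((measurable_sigVal hα).comp (measurable_snd.sub_const x).norm)
    ((measurable_sigVal hα).comp (measurable_snd.sub_const y).norm)

lemma measurable_ite_norm_lt (a : ℝ) {f : Plane → ℝ} (hf : Measurable f) :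
    Measurable fun w : Plane => if ‖w‖ < a then 1 else f w :=
  Measurable.ite (measurableSet_lt measurable_norm measurable_const) measurable_const hf

lemma measurable_mixVal_norm (β t s : ℝ) (x y : Plane) {f g : ℝ → ℝ} (hf : Measurable f)
    (hg : Measurable g) : Measurable fun w : Plane => mixVal β t s (f ‖w - x‖) (g ‖w - y‖) :=
  measurable_mixVal_comp measurable_const measurable_const measurable_const
    (hf.comp (measurable_id.sub_const x).norm) (hg.comp (measurable_id.sub_const y).norm)

lemma integrable_radVal_mul (hc₁ : 0 < c₁) (hc₂ : 0 < c₂) (hα : 0 < α) (x y : Plane) :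
    Integrable fun w : Plane => radVal c₁ α ‖w - x‖ * radVal c₂ α ‖w - y‖ := by
  refine (integrable_radVal hc₁ hα x).mono' ?_ (.of_forall fun w => ?_)
  · exact (((continuous_radVal hα.le).comp (continuous_id.sub continuous_const).norm).mul
      ((continuous_radVal hα.le).comp
        (continuous_id.sub continuous_const).norm)).aestronglyMeasurable
  · rw [Real.norm_of_nonneg (mul_nonneg (radVal_nonneg _) (radVal_nonneg _))]
    exact mul_le_of_le_one_right (radVal_nonneg _)
      (radVal_le_one hc₂.le (norm_nonneg _))

lemma meanVal_nonneg (hc₁ : 0 < c₁) (hc₂ : 0 < c₂) (hα : 0 < α) (hβ : 0 ≤ β) (hβ1 : β ≤ 1)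
    (ht : 0 ≤ t) (hs : 0 ≤ s) : 0 ≤ meanVal α c₁ c₂ r x y β t s ∧
    (∫ w in (Metric.closedBall (0 : Plane) r)ᶜ,
      mixVal β t s (radVal c₁ α ‖w - x‖) (radVal c₂ α ‖w - y‖)) = meanVal α c₁ c₂ r x y β t s ∧
    Integrable fun w : Plane => mixVal β t s (radVal c₁ α ‖w - x‖) (radVal c₂ α ‖w - y‖) := by
  have h1 := (integrable_radVal hc₁ hα x).const_mul (β * t)
  have h2 := (integrable_radVal hc₂ hα y).const_mul s
  have h3 := (integrable_radVal_mul hc₁ hc₂ hα x y).const_mul (β * min t s)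
  have he : (fun w : Plane => mixVal β t s (radVal c₁ α ‖w - x‖) (radVal c₂ α ‖w - y‖))
      = fun w => β * t * radVal c₁ α ‖w - x‖ + s * radVal c₂ α ‖w - y‖
        - β * min t s * (radVal c₁ α ‖w - x‖ * radVal c₂ α ‖w - y‖) := by
    funext w; unfold mixVal; ring
  have hi : (∫ w in (Metric.closedBall (0 : Plane) r)ᶜ,
      mixVal β t s (radVal c₁ α ‖w - x‖) (radVal c₂ α ‖w - y‖)) = meanVal α c₁ c₂ r x y β t s := by
    have h12 : Integrable fun w : Plane =>
      β * t * radVal c₁ α ‖w - x‖ + s * radVal c₂ α ‖w - y‖ := h1.add h2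
    rw [he, integral_sub h12.integrableOn h3.integrableOn,
      integral_add h1.integrableOn h2.integrableOn, integral_const_mul, integral_const_mul,
      integral_const_mul]
    rfl
  refine ⟨?_, hi, ?_⟩
  · rw [← hi]
    exact integral_nonneg fun w => mixVal_nonneg hβ hβ1 ht hs (radVal_nonneg _)
      (radVal_le_one hc₁.le (norm_nonneg _)) (radVal_nonneg _)
      (radVal_le_one hc₂.le (norm_nonneg _))
  · rw [he]; exact (h1.add h2).sub h3

/-- The null set excluded here contains every point at which the envelopes of `blockProb` might fail
to converge: the two Palm positions, where the convention at distance zero intervenes, and the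
circle of radius `r`. -/
lemma ae_plane_generic (r : ℝ) (x y : Plane) :
    ∀ᵐ w : Plane, w ≠ x ∧ w ≠ y ∧ ‖w‖ ≠ r := by
  have hsph : (volume : Measure Plane) (Metric.sphere 0 r) = 0 :=
    Measure.addHaar_sphere volume 0 r
  have h1 : ∀ᵐ w : Plane, w ∉ Metric.sphere (0 : Plane) r := measure_eq_zero_iff_ae_notMem.1 hsph
  filter_upwards [h1, Measure.ae_ne volume x, Measure.ae_ne volume y] with w hw hx hy
  exact ⟨hx, hy, fun h => hw (by simpa using h)⟩

/-- Inside the disc the integrand is one and yields the area; outside, it is the affine expression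
integrated by `meanVal`. The disc is open in `blockProb` and closed in `meanVal`, and the circle
between them is null. -/
lemma lintegral_blockProb (hc₁ : 0 < c₁) (hc₂ : 0 < c₂) (hα : 0 < α) (hβ : 0 ≤ β) (hβ1 : β ≤ 1)
    (ht : 0 ≤ t) (hs : 0 ≤ s) :
    ∫⁻ w, ENNReal.ofReal (blockProb α c₁ c₂ r x y β t s w)
      = volume (Metric.closedBall (0 : Plane) r)
        + ENNReal.ofReal (meanVal α c₁ c₂ r x y β t s) := by
  obtain ⟨h0, hi, hint⟩ := meanVal_nonneg (r := r) (x := x) (y := y) hc₁ hc₂ hα hβ hβ1 ht hs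
  have hB : MeasurableSet (Metric.closedBall (0 : Plane) r) := measurableSet_closedBall
  rw [← lintegral_add_compl _ hB]
  congr 1
  · rw [← setLIntegral_one]
    refine lintegral_congr_ae ?_
    filter_upwards [ae_restrict_mem hB, ae_restrict_of_ae (ae_plane_generic r x y)] with w hw hw'
    have : ‖w‖ < r := lt_of_le_of_ne (by simpa using hw) hw'.2.2
    simp [blockProb, this]
  · rw [← hi, ofReal_integral_eq_lintegral_ofReal hint.integrableOn]
    · refine lintegral_congr_ae ?_
      filter_upwards [ae_restrict_mem hB.compl, ae_restrict_of_ae (ae_plane_generic r x y)]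
        with w hw hw'
      have h1 : ¬ ‖w‖ < r := fun h => hw (by simpa using h.le)
      rw [blockProb, if_neg h1, sigVal, sigVal, if_neg (norm_ne_zero_iff.2 (sub_ne_zero.2 hw'.1)),
        if_neg (norm_ne_zero_iff.2 (sub_ne_zero.2 hw'.2.1))]
    · exact .of_forall fun w => mixVal_nonneg hβ hβ1 ht hs (radVal_nonneg _)
        (radVal_le_one hc₁.le (norm_nonneg _)) (radVal_nonneg _)
        (radVal_le_one hc₂.le (norm_nonneg _))

lemma tendsto_mixVal {p q : ℕ → ℝ} {p₀ q₀ : ℝ} (hp : Filter.Tendsto p Filter.atTop (nhds p₀))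
    (hq : Filter.Tendsto q Filter.atTop (nhds q₀)) :
    Filter.Tendsto (fun n => mixVal β t s (p n) (q n)) Filter.atTop
      (nhds (mixVal β t s p₀ q₀)) := by
  unfold mixVal
  exact ((tendsto_const_nhds.mul hp).add (tendsto_const_nhds.mul hq)).sub
    ((tendsto_const_nhds.mul hp).mul hq)


/-- Slivnyak's formula for the blocking probabilities. -/
theorem palmCampbell_blockProb {Ω : Type*} [MeasurableSpace Ω] {P : Measure Ω} [SFinite P]
    {X : ℕ → Ω → Plane} {lam : ℝ} (hX : IsPoissonProcess P X (ENNReal.ofReal lam • volume))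
    (hlam : 0 ≤ lam) {A : Set Plane} (hA : MeasurableSet A) (hAν : volume A ≠ ∞) (o : Plane)
    (hc₁ : 0 < c₁) (hc₂ : 0 < c₂) (hα : 0 < α) (hβ : 0 ≤ β) (hβ1 : β ≤ 1)
    (ht : 0 ≤ t) (ht1 : t ≤ 1) (hs : 0 ≤ s) (hs1 : s ≤ 1) :
    palmCampbell P X A o (fun w => 1 - ENNReal.ofReal (blockProb α c₁ c₂ r x y β t s w))
      = ENNReal.ofReal lam * volume A * ENNReal.ofReal (Real.exp (-(lam *
        ((volume (Metric.closedBall (0 : Plane) r)).toReal + meanVal α c₁ c₂ r x y β t s)))) := by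
  let ε : ℕ → ℝ := fun n => 1 / ((n : ℝ) + 1)
  have hε : ∀ n, 0 < ε n := fun n => Nat.one_div_pos_of_nat
  have hε1 : ∀ n, ε n ≤ 1 := fun n => by
    rw [div_le_one (by positivity)]; linarith [Nat.cast_nonneg (α := ℝ) n]
  have hε0 : Filter.Tendsto ε Filter.atTop (nhds 0) := tendsto_one_div_add_atTop_nhds_zero_nat
  -- The envelopes must survive a displacement by `ε n`, so the disc is enlarged or shrunk by the
  -- same amount as the distances.
  let up : ℕ → Plane → ℝ := fun n w => if ‖w‖ < r + ε n then 1 else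
    mixVal β t s (sigUp (ε n) c₁ α ‖w - x‖) (sigUp (ε n) c₂ α ‖w - y‖)
  let low : ℕ → Plane → ℝ := fun n w => if ‖w‖ < r - ε n then 1 else
    mixVal β t s (sigLow (ε n) c₁ α ‖w - x‖) (sigLow (ε n) c₂ α ‖w - y‖)
  have hdist : ∀ u v z : Plane, |‖u - z‖ - ‖v - z‖| ≤ dist u v := fun u v z => by
    refine (abs_norm_sub_norm_le _ _).trans ?_
    rw [sub_sub_sub_cancel_right, dist_eq_norm]
  have hsL1 : ∀ n c (d : ℝ), 0 < c → 0 ≤ d → sigLow (ε n) c α d ≤ 1 := fun n c d hc hd =>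
    (sigLow_le_sigVal hc.le hα.le hd (by simp [(hε n).le])).trans (sigVal_le_one hc.le hd)
  have hsU0 : ∀ n c (d : ℝ), 0 ≤ sigUp (ε n) c α d := fun n c d => radVal_nonneg _
  have hup1 : ∀ n w, up n w ≤ 1 := fun n w => by
    simp only [up]; split_ifs
    · exact le_rfl
    · exact mixVal_le_one hβ hβ1 ht ht1 hs hs1 (sigUp_le_one hc₁.le _ _)
        (sigUp_le_one hc₂.le _ _)
  have hup0 : ∀ n w, 0 ≤ up n w := fun n w => by
    simp only [up]; split_ifs
    · exact zero_le_one
    · exact mixVal_nonneg hβ hβ1 ht hs (hsU0 _ _ _) (sigUp_le_one hc₁.le _ _) (hsU0 _ _ _)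
        (sigUp_le_one hc₂.le _ _)
  have hblock1 : ∀ w, blockProb α c₁ c₂ r x y β t s w ≤ 1 := fun w => by
    unfold blockProb; split_ifs
    · exact le_rfl
    · exact mixVal_le_one hβ hβ1 ht ht1 hs hs1 (sigVal_le_one hc₁.le (norm_nonneg _))
        (sigVal_le_one hc₂.le (norm_nonneg _))
  have hup : ∀ n u v, dist u v ≤ ε n → blockProb α c₁ c₂ r x y β t s v ≤ up n u := by
    intro n u v huv
    simp only [up]
    split_ifs with h
    · exact hblock1 v
    · have hv : ¬ ‖v‖ < r := fun hv => h (by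
        have := (abs_le.1 (hdist u v 0)).2; simp only [sub_zero] at this; linarith)
      rw [blockProb, if_neg hv]
      exact mixVal_mono hβ hβ1 ht hs
        (sigVal_le_sigUp hc₁.le hα.le (norm_nonneg _) ((hdist u v x).trans huv))
        (sigUp_le_one hc₁.le _ _)
        (sigVal_le_sigUp hc₂.le hα.le (norm_nonneg _) ((hdist u v y).trans huv))
        (sigUp_le_one hc₂.le _ _)
  have hlow : ∀ n u v, dist u v ≤ ε n → low n u ≤ blockProb α c₁ c₂ r x y β t s v := by
    intro n u v huv
    by_cases hv : ‖v‖ < r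
    · rw [blockProb, if_pos hv]
      simp only [low]; split_ifs
      · exact le_rfl
      · exact mixVal_le_one hβ hβ1 ht ht1 hs hs1 (hsL1 n _ _ hc₁ (norm_nonneg _))
          (hsL1 n _ _ hc₂ (norm_nonneg _))
    · have hu : ¬ ‖u‖ < r - ε n := fun hu => hv (by
        have := (abs_le.1 (hdist u v 0)).1; simp only [sub_zero] at this; linarith)
      simp only [low]
      rw [blockProb, if_neg hv, if_neg hu]
      exact mixVal_mono hβ hβ1 ht hs
        (sigLow_le_sigVal hc₁.le hα.le (norm_nonneg _) ((hdist u v x).trans huv))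
        (sigVal_le_one hc₁.le (norm_nonneg _))
        (sigLow_le_sigVal hc₂.le hα.le (norm_nonneg _) ((hdist u v y).trans huv))
        (sigVal_le_one hc₂.le (norm_nonneg _))
  have hupm : ∀ n, Measurable (up n) := fun n => measurable_ite_norm_lt _
    (measurable_mixVal_norm β t s x y (measurable_sigUp hα.le _) (measurable_sigUp hα.le _))
  have hlowm : ∀ n, Measurable (low n) := fun n => measurable_ite_norm_lt _
    (measurable_mixVal_norm β t s x y (measurable_sigLow hα.le _) (measurable_sigLow hα.le _))
  have hbm : Measurable fun w => blockProb α c₁ c₂ r x y β t s w := measurable_ite_norm_lt _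
    (measurable_mixVal_norm β t s x y (measurable_sigVal hα.le) (measurable_sigVal hα.le))
  -- A majorant independent of `n`: `ε n ≤ 1` bounds the enlarged discs by the one of radius `r +
  -- 1`, and `sigUp_le` bounds the channel terms.
  let dom : Plane → ℝ := fun w => (Metric.ball (0 : Plane) (r + 1)).indicator 1 w
    + (Real.exp c₁ * radVal (c₁ * (1 / 2) ^ α) α ‖w - x‖
      + Real.exp c₂ * radVal (c₂ * (1 / 2) ^ α) α ‖w - y‖)
  have hdomi : Integrable dom := by
    refine ((integrable_indicator_iff measurableSet_ball).2 ?_).add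
      (((integrable_radVal (by positivity) hα x).const_mul _).add
        ((integrable_radVal (by positivity) hα y).const_mul _))
    exact integrableOn_const (measure_ball_lt_top.ne)
  have hupdom : ∀ n w, up n w ≤ dom w := fun n w => by
    have h1 : 0 ≤ (Metric.ball (0 : Plane) (r + 1)).indicator (1 : Plane → ℝ) w :=
      Set.indicator_nonneg (fun _ _ => zero_le_one) w
    have h2 := sigUp_le hc₁.le hα.le (hε1 n) (norm_nonneg (w - x))
    have h3 := sigUp_le hc₂.le hα.le (hε1 n) (norm_nonneg (w - y))
    have h4 := hsU0 n c₁ ‖w - x‖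
    have h5 := hsU0 n c₂ ‖w - y‖
    simp only [up, dom]
    split_ifs with h
    · have hw : w ∈ Metric.ball (0 : Plane) (r + 1) := by
        simp only [Metric.mem_ball, dist_zero_right]; linarith [hε1 n]
      rw [Set.indicator_of_mem hw, Pi.one_apply]
      linarith
    · have := mixVal_le_add hβ hβ1 ht ht1 hs hs1 h4 h5
      linarith
  have hdoml : ∫⁻ w, ENNReal.ofReal (dom w) ≠ ∞ := hdomi.lintegral_lt_top.ne
  have hlim : ∀ F : ℕ → Plane → ℝ, (∀ n, Measurable (F n)) → (∀ n w, F n w ≤ dom w) →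
      (∀ w, w ≠ x → w ≠ y → ‖w‖ ≠ r → Filter.Tendsto (fun n => F n w) Filter.atTop
        (nhds (blockProb α c₁ c₂ r x y β t s w))) →
      Filter.Tendsto (fun n => ∫⁻ w, ENNReal.ofReal (F n w) ∂(ENNReal.ofReal lam • volume))
        Filter.atTop (nhds (∫⁻ w, ENNReal.ofReal (blockProb α c₁ c₂ r x y β t s w)
          ∂(ENNReal.ofReal lam • volume))) := by
    intro F hFm hF hFt
    simp_rw [lintegral_smul_measure, smul_eq_mul]
    refine ENNReal.Tendsto.const_mul ?_ (Or.inr ENNReal.ofReal_ne_top)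
    refine tendsto_lintegral_of_dominated_convergence (fun w => ENNReal.ofReal (dom w))
      (fun n => (hFm n).ennreal_ofReal)
      (fun n => .of_forall fun w => ENNReal.ofReal_le_ofReal (hF n w)) hdoml ?_
    filter_upwards [ae_plane_generic r x y] with w hw
    exact (ENNReal.continuous_ofReal.tendsto _).comp (hFt w hw.1 hw.2.1 hw.2.2)
  have hpos : ∀ {w z : Plane}, w ≠ z → 0 < ‖w - z‖ := fun h => norm_pos_iff.2 (sub_ne_zero.2 h)
  have hut := hlim up hupm hupdom fun w hwx hwy hwr => by
    by_cases h : ‖w‖ < r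
    · rw [blockProb, if_pos h]
      refine tendsto_const_nhds.congr fun n => ?_
      simp only [up]; rw [if_pos (by linarith [hε n])]
    · rw [blockProb, if_neg h]
      have h' : 0 < ‖w‖ - r := by
        rcases lt_or_eq_of_le (not_lt.1 h) with h1 | h1
        · linarith
        · exact absurd h1.symm hwr
      refine (tendsto_mixVal (tendsto_sigUp hα.le (hpos hwx) hε0)
        (tendsto_sigUp hα.le (hpos hwy) hε0)).congr' ?_
      filter_upwards [hε0.eventually_lt_const h'] with n hn
      simp only [up]; rw [if_neg (by linarith)]
  have hlt := hlim low hlowm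
    (fun n w => ((hlow n w w (by simp [(hε n).le])).trans (hup n w w (by simp [(hε n).le]))).trans
      (hupdom n w)) fun w hwx hwy hwr => by
    by_cases h : ‖w‖ < r
    · rw [blockProb, if_pos h]
      refine tendsto_const_nhds.congr' ?_
      filter_upwards [hε0.eventually_lt_const (sub_pos.2 h)] with n hn
      simp only [low]; rw [if_pos (by linarith)]
    · rw [blockProb, if_neg h]
      refine (tendsto_mixVal (tendsto_sigLow hα.le (hpos hwx) hε0)
        (tendsto_sigLow hα.le (hpos hwy) hε0)).congr fun n => ?_
      simp only [low]; rw [if_neg (by linarith [hε n])]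
  have hmain := hX.palmCampbell_eq hA
    (by rw [Measure.smul_apply, smul_eq_mul]; exact ENNReal.mul_ne_top ENNReal.ofReal_ne_top hAν) o
    hbm.ennreal_ofReal (fun n => (hlowm n).ennreal_ofReal) (fun n => (hupm n).ennreal_ofReal)
    (fun n w => by simpa using hup1 n w) hε
    (fun n u v h => ENNReal.ofReal_le_ofReal (hlow n u v h))
    (fun n u v h => ENNReal.ofReal_le_ofReal (hup n u v h))
    (fun n => by
      rw [lintegral_smul_measure, smul_eq_mul]
      exact ENNReal.mul_ne_top ENNReal.ofReal_ne_top (ne_top_of_le_ne_top hdoml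
        (lintegral_mono fun w => ENNReal.ofReal_le_ofReal (hupdom n w))))
    hlt hut
  rw [hmain, Measure.smul_apply, smul_eq_mul, lintegral_smul_measure, smul_eq_mul,
    lintegral_blockProb hc₁ hc₂ hα hβ hβ1 ht hs, expNeg, ENNReal.toReal_mul,
    ENNReal.toReal_ofReal hlam, ENNReal.toReal_add measure_closedBall_lt_top.ne
      ENNReal.ofReal_ne_top,
    ENNReal.toReal_ofReal (meanVal_nonneg hc₁ hc₂ hα hβ hβ1 ht hs).1]

end

/-! ### Infinite product measures -/

section
variable {ι : Type*} {S : ι → Type*} [∀ i, MeasurableSpace (S i)] (μ : ∀ i, Measure (S i))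
  [∀ i, IsProbabilityMeasure (μ i)]

/-- Resampling one coordinate independently preserves a product measure. The resampled coordinate
becomes an explicit variable of integration. -/
lemma infinitePi_eq_map_update [DecidableEq ι] (i : ι) :
    Measure.infinitePi μ = ((μ i).prod (Measure.infinitePi μ)).map
      (fun q => Function.update q.2 i q.1) := by
  have hm : Measurable fun q : S i × (∀ j, S j) => Function.update q.2 i q.1 :=
    measurable_update'.comp measurable_swap
  refine (Measure.eq_infinitePi μ fun s t ht => ?_).symm
  rw [Measure.map_apply hm (.pi s.countable_toSet fun j _ => ht j)]
  have hpre : (fun q : S i × (∀ j, S j) => Function.update q.2 i q.1) ⁻¹' (Set.pi s t)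
      = (if i ∈ s then t i else Set.univ) ×ˢ Set.pi (s.erase i : Finset ι) t := by
    ext ⟨a, z⟩
    simp only [Set.mem_preimage, Set.mem_pi, Finset.mem_coe, Set.mem_prod, Finset.mem_erase]
    constructor
    · intro h
      refine ⟨?_, fun j hj => ?_⟩
      · split_ifs with hi
        · simpa using h i hi
        · trivial
      · simpa [Function.update_of_ne hj.1] using h j hj.2
    · rintro ⟨h1, h2⟩ j hj
      by_cases hji : j = i
      · subst hji; simpa [hj] using h1
      · simpa [Function.update_of_ne hji] using h2 j ⟨hji, hj⟩
  rw [hpre, Measure.prod_prod, Measure.infinitePi_pi μ fun j _ => ht j]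
  split_ifs with hi
  · exact Finset.mul_prod_erase s (fun j => μ j (t j)) hi
  · rw [measure_univ, one_mul, Finset.erase_eq_of_notMem hi]

/-- The box is the directed intersection of boxes with finitely many constraints, so continuity from
above applies. -/
lemma infinitePi_univ_pi_eq_infProd [Countable ι] {t : ∀ i, Set (S i)}
    (ht : ∀ i, MeasurableSet (t i)) :
    Measure.infinitePi μ (Set.univ.pi t) = infProd fun i => μ i (t i) := by
  have h : Set.univ.pi t = ⋂ s : Finset ι, Set.pi (s : Set ι) t := by
    ext z
    simp only [Set.mem_pi, Set.mem_univ, true_implies, Set.mem_iInter, Finset.mem_coe]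
    exact ⟨fun h s j _ => h j, fun h j => h {j} j (Finset.mem_singleton_self j)⟩
  classical
  rw [h, Directed.measure_iInter
    (fun s => (MeasurableSet.pi s.countable_toSet fun j _ => ht j).nullMeasurableSet)
    (fun s s' => ⟨s ∪ s', Set.pi_mono' (fun _ _ => le_rfl) (by simp),
      Set.pi_mono' (fun _ _ => le_rfl) (by simp)⟩) ⟨∅, measure_ne_top _ _⟩]
  exact iInf_congr fun s => Measure.infinitePi_pi μ fun j _ => ht j

end

open Classical in
/-- Conditioning on two coordinates of an infinite sequence of independent variables. -/
lemma infinitePi_two_coordinates {ι T : Type*} [Countable ι] [MeasurableSpace T]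
    (κ : Measure T) [IsProbabilityMeasure κ] {i k : ι} (hik : i ≠ k) {S₀ : Set (T × T)}
    (hS₀ : MeasurableSet S₀) {G : ι → Set ((T × T) × T)} (hG : ∀ b, MeasurableSet (G b)) :
    Measure.infinitePi (fun _ : ι => κ)
        {z | (z i, z k) ∈ S₀ ∧ ∀ b, b ≠ i → b ≠ k → ((z i, z k), z b) ∈ G b}
      = ∫⁻ a, ∫⁻ a', S₀.indicator 1 (a, a') * infProd (fun b => if b = i ∨ b = k then 1 else
          κ {v | ((a, a'), v) ∈ G b}) ∂κ ∂κ := by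
  set Q := Measure.infinitePi (fun _ : ι => κ) with hQ
  set E : Set (ι → T) := {z | (z i, z k) ∈ S₀ ∧ ∀ b, b ≠ i → b ≠ k → ((z i, z k), z b) ∈ G b}
  have hev : Measurable fun z : ι → T => (z i, z k) :=
    (measurable_pi_apply i).prodMk (measurable_pi_apply k)
  have hE : MeasurableSet E := by
    refine (hev hS₀).inter (MeasurableSet.iInter fun b => ?_ : MeasurableSet
      (⋂ b, {z : ι → T | b ≠ i → b ≠ k → ((z i, z k), z b) ∈ G b})) |>.congr ?_
    · by_cases h : b ≠ i ∧ b ≠ k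
      · convert (hev.prodMk (measurable_pi_apply b)) (hG b) using 1
        ext z
        simp [h.1, h.2]
      · have : {z : ι → T | b ≠ i → b ≠ k → ((z i, z k), z b) ∈ G b} = Set.univ :=
          Set.eq_univ_of_forall fun z h1 h2 => absurd ⟨h1, h2⟩ h
        rw [this]; exact .univ
    · ext z
      simp [E]
  have hu : ∀ j, Measurable fun q : T × (ι → T) => Function.update q.2 j q.1 := fun j =>
    measurable_update'.comp measurable_swap
  rw [hQ, infinitePi_eq_map_update (fun _ : ι => κ) i, Measure.map_apply (hu i) hE,
    Measure.prod_apply (hu i hE)]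
  refine lintegral_congr fun a => ?_
  have hEa : MeasurableSet (Prod.mk a ⁻¹'
      ((fun q : T × (ι → T) => Function.update q.2 i q.1) ⁻¹' E)) :=
    measurable_prodMk_left (hu i hE)
  rw [infinitePi_eq_map_update (fun _ : ι => κ) k, Measure.map_apply (hu k) hEa,
    Measure.prod_apply (hu k hEa)]
  refine lintegral_congr fun a' => ?_
  -- With the coordinates `i` and `k` frozen at `a` and `a'`, the event is a box, unconstrained in
  -- these two directions.
  let t : ι → Set T := fun b => if b = i ∨ b = k then Set.univ else {v | ((a, a'), v) ∈ G b}
  have ht : ∀ b, MeasurableSet (t b) := fun b => by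
    simp only [t]; split_ifs
    · exact .univ
    · exact measurable_prodMk_left (hG b)
  have hset : (Prod.mk a' ⁻¹' ((fun q : T × (ι → T) => Function.update q.2 k q.1) ⁻¹'
      (Prod.mk a ⁻¹' ((fun q : T × (ι → T) => Function.update q.2 i q.1) ⁻¹' E))))
      = {z | (a, a') ∈ S₀} ∩ Set.univ.pi t := by
    ext z
    simp only [Set.mem_preimage, E, Set.mem_ofPred_eq, Function.update_self,
      Function.update_of_ne hik.symm, Set.mem_inter_iff, Set.mem_pi, Set.mem_univ, true_implies]
    refine and_congr_right fun _ => forall_congr' fun b => ?_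
    by_cases h1 : b = i
    · simp [t, h1]
    · by_cases h2 : b = k
      · simp [t, h2]
      · simp [t, h1, h2]
  rw [hset]
  by_cases h : (a, a') ∈ S₀
  · have h' : {z : ι → T | (a, a') ∈ S₀} = Set.univ := by simp [h]
    rw [h', Set.univ_inter, infinitePi_univ_pi_eq_infProd _ ht, Set.indicator_of_mem h,
      Pi.one_apply, one_mul]
    congr 1
    funext b
    simp only [t]
    split_ifs
    · exact measure_univ
    · rfl
  · have h' : {z : ι → T | (a, a') ∈ S₀} = ∅ := by simp [h]
    rw [h', Set.empty_inter, measure_empty, Set.indicator_of_notMem h, zero_mul]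

/-! ### Laws of the marks -/

/-- The laws of a timer and of two fading variables. -/
noncomputable def blockLaw (p : Params) : Fin 3 → Measure ℝ :=
  ![volume.restrict (Set.Icc 0 1), expMeasure p.mu, expMeasure p.mu]

instance (p : Params) (c : Fin 3) : IsProbabilityMeasure (blockLaw p c) := by
  have h := isProbabilityMeasure_expMeasure p.mu_pos
  fin_cases c
  · exact ⟨by simp [blockLaw]⟩
  · exact h
  · exact h

/-- The joint law of a timer and of two fading variables. -/
noncomputable def nodeLaw (p : Params) : Measure (Fin 3 → ℝ) := Measure.infinitePi (blockLaw p)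

instance (p : Params) : IsProbabilityMeasure (nodeLaw p) := by unfold nodeLaw; infer_instance

/-- The marks of a node that matter for AP `i` and eNB `k`: its timer and its channels to AP `i`
and eNB `k`. -/
def nodeMark (i k : ℕ) : ℕ ⊕ ℕ → Fin 3 → Mark
  | .inl j => ![.timerW j, .fadeW j i, .fadeWL j k]
  | .inr m => ![.timerL m, .fadeLW m i, .fadeL m k]

/-- Distinct pairs of a node and a slot name distinct marks, so independence is inherited by the
family. The self-channels `fadeW i i` and `fadeL k k` fill the unused slots of the two Palm nodes.
-/
lemma nodeMark_injective (i k : ℕ) :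
    Function.Injective fun q : (ℕ ⊕ ℕ) × Fin 3 => nodeMark i k q.1 q.2 := by
  rintro ⟨b, c⟩ ⟨b', c'⟩ h
  rcases b with j | m <;> rcases b' with j' | m' <;> fin_cases c <;> fin_cases c' <;>
    simp_all [nodeMark]

lemma IsLBTNetwork.map_mark {p : Params} {Ω : Type*} [MeasurableSpace Ω] {P : Measure Ω}
    {ap enb : ℕ → Ω → Plane} {mark : Mark → Ω → ℝ} (hnet : IsLBTNetwork p 0 1 P ap enb mark)
    (i k : ℕ) (b : ℕ ⊕ ℕ) (c : Fin 3) : P.map (mark (nodeMark i k b c)) = blockLaw p c := by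
  have hu : ProbabilityTheory.cond volume (Set.Icc (0 : ℝ) 1)
      = volume.restrict (Set.Icc (0 : ℝ) 1) := by simp [ProbabilityTheory.cond]
  rcases b with j | m <;> fin_cases c
  · exact (hnet.timerW_law j).trans hu
  · exact (hnet.fadeW_law j i).map_eq
  · exact (hnet.fadeWL_law j k).map_eq
  · exact (hnet.timerL_law m).trans hu
  · exact (hnet.fadeLW_law m i).map_eq
  · exact (hnet.fadeL_law m k).map_eq

/-- Currying groups the independent marks into triples, one for each node; the triples are
independent with the same law for APs and eNBs, since both timers are uniform on the unit interval.
-/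
lemma IsLBTNetwork.map_nodeMark {p : Params} {Ω : Type*} [MeasurableSpace Ω] {P : Measure Ω}
    {ap enb : ℕ → Ω → Plane} {mark : Mark → Ω → ℝ} (hnet : IsLBTNetwork p 0 1 P ap enb mark)
    (i k : ℕ) : P.map (fun ω b c => mark (nodeMark i k b c) ω)
      = Measure.infinitePi fun _ => nodeLaw p := by
  have h := (hnet.iIndep_marks.precomp (nodeMark_injective i k)).map_fun_eq_infinitePi_map
    fun q => hnet.measurable_mark _
  simp only [hnet.map_mark] at h
  have h2 := Measure.infinitePi_map_curry fun (_ : ℕ ⊕ ℕ) (c : Fin 3) => blockLaw p c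
  rw [← h, Measure.map_map (MeasurableEquiv.measurable _)
    (measurable_pi_lambda _ fun q => hnet.measurable_mark _)] at h2
  exact h2

lemma nodeLaw_box (p : Params) {A B C : Set ℝ} :
    nodeLaw p {v | v 0 ∈ A ∧ v 1 ∈ B ∧ v 2 ∈ C}
      = volume.restrict (Set.Icc 0 1) A * expMeasure p.mu B * expMeasure p.mu C := by
  have h : {v : Fin 3 → ℝ | v 0 ∈ A ∧ v 1 ∈ B ∧ v 2 ∈ C} = Set.univ.pi ![A, B, C] := by
    ext v
    simp [Set.mem_pi, Fin.forall_fin_succ]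
  rw [h, nodeLaw, Measure.infinitePi_eq_pi, Measure.pi_pi, Fin.prod_univ_three]
  rfl

lemma restrict_Icc_Iio {t : ℝ} (ht1 : t ≤ 1) :
    (volume.restrict (Set.Icc (0 : ℝ) 1)) (Set.Iio t) = ENNReal.ofReal t := by
  rw [Measure.restrict_apply measurableSet_Iio]
  have : Set.Iio t ∩ Set.Icc 0 1 = Set.Ico 0 t := by
    ext u
    simp only [Set.mem_inter_iff, Set.mem_Iio, Set.mem_Icc, Set.mem_Ico]
    constructor
    · exact fun h => ⟨h.2.1, h.1⟩
    · exact fun h => ⟨h.2, h.1, (h.2.trans_le ht1).le⟩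
  rw [this, Real.volume_Ico, sub_zero]

/-- The rate `c` such that `exp (-c d ^ α)` is the probability that the power received at distance
`d` is above the threshold. -/
noncomputable def Params.rate (p : Params) (θ : ℝ) : ℝ :=
  p.mu * θ * (4 * Real.pi / p.wavelength) ^ 2

lemma Params.rate_pos (p : Params) {θ : ℝ} (hθ : 0 < θ) : 0 < p.rate θ := by
  have := p.mu_pos
  have := p.wavelength_pos
  have := Real.pi_pos
  unfold Params.rate; positivity

lemma Params.exp_neg_loss (p : Params) (θ d : ℝ) :
    Real.exp (-(p.mu * θ * p.loss d)) = radVal (p.rate θ) p.alpha d := by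
  rw [radVal, Params.rate, Params.loss]; ring_nf

lemma Params.loss_pos (p : Params) {d : ℝ} (hd : 0 < d) : 0 < p.loss d := by
  have := p.wavelength_pos
  have := Real.pi_pos
  have := Real.rpow_pos_of_pos hd p.alpha
  unfold Params.loss; positivity

lemma expMeasure_div_le (p : Params) {θ : ℝ} (hθ : 0 < θ) {ℓ : ℝ} (hℓ : 0 < ℓ) :
    expMeasure p.mu {g | g / ℓ ≤ θ} = ENNReal.ofReal (1 - Real.exp (-(p.mu * θ * ℓ))) := by
  have := isProbabilityMeasure_expMeasure p.mu_pos
  have h1 : {g : ℝ | g / ℓ ≤ θ} = Set.Iic (θ * ℓ) := by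
    ext g; simp [div_le_iff₀ hℓ]
  have h2 := cdf_expMeasure_eq p.mu_pos (θ * ℓ)
  rw [if_pos (by positivity), cdf_eq_real] at h2
  rw [h1, ← ENNReal.ofReal_toReal (measure_ne_top (expMeasure p.mu) _), ← measureReal_def, h2,
    mul_assoc]

lemma measurableSet_div_le (ℓ θ : ℝ) : MeasurableSet {g : ℝ | g / ℓ ≤ θ} :=
  measurableSet_le (measurable_id.div_const ℓ) measurable_const

lemma expMeasure_not_div_le (p : Params) {θ : ℝ} (hθ : 0 < θ) {d : ℝ} (hd : 0 ≤ d) :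
    expMeasure p.mu {g | ¬ g / p.loss d ≤ θ}
      = ENNReal.ofReal (sigVal (p.rate θ) p.alpha d) := by
  have := isProbabilityMeasure_expMeasure p.mu_pos
  rcases eq_or_lt_of_le hd with rfl | hd
  -- At distance zero the loss vanishes and the quotient by zero is `0 ≤ θ`, so the node never
  -- blocks; this is the value of `sigVal` at zero.
  · simp [sigVal, Params.loss, Real.zero_rpow p.alpha_pos.ne', hθ.le]
  · have hl := p.loss_pos hd
    rw [sigVal, if_neg hd.ne', ← p.exp_neg_loss]
    have h := prob_compl_eq_one_sub (μ := expMeasure p.mu) (measurableSet_div_le (p.loss d) θ)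
    rw [expMeasure_div_le p hθ hl] at h
    have hle : Real.exp (-(p.mu * θ * p.loss d)) ≤ 1 := by
      rw [Real.exp_le_one_iff]
      have := mul_pos (mul_pos p.mu_pos hθ) hl
      linarith
    change expMeasure p.mu {g | g / p.loss d ≤ θ}ᶜ = _
    rw [h, ← ENNReal.ofReal_one, ← ENNReal.ofReal_sub _ (sub_nonneg.2 hle)]
    congr 1; ring

/-- The weight of a condition. -/
def boolWeight (b : Bool) : ℝ := if b then 1 else 0

lemma boolWeight_nonneg (b : Bool) : 0 ≤ boolWeight b := by cases b <;> simp [boolWeight]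

lemma boolWeight_le_one (b : Bool) : boolWeight b ≤ 1 := by cases b <;> simp [boolWeight]

/-- The probability that a node does not block. -/
lemma nodeLaw_good (p : Params) (b : Bool) {t s θ₁ θ₂ d₁ d₂ : ℝ} (ht : 0 ≤ t) (ht1 : t ≤ 1)
    (hs : 0 ≤ s) (hs1 : s ≤ 1) (hθ₁ : 0 < θ₁) (hθ₂ : 0 < θ₂) (hd₁ : 0 ≤ d₁) (hd₂ : 0 ≤ d₂) :
    nodeLaw p {v | (b = true → v 0 < t → v 1 / p.loss d₁ ≤ θ₁) ∧
        (v 0 < s → v 2 / p.loss d₂ ≤ θ₂)}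
      = 1 - ENNReal.ofReal (mixVal (boolWeight b) t s (sigVal (p.rate θ₁) p.alpha d₁)
          (sigVal (p.rate θ₂) p.alpha d₂)) := by
  have := isProbabilityMeasure_expMeasure p.mu_pos
  set p₁ := sigVal (p.rate θ₁) p.alpha d₁
  set p₂ := sigVal (p.rate θ₂) p.alpha d₂
  have hp₁ : 0 ≤ p₁ := sigVal_nonneg _
  have hp₂ : 0 ≤ p₂ := sigVal_nonneg _
  let F₁ : Set ℝ := {g | ¬ g / p.loss d₁ ≤ θ₁}
  let F₂ : Set ℝ := {g | ¬ g / p.loss d₂ ≤ θ₂}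
  have hF₁ : MeasurableSet F₁ := (measurableSet_div_le _ _).compl
  have hF₂ : MeasurableSet F₂ := (measurableSet_div_le _ _).compl
  have hbox : ∀ {A B C : Set ℝ}, MeasurableSet A → MeasurableSet B → MeasurableSet C →
      MeasurableSet {v : Fin 3 → ℝ | v 0 ∈ A ∧ v 1 ∈ B ∧ v 2 ∈ C} := fun hA hB hC =>
    (measurable_pi_apply 0 hA).inter ((measurable_pi_apply 1 hB).inter (measurable_pi_apply 2 hC))
  let B₂ : Set (Fin 3 → ℝ) := {v | v 0 ∈ Set.Iio s ∧ v 1 ∈ Set.univ ∧ v 2 ∈ F₂}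
  have hB₂m : MeasurableSet B₂ := hbox measurableSet_Iio .univ hF₂
  have hB₂ : nodeLaw p B₂ = ENNReal.ofReal (s * p₂) := by
    rw [nodeLaw_box, restrict_Icc_Iio hs1, measure_univ, mul_one,
      expMeasure_not_div_le p hθ₂ hd₂, ← ENNReal.ofReal_mul hs]
  cases b with
  | false =>
    have hset : {v : Fin 3 → ℝ | (false = true → v 0 < t → v 1 / p.loss d₁ ≤ θ₁) ∧
        (v 0 < s → v 2 / p.loss d₂ ≤ θ₂)} = B₂ᶜ := by
      ext v
      simp [B₂, F₂]
    rw [hset, prob_compl_eq_one_sub hB₂m, hB₂]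
    simp [mixVal, boolWeight]
  | true =>
    let B₁ : Set (Fin 3 → ℝ) := {v | v 0 ∈ Set.Iio t ∧ v 1 ∈ F₁ ∧ v 2 ∈ Set.univ}
    have hB₁m : MeasurableSet B₁ := hbox measurableSet_Iio hF₁ .univ
    have hB₁ : nodeLaw p B₁ = ENNReal.ofReal (t * p₁) := by
      rw [nodeLaw_box, restrict_Icc_Iio ht1, measure_univ, mul_one,
        expMeasure_not_div_le p hθ₁ hd₁, ← ENNReal.ofReal_mul ht]
    -- Both blocking events are governed by the same timer, which must lie below both thresholds;
    -- this is the origin of `min t s`.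
    have hB₁₂ : nodeLaw p (B₁ ∩ B₂) = ENNReal.ofReal (min t s * p₁ * p₂) := by
      have h : B₁ ∩ B₂ = {v | v 0 ∈ Set.Iio (min t s) ∧ v 1 ∈ F₁ ∧ v 2 ∈ F₂} := by
        ext v
        simp only [B₁, B₂, Set.mem_inter_iff, Set.mem_ofPred_eq, Set.mem_Iio, Set.mem_univ,
          lt_min_iff]
        tauto
      have hm : 0 ≤ min t s := le_min ht hs
      rw [h, nodeLaw_box, restrict_Icc_Iio ((min_le_left _ _).trans ht1),
        expMeasure_not_div_le p hθ₁ hd₁, expMeasure_not_div_le p hθ₂ hd₂,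
        ← ENNReal.ofReal_mul hm, ← ENNReal.ofReal_mul (mul_nonneg hm hp₁)]
    have hset : {v : Fin 3 → ℝ | (true = true → v 0 < t → v 1 / p.loss d₁ ≤ θ₁) ∧
        (v 0 < s → v 2 / p.loss d₂ ≤ θ₂)} = (B₁ ∪ B₂)ᶜ := by
      ext v
      simp [B₁, B₂, F₁, F₂]
    rw [hset, prob_compl_eq_one_sub (hB₁m.union hB₂m)]
    congr 1
    have h := measureReal_union_add_inter (μ := nodeLaw p) (s := B₁) (t := B₂) hB₂m
    rw [measureReal_def, measureReal_def, measureReal_def, measureReal_def, hB₁, hB₂, hB₁₂,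
      ENNReal.toReal_ofReal (mul_nonneg ht hp₁), ENNReal.toReal_ofReal (mul_nonneg hs hp₂),
      ENNReal.toReal_ofReal (mul_nonneg (mul_nonneg (le_min ht hs) hp₁) hp₂)] at h
    rw [← ENNReal.ofReal_toReal (measure_ne_top (nodeLaw p) (B₁ ∪ B₂))]
    congr 1
    unfold mixVal boolWeight
    simp only [if_true, one_mul]
    linarith

/-! ### The transmission event in terms of the marks -/

/-- The node `k` is tagged and transmits, and AP `i` transmits if `b` is set. -/
def jointEvent (p : Params) (b : Bool) (s : Snapshot) (i k : ℕ) : Prop :=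
  IsTagged s k ∧ enbTransmits p s k ∧ (b = true → apTransmits p s i)

/-- A node at `w` with marks `q.2` lies outside the open disc of radius `r` and blocks neither the
node at `x` nor the node at `y`, whose marks are `q.1`. -/
def goodSet (p : Params) (b : Bool) (θ₁ θ₂ r : ℝ) (x y w : Plane) :
    Set (((Fin 3 → ℝ) × (Fin 3 → ℝ)) × (Fin 3 → ℝ)) :=
  {q | ¬ ‖w‖ < r ∧ (b = true → q.2 0 < q.1.1 0 → q.2 1 / p.loss ‖w - x‖ ≤ θ₁) ∧
    (q.2 0 < q.1.2 0 → q.2 2 / p.loss ‖w - y‖ ≤ θ₂)}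

/-- The AP at `x` and the eNB at `y`, with marks `q.1` and `q.2`, do not block each other. -/
def mutualSet (p : Params) (b : Bool) (x y : Plane) : Set ((Fin 3 → ℝ) × (Fin 3 → ℝ)) :=
  {q | (b = true → q.2 0 < q.1 0 → q.2 1 / p.loss ‖y - x‖ ≤ p.thrED / p.PL) ∧
    (q.1 0 < q.2 0 → q.1 2 / p.loss ‖y - x‖ ≤ p.thrL / p.PW)}

/-- The sets `goodSet` for the APs and the eNBs. -/
def goodFamily (p : Params) (b : Bool) (r : ℝ) (x y : Plane) (z w : ℕ → Plane) :
    ℕ ⊕ ℕ → Set (((Fin 3 → ℝ) × (Fin 3 → ℝ)) × (Fin 3 → ℝ))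
  | .inl j => goodSet p b (p.thrCS / p.PW) (p.thrL / p.PW) 0 x y (z j)
  | .inr m => goodSet p b (p.thrED / p.PL) (p.thrL / p.PL) r x y (w m)

/-- The clauses that involve AP `i` and eNB `k` alone form the mutual condition, and every other
clause concerns one further node. The tagging inequality for an eNB says that it lies outside the
open disc of radius `‖w k‖`; for APs the radius is zero and the condition is vacuous. -/
lemma jointEvent_iff (p : Params) (b : Bool) (z w : ℕ → Plane) (mk : Mark → ℝ) (i k : ℕ) :
    jointEvent p b (z, w, mk) i k ↔
      (mk ∘ nodeMark i k (.inl i), mk ∘ nodeMark i k (.inr k)) ∈ mutualSet p b (z i) (w k) ∧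
      ∀ β, β ≠ .inl i → β ≠ .inr k →
        ((mk ∘ nodeMark i k (.inl i), mk ∘ nodeMark i k (.inr k)), mk ∘ nodeMark i k β)
          ∈ goodFamily p b ‖w k‖ (z i) (w k) z w β := by
  constructor
  · rintro ⟨htag, ⟨he1, he2⟩, hap⟩
    refine ⟨⟨fun hb => (hap hb).2 k, ?_⟩, ?_⟩
    · exact he1 i
    · rintro (j | m) h1 h2
      · refine ⟨not_lt.2 (norm_nonneg _), fun hb => ?_, ?_⟩
        · exact (hap hb).1 j fun h => h1 (by rw [h])
        · have := he1 j
          rw [Snapshot.enb, Snapshot.ap, norm_sub_rev] at this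
          exact this
      · refine ⟨not_lt.2 (htag m), fun hb => ?_, ?_⟩
        · exact (hap hb).2 m
        · exact he2 m fun h => h2 (by rw [h])
  · rintro ⟨⟨hm1, hm2⟩, hg⟩
    refine ⟨fun m => ?_, ⟨fun j => ?_, fun m hm => ?_⟩, fun hb => ⟨fun j hj => ?_, fun m => ?_⟩⟩
    · by_cases hm : m = k
      · rw [hm]
      · exact not_lt.1 (hg (.inr m) (by simp) (by simpa using hm)).1
    · by_cases hj : j = i
      · subst hj; exact hm2
      · have := (hg (.inl j) (by simpa using hj) (by simp)).2.2
        rw [Snapshot.enb, Snapshot.ap, norm_sub_rev]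
        exact this
    · exact (hg (.inr m) (by simp) (by simpa using hm)).2.2
    · exact (hg (.inl j) (by simpa using hj) (by simp)).2.1 hb
    · by_cases hm : m = k
      · subst hm; exact hm1 hb
      · exact (hg (.inr m) (by simp) (by simpa using hm)).2.1 hb

lemma measurable_le_prop {T : Type*} [MeasurableSpace T] {f g : T → ℝ} (hf : Measurable f)
    (hg : Measurable g) : Measurable fun a => f a ≤ g a :=
  measurableSet_setOfPred.1 (measurableSet_le hf hg)

lemma measurable_lt_prop {T : Type*} [MeasurableSpace T] {f g : T → ℝ} (hf : Measurable f)
    (hg : Measurable g) : Measurable fun a => f a < g a :=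
  measurableSet_setOfPred.1 (measurableSet_lt hf hg)

lemma measurable_imp_div_le {T : Type*} [MeasurableSpace T] {f g h l : T → ℝ} (hf : Measurable f)
    (hg : Measurable g) (hh : Measurable h) (hl : Measurable l) (θ : ℝ) :
    Measurable fun a => (f a < g a → h a / l a ≤ θ) :=
  (measurable_lt_prop hf hg).imp (measurable_le_prop (hh.div hl) measurable_const)

lemma measurableSet_goodSet (p : Params) (b : Bool) (θ₁ θ₂ r : ℝ) (x y w : Plane) :
    MeasurableSet (goodSet p b θ₁ θ₂ r x y w) := by
  refine measurableSet_setOfPred.2 (measurable_const.and (Measurable.and ?_ ?_))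
  · exact measurable_const.imp (measurable_imp_div_le (by fun_prop) (by fun_prop) (by fun_prop)
      measurable_const _)
  · exact measurable_imp_div_le (by fun_prop) (by fun_prop) (by fun_prop) measurable_const _

lemma measurableSet_goodFamily (p : Params) (b : Bool) (r : ℝ) (x y : Plane) (z w : ℕ → Plane)
    (β : ℕ ⊕ ℕ) : MeasurableSet (goodFamily p b r x y z w β) := by
  rcases β with j | m
  · exact measurableSet_goodSet ..
  · exact measurableSet_goodSet ..

lemma measurableSet_mutualSet (p : Params) (b : Bool) (x y : Plane) :
    MeasurableSet (mutualSet p b x y) := by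
  refine measurableSet_setOfPred.2 (Measurable.and ?_ ?_)
  · exact measurable_const.imp (measurable_imp_div_le (by fun_prop) (by fun_prop) (by fun_prop)
      measurable_const _)
  · exact measurable_imp_div_le (by fun_prop) (by fun_prop) (by fun_prop) measurable_const _

lemma Params.measurable_loss (p : Params) : Measurable p.loss :=
  measurable_const.mul (measurable_id.pow_const _)

lemma measurableSet_jointEvent (p : Params) (b : Bool) (i k : ℕ) :
    MeasurableSet {s : Snapshot | jointEvent p b s i k} := by
  have hap : ∀ j, Measurable fun s : Snapshot => s.ap j := fun j =>
    (measurable_pi_apply j).comp measurable_fst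
  have henb : ∀ j, Measurable fun s : Snapshot => s.enb j := fun j =>
    (measurable_pi_apply j).comp measurable_snd.fst
  have hmark : ∀ m, Measurable fun s : Snapshot => s.mark m := fun m =>
    (measurable_pi_apply m).comp measurable_snd.snd
  have hl : ∀ {u v : Snapshot → Plane}, Measurable u → Measurable v →
      Measurable fun s => p.loss ‖u s - v s‖ := fun hu hv =>
    p.measurable_loss.comp (hu.sub hv).norm
  refine measurableSet_setOfPred.2 (Measurable.and ?_ (Measurable.and (Measurable.and ?_ ?_)
    (measurable_const.imp (Measurable.and ?_ ?_))))
  · exact Measurable.forall fun m => measurable_le_prop (henb k).norm (henb m).norm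
  · exact Measurable.forall fun j =>
      measurable_imp_div_le (hmark _) (hmark _) (hmark _) (hl (henb k) (hap j)) _
  · exact Measurable.forall fun m => measurable_const.imp
      (measurable_imp_div_le (hmark _) (hmark _) (hmark _) (hl (henb m) (henb k)) _)
  · exact Measurable.forall fun j => measurable_const.imp
      (measurable_imp_div_le (hmark _) (hmark _) (hmark _) (hl (hap j) (hap i)) _)
  · exact Measurable.forall fun m =>
      measurable_imp_div_le (hmark _) (hmark _) (hmark _) (hl (henb m) (hap i)) _

/-- The probability that a node at `w` lies outside the open disc of radius `r` and does not block
the nodes at `x` and `y`, whose timers are `t` and `s`. -/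
noncomputable def nodeFactor (p : Params) (b : Bool) (θ₁ θ₂ r : ℝ) (x y : Plane) (t s : ℝ)
    (w : Plane) : ℝ≥0∞ :=
  1 - ENNReal.ofReal (blockProb p.alpha (p.rate θ₁) (p.rate θ₂) r x y (boolWeight b) t s w)

lemma nodeLaw_goodSet (p : Params) (b : Bool) {θ₁ θ₂ : ℝ} (hθ₁ : 0 < θ₁) (hθ₂ : 0 < θ₂) (r : ℝ)
    (x y w : Plane) {a a' : Fin 3 → ℝ} (ha : a 0 ∈ Set.Icc (0 : ℝ) 1)
    (ha' : a' 0 ∈ Set.Icc (0 : ℝ) 1) :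
    nodeLaw p {v | ((a, a'), v) ∈ goodSet p b θ₁ θ₂ r x y w}
      = nodeFactor p b θ₁ θ₂ r x y (a 0) (a' 0) w := by
  unfold nodeFactor blockProb
  by_cases h : ‖w‖ < r
  · have : {v | ((a, a'), v) ∈ goodSet p b θ₁ θ₂ r x y w} = ∅ := by
      ext v; simp [goodSet, h]
    rw [this, if_pos h]; simp
  · rw [if_neg h, ← nodeLaw_good p b ha.1 ha.2 ha'.1 ha'.2 hθ₁ hθ₂ (norm_nonneg _) (norm_nonneg _)]
    congr 1
    ext v
    simp [goodSet, h]

lemma nodeLaw_ae_timer (p : Params) : ∀ᵐ a ∂nodeLaw p, a 0 ∈ Set.Icc (0 : ℝ) 1 := by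
  have h := Measure.infinitePi_map_eval (blockLaw p) 0
  refine ae_of_ae_map (f := fun a : Fin 3 → ℝ => a 0) (measurable_pi_apply 0).aemeasurable
    (p := fun t => t ∈ Set.Icc (0 : ℝ) 1) ?_
  rw [nodeLaw, h]
  exact ae_restrict_mem measurableSet_Icc

/-- The probability of the transmission event for fixed positions. -/
lemma IsLBTNetwork.prob_jointEvent {p : Params} {Ω : Type*} [MeasurableSpace Ω] {P : Measure Ω}
    {ap enb : ℕ → Ω → Plane} {mark : Mark → Ω → ℝ} (hnet : IsLBTNetwork p 0 1 P ap enb mark)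
    (b : Bool) (z w : ℕ → Plane) (i k : ℕ) {x y : Plane} (hz : z i = x) (hw : w k = y) :
    P {ω | jointEvent p b (z, w, fun m => mark m ω) i k}
      = ∫⁻ a, ∫⁻ a', (mutualSet p b x y).indicator 1 (a, a') *
          (redProd (fun j => nodeFactor p b (p.thrCS / p.PW) (p.thrL / p.PW) 0 x y
              (a 0) (a' 0) (z j)) i *
            redProd (fun m => nodeFactor p b (p.thrED / p.PL) (p.thrL / p.PL) ‖y‖ x y
              (a 0) (a' 0) (w m)) k) ∂nodeLaw p ∂nodeLaw p := by
  classical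
  subst hz hw
  have hPW := p.PW_pos
  have hPL := p.PL_pos
  have hset : {ω | jointEvent p b (z, w, fun m => mark m ω) i k}
      = (fun ω b c => mark (nodeMark i k b c) ω) ⁻¹' {Z | (Z (.inl i), Z (.inr k)) ∈
        mutualSet p b (z i) (w k) ∧ ∀ β, β ≠ .inl i → β ≠ .inr k →
          ((Z (.inl i), Z (.inr k)), Z β) ∈ goodFamily p b ‖w k‖ (z i) (w k) z w β} := by
    ext ω
    exact jointEvent_iff p b z w (fun m => mark m ω) i k
  have hmeas : Measurable fun ω (b : ℕ ⊕ ℕ) (c : Fin 3) => mark (nodeMark i k b c) ω :=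
    measurable_pi_lambda _ fun b => measurable_pi_lambda _ fun c => hnet.measurable_mark _
  have hev : ∀ b : ℕ ⊕ ℕ, Measurable fun Z : ℕ ⊕ ℕ → Fin 3 → ℝ => Z b := measurable_pi_apply
  have hpair := (hev (.inl i)).prodMk (hev (.inr k))
  have hD : MeasurableSet {Z : ℕ ⊕ ℕ → Fin 3 → ℝ | (Z (.inl i), Z (.inr k)) ∈
        mutualSet p b (z i) (w k) ∧ ∀ β, β ≠ .inl i → β ≠ .inr k →
          ((Z (.inl i), Z (.inr k)), Z β) ∈ goodFamily p b ‖w k‖ (z i) (w k) z w β} := by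
    refine measurableSet_setOfPred.2 (Measurable.and ?_ (Measurable.forall fun β =>
      measurable_const.imp (measurable_const.imp ?_)))
    · exact measurableSet_setOfPred.1 (hpair (measurableSet_mutualSet p b _ _))
    · exact measurableSet_setOfPred.1 ((hpair.prodMk (hev β))
        (measurableSet_goodFamily p b _ _ _ _ _ β))
  rw [hset, ← Measure.map_apply hmeas hD, hnet.map_nodeMark,
    infinitePi_two_coordinates (nodeLaw p) (by simp) (measurableSet_mutualSet p b _ _)
      (measurableSet_goodFamily p b _ _ _ _ _)]
  refine lintegral_congr_ae ?_
  filter_upwards [nodeLaw_ae_timer p] with a ha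
  refine lintegral_congr_ae ?_
  filter_upwards [nodeLaw_ae_timer p] with a' ha'
  congr 1
  have hfac : (fun β : ℕ ⊕ ℕ => if β = .inl i ∨ β = .inr k then 1 else
      nodeLaw p {v | ((a, a'), v) ∈ goodFamily p b ‖w k‖ (z i) (w k) z w β})
      = Sum.elim (Function.update (fun j => nodeFactor p b (p.thrCS / p.PW) (p.thrL / p.PW) 0
          (z i) (w k) (a 0) (a' 0) (z j)) i 1)
        (Function.update (fun m => nodeFactor p b (p.thrED / p.PL) (p.thrL / p.PL) ‖w k‖
          (z i) (w k) (a 0) (a' 0) (w m)) k 1) := by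
    funext β
    rcases β with j | m
    · by_cases hj : j = i
      · subst hj; simp
      · simp only [Sum.inl.injEq, hj, reduceCtorEq, or_self, if_false, Sum.elim_inl,
          Function.update_of_ne hj]
        exact nodeLaw_goodSet p b (div_pos p.thrCS_pos hPW) (div_pos p.thrL_pos hPW) _ _ _ _ ha ha'
    · by_cases hm : m = k
      · subst hm; simp
      · simp only [Sum.inr.injEq, hm, reduceCtorEq, or_self, if_false, Sum.elim_inr,
          Function.update_of_ne hm]
        exact nodeLaw_goodSet p b (div_pos p.thrED_pos hPL) (div_pos p.thrL_pos hPL) _ _ _ _ ha ha'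
  refine (Eq.trans (by congr!) (congrArg infProd hfac)).trans ?_
  rw [infProd_sum]
  · rfl
  · intro j
    by_cases hj : j = i
    · subst hj; simp
    · rw [Function.update_of_ne hj]; exact tsub_le_self

/-! ### The Palm probability of the transmission event -/

/-- Independence turns the joint law into a product, and Tonelli freezes the first variable. It is
used to freeze all positions and average over the marks. -/
lemma measure_indepFun_eq_lintegral {Ω S T : Type*} [MeasurableSpace Ω] [MeasurableSpace S]
    [MeasurableSpace T] {P : Measure Ω} [IsProbabilityMeasure P] {f : Ω → S} {g : Ω → T}
    (hf : Measurable f) (hg : Measurable g) (h : IndepFun f g P) {D : Set (S × T)}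
    (hD : MeasurableSet D) :
    P {ω | (f ω, g ω) ∈ D} = ∫⁻ ω, P {ω' | (f ω, g ω') ∈ D} ∂P := by
  have h1 := (indepFun_iff_map_prod_eq_prod_map_map hf.aemeasurable hg.aemeasurable).1 h
  have h2 : P {ω | (f ω, g ω) ∈ D} = P.map (fun ω => (f ω, g ω)) D :=
    (Measure.map_apply (hf.prodMk hg) hD).symm
  rw [h2, h1, Measure.prod_apply hD, lintegral_map (measurable_measure_prodMk_left hD) hf]
  refine lintegral_congr fun ω => ?_
  rw [Measure.map_apply hg (measurable_prodMk_left hD)]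
  rfl

lemma tsum_mul_tsum_prod {ι κ : Type*} (f : ι → ℝ≥0∞) (g : κ → ℝ≥0∞) :
    ∑' ik : ι × κ, f ik.1 * g ik.2 = (∑' i, f i) * ∑' k, g k := by
  rw [ENNReal.tsum_prod (f := fun i k => f i * g k)]
  simp_rw [ENNReal.tsum_mul_left]
  rw [ENNReal.tsum_mul_right]

/-- The event `jointEvent` as a set of network realizations with the indices of the Palm points. -/
def palmEvent (p : Params) (b : Bool) : Set (Snapshot × ℕ × ℕ) :=
  {q | jointEvent p b q.1 q.2.1 q.2.2}

lemma measurableSet_palmEvent (p : Params) (b : Bool) : MeasurableSet (palmEvent p b) := by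
  have h : palmEvent p b = ⋃ ik : ℕ × ℕ, {s : Snapshot | jointEvent p b s ik.1 ik.2} ×ˢ {ik} := by
    ext ⟨s, ik⟩
    simp [palmEvent]
  rw [h]
  exact MeasurableSet.iUnion fun ik =>
    (measurableSet_jointEvent p b ik.1 ik.2).prod (measurableSet_singleton ik)

/-- The probability that no other node blocks the transmissions, for timers `t` and `s`. -/
noncomputable def clearProb (p : Params) (b : Bool) (x y : Plane) (t s : ℝ) : ℝ :=
  Real.exp (-(p.lamW * meanVal p.alpha (p.rate (p.thrCS / p.PW)) (p.rate (p.thrL / p.PW)) 0 x y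
      (boolWeight b) t s)) *
    Real.exp (-(p.lamL * ((volume (Metric.closedBall (0 : Plane) ‖y‖)).toReal +
      meanVal p.alpha (p.rate (p.thrED / p.PL)) (p.rate (p.thrL / p.PL)) ‖y‖ x y
        (boolWeight b) t s)))

lemma measurable_nodeFactor (p : Params) (b : Bool) (θ₁ θ₂ r : ℝ) (x y : Plane) :
    Measurable fun a : (ℝ × ℝ) × Plane => nodeFactor p b θ₁ θ₂ r x y a.1.1 a.1.2 a.2 :=
  (measurable_blockProb p.alpha_pos.le x y (boolWeight b)).ennreal_ofReal.const_sub 1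

/-- The contribution of a node to the Palm expectation, for given timers `t` and `s`. -/
noncomputable def palmTerm (A : Set Plane) (o : Plane) (f : ℝ → ℝ → Plane → ℝ≥0∞) (i : ℕ)
    (t s : ℝ) (z : ℕ → Plane) : ℝ≥0∞ :=
  A.indicator 1 (z i) * redProd (fun j => f t s (z j + (o - z i))) i

lemma tsum_palmTerm {Ω : Type*} [MeasurableSpace Ω] (P : Measure Ω) (X : ℕ → Ω → Plane)
    (A : Set Plane) (o : Plane) (f : ℝ → ℝ → Plane → ℝ≥0∞) (t s : ℝ) :
    ∑' i, ∫⁻ ω, palmTerm A o f i t s (fun n => X n ω) ∂P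
      = palmCampbell P X A o fun w => f t s w := rfl

section
variable {p : Params} {Ω : Type*} [MeasurableSpace Ω] {P : Measure Ω} [IsProbabilityMeasure P]
    {ap enb : ℕ → Ω → Plane} {mark : Mark → Ω → ℝ}

lemma nodeFactor_eq (p : Params) (b : Bool) (θ₁ θ₂ r : ℝ) (x y : Plane) (t s : ℝ) :
    (fun w => nodeFactor p b θ₁ θ₂ r x y t s w) = fun w => 1 - ENNReal.ofReal
      (blockProb p.alpha (p.rate θ₁) (p.rate θ₂) r x y (boolWeight b) t s w) := rfl

lemma measurable_palmTerm {A : Set Plane} (hA : MeasurableSet A) (o : Plane)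
    {f : ℝ → ℝ → Plane → ℝ≥0∞}
    (hf : Measurable fun a : (ℝ × ℝ) × Plane => f a.1.1 a.1.2 a.2) (i : ℕ) :
    Measurable fun a : (ℝ × ℝ) × (ℕ → Plane) => palmTerm A o f i a.1.1 a.1.2 a.2 := by
  have hz : ∀ j, Measurable fun a : (ℝ × ℝ) × (ℕ → Plane) => a.2 j := fun j =>
    (measurable_pi_apply j).comp measurable_snd
  refine ((measurable_one.indicator hA).comp (hz i)).mul (measurable_redProd (fun j => ?_) i)
  exact hf.comp (measurable_fst.prodMk ((hz j).add ((hz i).const_sub o)))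

lemma measurable_lintegral_palmTerm {X : ℕ → Ω → Plane} (hX : ∀ n, Measurable (X n)) {A : Set Plane}
    (hA : MeasurableSet A) (o : Plane) {f : ℝ → ℝ → Plane → ℝ≥0∞}
    (hf : Measurable fun a : (ℝ × ℝ) × Plane => f a.1.1 a.1.2 a.2) (i : ℕ) :
    Measurable fun q : (Fin 3 → ℝ) × (Fin 3 → ℝ) =>
      ∫⁻ ω, palmTerm A o f i (q.1 0) (q.2 0) (fun n => X n ω) ∂P := by
  have h : Measurable fun a : ℝ × ℝ => ∫⁻ ω, palmTerm A o f i a.1 a.2 (fun n => X n ω) ∂P :=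
    Measurable.lintegral_prod_right' (f := fun u : (ℝ × ℝ) × Ω =>
      palmTerm A o f i u.1.1 u.1.2 (fun n => X n u.2))
      ((measurable_palmTerm hA o hf i).comp
        (measurable_fst.prodMk ((measurable_pi_lambda _ hX).comp measurable_snd)))
  have hqt : Measurable fun q : (Fin 3 → ℝ) × (Fin 3 → ℝ) => (q.1 0, q.2 0) := by fun_prop
  have h' := h.comp hqt
  exact h'

/-- Positions are frozen first, since the marks are independent of them, and `prob_jointEvent` gives
the product over the other nodes. Tonelli then brings the marks of the two Palm nodes outside, and
independence of the AP and eNB positions splits the remaining expectation into two factors. -/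
lemma IsLBTNetwork.palm_term (hnet : IsLBTNetwork p 0 1 P ap enb mark) (b : Bool)
    {A B : Set Plane} (hA : MeasurableSet A) (hB : MeasurableSet B) (x y : Plane) (i k : ℕ) :
    ((P.restrict {ω | ap i ω ∈ A ∧ enb k ω ∈ B}).map (fun ω =>
        (Snapshot.translate ((fun n => ap n ω), (fun n => enb n ω), (fun m => mark m ω))
          (x - ap i ω) (y - enb k ω), ((i, k) : ℕ × ℕ)))) (palmEvent p b)
      = ∫⁻ q, (mutualSet p b x y).indicator 1 q *
        ((∫⁻ ω, palmTerm A x (nodeFactor p b (p.thrCS / p.PW) (p.thrL / p.PW) 0 x y) i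
            (q.1 0) (q.2 0) (fun n => ap n ω) ∂P) *
          ∫⁻ ω, palmTerm B y (nodeFactor p b (p.thrED / p.PL) (p.thrL / p.PL) ‖y‖ x y) k
            (q.1 0) (q.2 0) (fun n => enb n ω) ∂P) ∂((nodeLaw p).prod (nodeLaw p)) := by
  have hap := hnet.poisson_ap.measurable
  have henb := hnet.poisson_enb.measurable
  have hmark := hnet.measurable_mark
  have hapm : Measurable fun ω n => ap n ω := measurable_pi_lambda _ hap
  have henbm : Measurable fun ω n => enb n ω := measurable_pi_lambda _ henb
  have hmarkm : Measurable fun ω m => mark m ω := measurable_pi_lambda _ hmark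
  have hposm : Measurable fun ω => ((fun n => ap n ω), (fun n => enb n ω)) := hapm.prodMk henbm
  have htr : Measurable fun q : ((ℕ → Plane) × (ℕ → Plane)) × (Mark → ℝ) =>
      ((fun n => q.1.1 n + (x - q.1.1 i), fun n => q.1.2 n + (y - q.1.2 k), q.2) : Snapshot) := by
    refine Measurable.prodMk (measurable_pi_lambda _ fun n => ?_)
      (Measurable.prodMk (measurable_pi_lambda _ fun n => ?_) measurable_snd)
    · exact (by fun_prop : Measurable fun q : ((ℕ → Plane) × (ℕ → Plane)) × (Mark → ℝ) =>
        q.1.1 n + (x - q.1.1 i))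
    · exact (by fun_prop : Measurable fun q : ((ℕ → Plane) × (ℕ → Plane)) × (Mark → ℝ) =>
        q.1.2 n + (y - q.1.2 k))
  have hmapm : Measurable fun ω =>
      (Snapshot.translate ((fun n => ap n ω), (fun n => enb n ω), (fun m => mark m ω))
          (x - ap i ω) (y - enb k ω), ((i, k) : ℕ × ℕ)) :=
    (htr.comp (hposm.prodMk hmarkm)).prodMk measurable_const
  let D : Set (((ℕ → Plane) × (ℕ → Plane)) × (Mark → ℝ)) :=
    {q | (q.1.1 i ∈ A ∧ q.1.2 k ∈ B) ∧ jointEvent p b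
      (fun n => q.1.1 n + (x - q.1.1 i), fun n => q.1.2 n + (y - q.1.2 k), q.2) i k}
  have hD : MeasurableSet D := by
    refine MeasurableSet.inter (MeasurableSet.inter ?_ ?_) (htr (measurableSet_jointEvent p b i k))
    · exact (by fun_prop : Measurable fun q : ((ℕ → Plane) × (ℕ → Plane)) × (Mark → ℝ) =>
        q.1.1 i) hA
    · exact (by fun_prop : Measurable fun q : ((ℕ → Plane) × (ℕ → Plane)) × (Mark → ℝ) =>
        q.1.2 k) hB
  have h1 : ((P.restrict {ω | ap i ω ∈ A ∧ enb k ω ∈ B}).map (fun ω =>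
        (Snapshot.translate ((fun n => ap n ω), (fun n => enb n ω), (fun m => mark m ω))
          (x - ap i ω) (y - enb k ω), ((i, k) : ℕ × ℕ)))) (palmEvent p b)
      = P {ω | (((fun n => ap n ω), (fun n => enb n ω)), fun m => mark m ω) ∈ D} := by
    rw [Measure.map_apply hmapm (measurableSet_palmEvent p b),
      Measure.restrict_apply (hmapm (measurableSet_palmEvent p b)), Set.inter_comm]
    rfl
  rw [h1, measure_indepFun_eq_lintegral hposm hmarkm hnet.indep_marks hD]
  set fW := nodeFactor p b (p.thrCS / p.PW) (p.thrL / p.PW) 0 x y with hfW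
  set fL := nodeFactor p b (p.thrED / p.PL) (p.thrL / p.PL) ‖y‖ x y with hfL
  have hmW := measurable_palmTerm hA x (f := fW) (measurable_nodeFactor p b _ _ _ x y) i
  have hmL := measurable_palmTerm hB y (f := fL) (measurable_nodeFactor p b _ _ _ x y) k
  have hqt : Measurable fun q : (Fin 3 → ℝ) × (Fin 3 → ℝ) => (q.1 0, q.2 0) := by fun_prop
  have hind : Measurable ((mutualSet p b x y).indicator (1 : (Fin 3 → ℝ) × (Fin 3 → ℝ) → ℝ≥0∞)) :=
    measurable_one.indicator (measurableSet_mutualSet p b x y)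
  have hW : Measurable fun u : Ω × ((Fin 3 → ℝ) × (Fin 3 → ℝ)) =>
      palmTerm A x fW i (u.2.1 0) (u.2.2 0) (fun n => ap n u.1) :=
    hmW.comp ((hqt.comp measurable_snd).prodMk (hapm.comp measurable_fst))
  have hL : Measurable fun u : Ω × ((Fin 3 → ℝ) × (Fin 3 → ℝ)) =>
      palmTerm B y fL k (u.2.1 0) (u.2.2 0) (fun n => enb n u.1) :=
    hmL.comp ((hqt.comp measurable_snd).prodMk (henbm.comp measurable_fst))
  have hjoint : Measurable fun u : Ω × ((Fin 3 → ℝ) × (Fin 3 → ℝ)) =>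
      (mutualSet p b x y).indicator 1 u.2 *
        (palmTerm A x fW i (u.2.1 0) (u.2.2 0) (fun n => ap n u.1) *
          palmTerm B y fL k (u.2.1 0) (u.2.2 0) (fun n => enb n u.1)) :=
    (hind.comp measurable_snd).mul (hW.mul hL)
  have h2 : ∀ ω, P {ω' | (((fun n => ap n ω), (fun n => enb n ω)), fun m => mark m ω') ∈ D}
      = ∫⁻ q, (mutualSet p b x y).indicator 1 q *
        (palmTerm A x fW i (q.1 0) (q.2 0) (fun n => ap n ω) *
          palmTerm B y fL k (q.1 0) (q.2 0) (fun n => enb n ω))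
        ∂((nodeLaw p).prod (nodeLaw p)) := fun ω => by
    by_cases hAB : ap i ω ∈ A ∧ enb k ω ∈ B
    · have hs : {ω' | (((fun n => ap n ω), (fun n => enb n ω)), fun m => mark m ω') ∈ D}
          = {ω' | jointEvent p b (fun n => ap n ω + (x - ap i ω),
              fun n => enb n ω + (y - enb k ω), fun m => mark m ω') i k} := by
        ext ω'
        exact and_iff_right hAB
      have hjω : Measurable fun q => (mutualSet p b x y).indicator 1 q *
          (palmTerm A x fW i (q.1 0) (q.2 0) (fun n => ap n ω) *
            palmTerm B y fL k (q.1 0) (q.2 0) (fun n => enb n ω)) :=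
        hjoint.comp (measurable_prodMk_left (x := ω))
      rw [hs, hnet.prob_jointEvent b _ _ i k (add_sub_cancel _ _) (add_sub_cancel _ _)]
      refine Eq.trans ?_ (lintegral_prod _ hjω.aemeasurable).symm
      simp only [palmTerm, Set.indicator_of_mem hAB.1, Set.indicator_of_mem hAB.2, Pi.one_apply,
        one_mul]
      rfl
    · have hs : {ω' | (((fun n => ap n ω), (fun n => enb n ω)), fun m => mark m ω') ∈ D} = ∅ := by
        ext ω'
        exact iff_of_false (fun h => hAB h.1) (Set.notMem_empty _)
      rw [hs, measure_empty]
      have h0 : ∀ t s : ℝ, palmTerm A x fW i t s (fun n => ap n ω) *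
          palmTerm B y fL k t s (fun n => enb n ω) = 0 := fun t s => by
        rcases not_and_or.1 hAB with h | h <;> simp [palmTerm, h]
      simp [h0]
  simp_rw [h2]
  rw [lintegral_lintegral_swap hjoint.aemeasurable]
  refine lintegral_congr fun q => ?_
  have hWLq : Measurable fun ω => palmTerm A x fW i (q.1 0) (q.2 0) (fun n => ap n ω) *
      palmTerm B y fL k (q.1 0) (q.2 0) (fun n => enb n ω) :=
    (hW.mul hL).comp (measurable_prodMk_right (y := q))
  rw [lintegral_const_mul _ hWLq]
  congr 1
  have hWq : Measurable fun z : ℕ → Plane => palmTerm A x fW i (q.1 0) (q.2 0) z :=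
    hmW.comp (measurable_prodMk_left (x := (q.1 0, q.2 0)))
  have hLq : Measurable fun z : ℕ → Plane => palmTerm B y fL k (q.1 0) (q.2 0) z :=
    hmL.comp (measurable_prodMk_left (x := (q.1 0, q.2 0)))
  exact lintegral_mul_eq_lintegral_mul_lintegral_of_indepFun'' (hWq.comp hapm).aemeasurable
    (hLq.comp henbm).aemeasurable (hnet.indep_positions.comp hWq hLq)

/-- The Palm probability of the transmission event, as an integral over the timers and the fading
variables of the two Palm nodes. -/
theorem IsLBTNetwork.palm_palmEvent (hnet : IsLBTNetwork p 0 1 P ap enb mark) (b : Bool)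
    {A B : Set Plane} (hA : MeasurableSet A) (hB : MeasurableSet B)
    (hA0 : volume A ≠ 0) (hA1 : volume A ≠ ∞) (hB0 : volume B ≠ 0) (hB1 : volume B ≠ ∞)
    (x y : Plane) :
    palm p P ap enb mark A B x y (palmEvent p b)
      = ∫⁻ q, (mutualSet p b x y).indicator 1 q *
          ENNReal.ofReal (clearProb p b x y (q.1 0) (q.2 0)) ∂((nodeLaw p).prod (nodeLaw p)) := by
  set c : ℝ≥0∞ := ENNReal.ofReal p.lamW * volume A * (ENNReal.ofReal p.lamL * volume B) with hc
  have hW0 : ENNReal.ofReal p.lamW ≠ 0 := by simpa using p.lamW_pos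
  have hL0 : ENNReal.ofReal p.lamL ≠ 0 := by simpa using p.lamL_pos
  have hc0 : c ≠ 0 := mul_ne_zero (mul_ne_zero hW0 hA0) (mul_ne_zero hL0 hB0)
  have hc1 : c ≠ ∞ := ENNReal.mul_ne_top (ENNReal.mul_ne_top ENNReal.ofReal_ne_top hA1)
    (ENNReal.mul_ne_top ENNReal.ofReal_ne_top hB1)
  have hPW := p.PW_pos
  have hPL := p.PL_pos
  set fW := nodeFactor p b (p.thrCS / p.PW) (p.thrL / p.PW) 0 x y with hfW
  set fL := nodeFactor p b (p.thrED / p.PL) (p.thrL / p.PL) ‖y‖ x y with hfL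
  have hind : Measurable ((mutualSet p b x y).indicator (1 : (Fin 3 → ℝ) × (Fin 3 → ℝ) → ℝ≥0∞)) :=
    measurable_one.indicator (measurableSet_mutualSet p b x y)
  have hmW := measurable_lintegral_palmTerm (P := P) hnet.poisson_ap.measurable hA x (f := fW)
    (measurable_nodeFactor p b _ _ _ x y)
  have hmL := measurable_lintegral_palmTerm (P := P) hnet.poisson_enb.measurable hB y (f := fL)
    (measurable_nodeFactor p b _ _ _ x y)
  -- For fixed marks of the Palm nodes the double sum over indices is a product of two Slivnyak
  -- sums. Their prefactors multiply to `c`, the normalization in `palm`, so the windows disappear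
  -- from the result.
  have hsum : ∀ᵐ q ∂((nodeLaw p).prod (nodeLaw p)),
      ∑' ik : ℕ × ℕ, (mutualSet p b x y).indicator 1 q *
        ((∫⁻ ω, palmTerm A x fW ik.1 (q.1 0) (q.2 0) (fun n => ap n ω) ∂P) *
          ∫⁻ ω, palmTerm B y fL ik.2 (q.1 0) (q.2 0) (fun n => enb n ω) ∂P)
      = c * ((mutualSet p b x y).indicator 1 q *
          ENNReal.ofReal (clearProb p b x y (q.1 0) (q.2 0))) := by
    filter_upwards [Measure.quasiMeasurePreserving_fst.ae (nodeLaw_ae_timer p),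
      Measure.quasiMeasurePreserving_snd.ae (nodeLaw_ae_timer p)] with q h1 h2
    rw [ENNReal.tsum_mul_left, tsum_mul_tsum_prod
      (fun i => ∫⁻ ω, palmTerm A x fW i (q.1 0) (q.2 0) (fun n => ap n ω) ∂P)
      (fun k => ∫⁻ ω, palmTerm B y fL k (q.1 0) (q.2 0) (fun n => enb n ω) ∂P)]
    have hW := palmCampbell_blockProb (r := 0) (x := x) (y := y) hnet.poisson_ap p.lamW_pos.le
      hA hA1 x (p.rate_pos (div_pos p.thrCS_pos hPW)) (p.rate_pos (div_pos p.thrL_pos hPW))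
      p.alpha_pos (boolWeight_nonneg b) (boolWeight_le_one b) h1.1 h1.2 h2.1 h2.2
    have hL := palmCampbell_blockProb (r := ‖y‖) (x := x) (y := y) hnet.poisson_enb p.lamL_pos.le
      hB hB1 y (p.rate_pos (div_pos p.thrED_pos hPL)) (p.rate_pos (div_pos p.thrL_pos hPL))
      p.alpha_pos (boolWeight_nonneg b) (boolWeight_le_one b) h1.1 h1.2 h2.1 h2.2
    have hball : (volume (Metric.closedBall (0 : Plane) 0)).toReal = 0 := by
      simp [Metric.closedBall_zero]
    rw [tsum_palmTerm, tsum_palmTerm, hfW, hfL, nodeFactor_eq, nodeFactor_eq, hW, hL,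
      hball, zero_add, clearProb, ENNReal.ofReal_mul (Real.exp_nonneg _), hc]
    ring
  rw [palm, Measure.smul_apply, smul_eq_mul, Measure.sum_apply _ (measurableSet_palmEvent p b)]
  have hterm : ∀ ik : ℕ × ℕ, _ := fun ik => hnet.palm_term b hA hB x y ik.1 ik.2
  have hmeas : ∀ ik : ℕ × ℕ, Measurable fun q : (Fin 3 → ℝ) × (Fin 3 → ℝ) =>
      (mutualSet p b x y).indicator 1 q *
        ((∫⁻ ω, palmTerm A x fW ik.1 (q.1 0) (q.2 0) (fun n => ap n ω) ∂P) *
          ∫⁻ ω, palmTerm B y fL ik.2 (q.1 0) (q.2 0) (fun n => enb n ω) ∂P) := fun ik =>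
    hind.mul ((hmW ik.1).mul (hmL ik.2))
  rw [tsum_congr hterm, ← lintegral_tsum fun ik => (hmeas ik).aemeasurable, lintegral_congr_ae hsum,
    lintegral_const_mul' _ _ hc1, ← mul_assoc, ENNReal.inv_mul_cancel hc0 hc1, one_mul]

end

/-! ### Integration over the timers and the fading variables of the Palm nodes -/

lemma lintegral_nodeLaw_pair (p : Params) {c : Fin 3} (hc : 0 ≠ c)
    (hl : blockLaw p c = expMeasure p.mu)
    {F : ℝ × ℝ → ℝ≥0∞} (hF : Measurable F) :
    ∫⁻ a, F (a 0, a c) ∂nodeLaw p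
      = ∫⁻ t in Set.Icc (0 : ℝ) 1, ∫⁻ g, F (t, g) ∂expMeasure p.mu := by
  have := isProbabilityMeasure_expMeasure p.mu_pos
  have h := Measure.infinitePi_map_eval_prod (P := blockLaw p) hc
  have h0 : blockLaw p 0 = volume.restrict (Set.Icc 0 1) := rfl
  rw [hl, h0] at h
  rw [← lintegral_prod _ hF.aemeasurable, ← h, lintegral_map hF (by fun_prop)]
  rfl

/-- The probability that two Palm nodes with timers `t` and `s` do not block each other. -/
noncomputable def mutualProb (u₁ u₂ : ℝ≥0∞) (t s : ℝ) : ℝ≥0∞ :=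
  (if t < s then u₁ else 1) * (if s < t then u₂ else 1)

lemma lintegral_mul_imp_indicator {μ : Measure ℝ} [IsProbabilityMeasure μ] (C : ℝ≥0∞) (a : Prop)
    [Decidable a] {F : Set ℝ} (hF : MeasurableSet F) :
    ∫⁻ g, C * {g | a → g ∈ F}.indicator 1 g ∂μ = C * if a then μ F else 1 := by
  split_ifs with h
  · have : {g | a → g ∈ F} = F := by ext; simp [h]
    rw [this, lintegral_const_mul _ (measurable_one.indicator hF), lintegral_indicator_one hF]
  · have : {g | a → g ∈ F} = Set.univ := by ext; simp [h]
    rw [this]; simp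

/-- The two mutual conditions involve different independent fadings, the channel AP to eNB stored
with the AP and the reverse channel stored with the eNB, so each is integrated out for fixed timers.
For `b = false` the second condition is empty and contributes total mass one. -/
lemma lintegral_mutualSet (p : Params) (b : Bool) (x y : Plane) {Φ : ℝ × ℝ → ℝ≥0∞}
    (hΦ : Measurable Φ) :
    ∫⁻ q, (mutualSet p b x y).indicator 1 q * Φ (q.1 0, q.2 0) ∂((nodeLaw p).prod (nodeLaw p))
      = ∫⁻ s in Set.Icc (0 : ℝ) 1, ∫⁻ t in Set.Icc (0 : ℝ) 1,
        mutualProb (expMeasure p.mu {g | g / p.loss ‖y - x‖ ≤ p.thrL / p.PW})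
          (expMeasure p.mu {g | b = true → g / p.loss ‖y - x‖ ≤ p.thrED / p.PL}) t s *
            Φ (t, s) := by
  have := isProbabilityMeasure_expMeasure p.mu_pos
  set F₁ : Set ℝ := {g | g / p.loss ‖y - x‖ ≤ p.thrL / p.PW} with hF₁
  set F₂ : Set ℝ := {g | b = true → g / p.loss ‖y - x‖ ≤ p.thrED / p.PL} with hF₂
  have hm₁ : MeasurableSet F₁ := measurableSet_div_le _ _
  have hm₂ : MeasurableSet F₂ := measurableSet_setOfPred.2 (measurable_const.imp
    (measurable_le_prop (measurable_id.div_const _) measurable_const))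
  -- Each factor sees the two timers and one fading only.
  let k₁ : (ℝ × ℝ) × ℝ → ℝ≥0∞ := {u | u.1.1 < u.1.2 → u.2 ∈ F₁}.indicator 1
  let k₂ : (ℝ × ℝ) × ℝ → ℝ≥0∞ := {u | u.1.2 < u.1.1 → u.2 ∈ F₂}.indicator 1
  have hk₁ : Measurable k₁ := measurable_one.indicator (measurableSet_setOfPred.2
    ((measurable_lt_prop measurable_fst.fst measurable_fst.snd).imp
      (measurableSet_setOfPred.1 (measurable_snd hm₁))))
  have hk₂ : Measurable k₂ := measurable_one.indicator (measurableSet_setOfPred.2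
    ((measurable_lt_prop measurable_fst.snd measurable_fst.fst).imp
      (measurableSet_setOfPred.1 (measurable_snd hm₂))))
  have hsplit : ∀ q : (Fin 3 → ℝ) × (Fin 3 → ℝ), 
      (mutualSet p b x y).indicator (1 : (Fin 3 → ℝ) × (Fin 3 → ℝ) → ℝ≥0∞) q
        = k₁ ((q.1 0, q.2 0), q.1 2) * k₂ ((q.1 0, q.2 0), q.2 1) := fun q => by
    have e1 : ∀ h1 : q.1 0 < q.2 0 → q.1 2 ∈ F₁, k₁ ((q.1 0, q.2 0), q.1 2) = 1 :=
      fun h1 => Set.indicator_of_mem (a := ((q.1 0, q.2 0), q.1 2))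
          (s := {u : (ℝ × ℝ) × ℝ | u.1.1 < u.1.2 → u.2 ∈ F₁}) h1 _
    have e2 : ∀ h2 : q.2 0 < q.1 0 → q.2 1 ∈ F₂, k₂ ((q.1 0, q.2 0), q.2 1) = 1 :=
      fun h2 => Set.indicator_of_mem (a := ((q.1 0, q.2 0), q.2 1))
          (s := {u : (ℝ × ℝ) × ℝ | u.1.2 < u.1.1 → u.2 ∈ F₂}) h2 _
    by_cases h1 : q.1 0 < q.2 0 → q.1 2 ∈ F₁
    · by_cases h2 : q.2 0 < q.1 0 → q.2 1 ∈ F₂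
      · have h : q ∈ mutualSet p b x y := ⟨fun hb h => h2 h hb, h1⟩
        rw [Set.indicator_of_mem h, e1 h1, e2 h2]
        simp
      · have h : q ∉ mutualSet p b x y := fun h => h2 fun h' hb => h.1 hb h'
        have e3 : k₂ ((q.1 0, q.2 0), q.2 1) = 0 := Set.indicator_of_notMem
          (a := ((q.1 0, q.2 0), q.2 1))
          (s := {u : (ℝ × ℝ) × ℝ | u.1.2 < u.1.1 → u.2 ∈ F₂}) h2 _
        rw [Set.indicator_of_notMem h, e3, mul_zero]
    · have h : q ∉ mutualSet p b x y := fun h => h1 h.2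
      have e3 : k₁ ((q.1 0, q.2 0), q.1 2) = 0 := Set.indicator_of_notMem
          (a := ((q.1 0, q.2 0), q.1 2))
          (s := {u : (ℝ × ℝ) × ℝ | u.1.1 < u.1.2 → u.2 ∈ F₁}) h1 _
      rw [Set.indicator_of_notMem h, e3, zero_mul]
  simp_rw [hsplit]
  have hmeas : Measurable fun q : (Fin 3 → ℝ) × (Fin 3 → ℝ) =>
      k₁ ((q.1 0, q.2 0), q.1 2) * k₂ ((q.1 0, q.2 0), q.2 1) * Φ (q.1 0, q.2 0) := by fun_prop
  rw [lintegral_prod _ hmeas.aemeasurable]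
  have hin : ∀ a : Fin 3 → ℝ, ∫⁻ a', k₁ ((a 0, a' 0), a 2) * k₂ ((a 0, a' 0), a' 1) * Φ (a 0, a' 0)
        ∂nodeLaw p
      = ∫⁻ s in Set.Icc (0 : ℝ) 1, k₁ ((a 0, s), a 2) *
        ((if s < a 0 then expMeasure p.mu F₂ else 1) * Φ (a 0, s)) := fun a => by
    have hm : Measurable fun u : ℝ × ℝ =>
        k₁ ((a 0, u.1), a 2) * k₂ ((a 0, u.1), u.2) * Φ (a 0, u.1) := by fun_prop
    have h := lintegral_nodeLaw_pair p (c := 1) (by decide) rfl hm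
    refine h.trans (lintegral_congr fun s => ?_)
    have h3 : ∀ g, k₁ ((a 0, s), a 2) * k₂ ((a 0, s), g) * Φ (a 0, s)
        = (k₁ ((a 0, s), a 2) * Φ (a 0, s)) * {g | s < a 0 → g ∈ F₂}.indicator 1 g := fun g => by
      have : k₂ ((a 0, s), g) = {g | s < a 0 → g ∈ F₂}.indicator 1 g := rfl
      rw [this]; ring
    rw [lintegral_congr h3]
    refine (lintegral_mul_imp_indicator (F := F₂) _ _ hm₂).trans ?_
    ring
  simp only [hin]
  have hite : Measurable fun u : ℝ × ℝ => if u.2 < u.1 then expMeasure p.mu F₂ else 1 :=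
    Measurable.ite (measurableSet_lt measurable_snd measurable_fst) measurable_const
      measurable_const
  have hmeas2 : Measurable fun u : (Fin 3 → ℝ) × ℝ => k₁ ((u.1 0, u.2), u.1 2) *
        ((if u.2 < u.1 0 then expMeasure p.mu F₂ else 1) * Φ (u.1 0, u.2)) := by
    have h4 : Measurable fun u : (Fin 3 → ℝ) × ℝ => (u.1 0, u.2) := by fun_prop
    have h5 := hite.comp h4
    have h6 := hΦ.comp h4
    have h7 : Measurable fun u : (Fin 3 → ℝ) × ℝ => k₁ ((u.1 0, u.2), u.1 2) := by fun_prop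
    exact h7.mul (h5.mul h6)
  rw [lintegral_lintegral_swap hmeas2.aemeasurable]
  refine lintegral_congr fun s => ?_
  have hm : Measurable fun u : ℝ × ℝ => k₁ ((u.1, s), u.2) *
        ((if s < u.1 then expMeasure p.mu F₂ else 1) * Φ (u.1, s)) := by
    have h4 : Measurable fun u : ℝ × ℝ => (u.1, s) := by fun_prop
    have h5 := hite.comp h4
    have h6 := hΦ.comp h4
    have h7 : Measurable fun u : ℝ × ℝ => k₁ ((u.1, s), u.2) := by fun_prop
    exact h7.mul (h5.mul h6)
  have h := lintegral_nodeLaw_pair p (c := 2) (by decide) rfl hm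
  refine h.trans (lintegral_congr fun t => ?_)
  have h3 : ∀ g, k₁ ((t, s), g) * ((if s < t then expMeasure p.mu F₂ else 1) * Φ (t, s))
      = ((if s < t then expMeasure p.mu F₂ else 1) * Φ (t, s)) *
        {g | t < s → g ∈ F₁}.indicator 1 g := fun g => by
    have : k₁ ((t, s), g) = {g | t < s → g ∈ F₁}.indicator 1 g := rfl
    rw [this]; ring
  rw [lintegral_congr h3]
  refine (lintegral_mul_imp_indicator (F := F₁) _ _ hm₁).trans ?_
  rw [mutualProb]
  ring

lemma lintegral_Icc_ofReal {r : ℝ} (hr : 0 ≤ r) {h : ℝ → ℝ} (hc : Continuous h)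
    (h0 : ∀ s ∈ Set.Icc 0 r, 0 ≤ h s) :
    ∫⁻ s in Set.Icc 0 r, ENNReal.ofReal (h s) = ENNReal.ofReal (∫ s in (0 : ℝ)..r, h s) := by
  rw [intervalIntegral.integral_of_le hr, ← integral_Icc_eq_integral_Ioc,
    ofReal_integral_eq_lintegral_ofReal (hc.continuousOn.integrableOn_Icc)]
  filter_upwards [ae_restrict_mem measurableSet_Icc] with s hs using h0 s hs

lemma integral_exp_linear (A : ℝ) {B : ℝ} (hB : B ≠ 0) (c r : ℝ) :
    ∫ t in (0 : ℝ)..r, Real.exp (-(A * c + B * t))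
      = (Real.exp (-(A * c)) - Real.exp (-(A * c + B * r))) / B := by
  rw [intervalIntegral.integral_eq_sub_of_hasDerivAt
    (f := fun t => -Real.exp (-(A * c + B * t)) / B)]
  · simp; ring
  · intro t _
    have h := ((((hasDerivAt_id t).const_mul B).const_add (A * c)).neg.exp).neg.div_const B
    refine h.congr_deriv ?_
    simp only [id_eq, mul_one, Pi.neg_apply]
    field_simp
  · exact (by fun_prop : Continuous fun t => Real.exp (-(A * c + B * t))).intervalIntegrable _ _

/-- The inner integral is `(exp (-A s) - exp (-(A + B) s)) / B`, and integrating it in `s` gives the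
closed form. With `A = N₁` and `B = N₂ - N₃` this is `M N₁ N₂ N₃`; nonnegativity is read off from
the integral. -/
lemma lintegral_triangle {A B : ℝ} (hA : A ≠ 0) (hB : 0 < B) (hAB : A + B ≠ 0) :
    0 ≤ ((1 - Real.exp (-A)) / A - (1 - Real.exp (-A - B)) / (A + B)) / B ∧
    ∫⁻ s in Set.Icc (0 : ℝ) 1, ∫⁻ t in Set.Icc (0 : ℝ) 1,
        (if t < s then 1 else 0) * ENNReal.ofReal (Real.exp (-(A * s + B * t)))
      = ENNReal.ofReal (((1 - Real.exp (-A)) / A - (1 - Real.exp (-A - B)) / (A + B)) / B) := by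
  have hin : ∀ s ∈ Set.Icc (0 : ℝ) 1, ∫⁻ t in Set.Icc (0 : ℝ) 1,
      (if t < s then 1 else 0) * ENNReal.ofReal (Real.exp (-(A * s + B * t)))
      = ENNReal.ofReal ((Real.exp (-(A * s)) - Real.exp (-(A * s + B * s))) / B) := fun s hs => by
    rw [← integral_exp_linear A hB.ne' s s, ← lintegral_Icc_ofReal hs.1 (by fun_prop)
      (fun _ _ => Real.exp_nonneg _)]
    have h1 : ∀ t, (if t < s then 1 else 0) * ENNReal.ofReal (Real.exp (-(A * s + B * t)))
        = (Set.Iio s).indicator (fun t => ENNReal.ofReal (Real.exp (-(A * s + B * t)))) t :=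
      fun t => by
        by_cases h : t < s <;> simp [h]
    simp only [h1]
    rw [lintegral_indicator measurableSet_Iio, Measure.restrict_restrict measurableSet_Iio]
    have h2 : Set.Iio s ∩ Set.Icc 0 1 = Set.Ico 0 s := by
      ext u
      simp only [Set.mem_inter_iff, Set.mem_Iio, Set.mem_Icc, Set.mem_Ico]
      exact ⟨fun h => ⟨h.2.1, h.1⟩, fun h => ⟨h.2, h.1, h.2.le.trans hs.2⟩⟩
    rw [h2, restrict_Ico_eq_restrict_Icc]
  have hpos : ∀ s ∈ Set.Icc (0 : ℝ) 1,
      0 ≤ (Real.exp (-(A * s)) - Real.exp (-(A * s + B * s))) / B := fun s hs => by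
    refine div_nonneg (sub_nonneg.2 (Real.exp_le_exp.2 ?_)) hB.le
    nlinarith [mul_nonneg hB.le hs.1]
  have hval : ∫ s in (0 : ℝ)..1, (Real.exp (-(A * s)) - Real.exp (-(A * s + B * s))) / B
      = ((1 - Real.exp (-A)) / A - (1 - Real.exp (-A - B)) / (A + B)) / B := by
    have e1 := integral_exp_linear 0 hA 0 1
    have e2 := integral_exp_linear 0 hAB 0 1
    simp only [mul_zero, zero_add, mul_one, neg_zero, Real.exp_zero] at e1 e2
    rw [intervalIntegral.integral_div, intervalIntegral.integral_sub
      ((by fun_prop : Continuous fun s : ℝ => Real.exp (-(A * s))).intervalIntegrable _ _)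
      ((by fun_prop : Continuous fun s : ℝ => Real.exp (-(A * s + B * s))).intervalIntegrable _ _)]
    simp only [← add_mul]
    rw [e1, e2]
    congr 4
    ring_nf
  refine ⟨?_, ?_⟩
  · rw [← hval]
    exact intervalIntegral.integral_nonneg zero_le_one hpos
  · rw [setLIntegral_congr_fun measurableSet_Icc hin, ← hval]
    exact lintegral_Icc_ofReal zero_le_one (by fun_prop) hpos

lemma measurable_ite_lt_mul {h : ℝ × ℝ → ℝ≥0∞} (hh : Measurable h) :
    Measurable fun u : ℝ × ℝ => (if u.1 < u.2 then 1 else 0) * h u :=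
  (Measurable.ite (measurableSet_lt measurable_fst measurable_snd) measurable_const
    measurable_const).mul hh

lemma lintegral_triangle_swap {A B : ℝ} (hA : A ≠ 0) (hB : 0 < B) (hAB : A + B ≠ 0) :
    ∫⁻ s in Set.Icc (0 : ℝ) 1, ∫⁻ t in Set.Icc (0 : ℝ) 1,
        (if s < t then 1 else 0) * ENNReal.ofReal (Real.exp (-(A * t + B * s)))
      = ENNReal.ofReal (((1 - Real.exp (-A)) / A - (1 - Real.exp (-A - B)) / (A + B)) / B) := by
  rw [← (lintegral_triangle hA hB hAB).2]
  refine lintegral_lintegral_swap ?_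
  exact (measurable_ite_lt_mul (h := fun u => ENNReal.ofReal (Real.exp (-(A * u.2 + B * u.1))))
    (by fun_prop)).aemeasurable

/-- Both Palm nodes are cleared: integral over the two timers. -/
lemma lintegral_mutualProb_both {u₁ u₂ e N₁ N₂ N₃ : ℝ} (hu₁ : 0 ≤ u₁) (hu₂ : 0 ≤ u₂) (he : 0 ≤ e)
    (h0 : 0 ≤ N₃) (h1 : N₃ < N₁) (h2 : N₃ < N₂) :
    0 ≤ u₁ * M N₁ N₂ N₃ + u₂ * M N₂ N₁ N₃ ∧
    ∫⁻ s in Set.Icc (0 : ℝ) 1, ∫⁻ t in Set.Icc (0 : ℝ) 1,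
        mutualProb (ENNReal.ofReal u₁) (ENNReal.ofReal u₂) t s *
          ENNReal.ofReal (e * Real.exp (-(t * N₂ + s * N₁ - min t s * N₃)))
      = ENNReal.ofReal (e * (u₁ * M N₁ N₂ N₃ + u₂ * M N₂ N₁ N₃)) := by
  have hs1 : N₁ + (N₂ - N₃) ≠ 0 := by linarith
  have hs2 : N₂ + (N₁ - N₃) ≠ 0 := by linarith
  obtain ⟨hM1, hI1⟩ := lintegral_triangle (A := N₁) (B := N₂ - N₃) (by linarith) (by linarith) hs1
  have hM2 := (lintegral_triangle (A := N₂) (B := N₁ - N₃) (by linarith) (by linarith) hs2).1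
  have hI2 := lintegral_triangle_swap (A := N₂) (B := N₁ - N₃) (by linarith) (by linarith) hs2
  have e1 : M N₁ N₂ N₃ = ((1 - Real.exp (-N₁)) / N₁
      - (1 - Real.exp (-N₁ - (N₂ - N₃))) / (N₁ + (N₂ - N₃))) / (N₂ - N₃) := by
    rw [M]; ring_nf
  have e2 : M N₂ N₁ N₃ = ((1 - Real.exp (-N₂)) / N₂
      - (1 - Real.exp (-N₂ - (N₁ - N₃))) / (N₂ + (N₁ - N₃))) / (N₁ - N₃) := by
    rw [M]; ring_nf
  rw [← e1] at hM1 hI1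
  rw [← e2] at hM2 hI2
  refine ⟨by positivity, ?_⟩
  set g₁ : ℝ × ℝ → ℝ≥0∞ := fun u => (if u.1 < u.2 then 1 else 0) *
    ENNReal.ofReal (Real.exp (-(N₁ * u.2 + (N₂ - N₃) * u.1))) with hg₁
  set g₂ : ℝ × ℝ → ℝ≥0∞ := fun u => (if u.2 < u.1 then 1 else 0) *
    ENNReal.ofReal (Real.exp (-(N₂ * u.1 + (N₁ - N₃) * u.2))) with hg₂
  have hmg₁ : Measurable g₁ := measurable_ite_lt_mul (by fun_prop)
  have hmg₂ : Measurable g₂ := (measurable_ite_lt_mul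
    (h := fun u => ENNReal.ofReal (Real.exp (-(N₂ * u.2 + (N₁ - N₃) * u.1)))) (by fun_prop)).comp
      measurable_swap
  have hms₁ : ∀ s, Measurable fun t => g₁ (t, s) := fun s => hmg₁.comp (by fun_prop)
  have hms₂ : ∀ s, Measurable fun t => g₂ (t, s) := fun s => hmg₂.comp (by fun_prop)
  have hmi₁ : Measurable fun s => ∫⁻ t in Set.Icc (0 : ℝ) 1, g₁ (t, s) := hmg₁.lintegral_prod_left'
  have hmi₂ : Measurable fun s => ∫⁻ t in Set.Icc (0 : ℝ) 1, g₂ (t, s) := hmg₂.lintegral_prod_left'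
  have hpt : ∀ s, ∫⁻ t in Set.Icc (0 : ℝ) 1,
        mutualProb (ENNReal.ofReal u₁) (ENNReal.ofReal u₂) t s *
        ENNReal.ofReal (e * Real.exp (-(t * N₂ + s * N₁ - min t s * N₃)))
      = ENNReal.ofReal e * (ENNReal.ofReal u₁ * (∫⁻ t in Set.Icc (0 : ℝ) 1, g₁ (t, s))
        + ENNReal.ofReal u₂ * ∫⁻ t in Set.Icc (0 : ℝ) 1, g₂ (t, s)) := fun s => by
    rw [← lintegral_const_mul _ (hms₁ s), ← lintegral_const_mul _ (hms₂ s),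
      ← lintegral_add_left ((hms₁ s).const_mul _),
      ← lintegral_const_mul' _ _ ENNReal.ofReal_ne_top]
    refine lintegral_congr_ae (ae_restrict_of_ae ?_)
    filter_upwards [compl_mem_ae_iff.2 (measure_singleton s)] with t ht
    rw [ENNReal.ofReal_mul he, mutualProb, hg₁, hg₂]
    -- Off the null diagonal, the smaller timer is the one whose rate is reduced by `N₃`, and only
    -- one of the two mutual factors is active.
    rcases lt_or_gt_of_ne ht with h | h
    · have : t * N₂ + s * N₁ - min t s * N₃ = N₁ * s + (N₂ - N₃) * t := by
        rw [min_eq_left h.le]; ring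
      simp only [h, h.not_gt, if_true, if_false, this]
      ring
    · have : t * N₂ + s * N₁ - min t s * N₃ = N₂ * t + (N₁ - N₃) * s := by
        rw [min_eq_right h.le]; ring
      simp only [h, h.not_gt, if_true, if_false, this]
      ring
  simp only [hpt]
  rw [lintegral_const_mul' _ _ ENNReal.ofReal_ne_top,
    lintegral_add_left (hmi₁.const_mul _), lintegral_const_mul _ hmi₁, lintegral_const_mul _ hmi₂]
  simp only [hg₁, hg₂]
  rw [hI1, hI2, ← ENNReal.ofReal_mul hu₁, ← ENNReal.ofReal_mul hu₂,
    ← ENNReal.ofReal_add (by positivity) (by positivity), ← ENNReal.ofReal_mul he]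

lemma lintegral_ite_lt (u : ℝ≥0∞) {s : ℝ} (hs : s ∈ Set.Icc (0 : ℝ) 1) :
    ∫⁻ t in Set.Icc (0 : ℝ) 1, (if t < s then u else 1)
      = u * ENNReal.ofReal s + ENNReal.ofReal (1 - s) := by
  have h : ∀ t, (if t < s then u else 1)
      = (Set.Iio s).indicator (fun _ => u) t + (Set.Ici s).indicator (fun _ => 1) t := fun t => by
    by_cases h : t < s
    · simp [h]
    · simp [h, not_lt.1 h]
  simp only [h]
  have h1 : Set.Icc (0 : ℝ) 1 ∩ Set.Iio s = Set.Ico 0 s := by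
    ext t
    simp only [Set.mem_inter_iff, Set.mem_Iio, Set.mem_Icc, Set.mem_Ico]
    exact ⟨fun h => ⟨h.1.1, h.2⟩, fun h => ⟨⟨h.1, h.2.le.trans hs.2⟩, h.2⟩⟩
  have h2 : Set.Icc (0 : ℝ) 1 ∩ Set.Ici s = Set.Icc s 1 := by
    ext t
    simp only [Set.mem_inter_iff, Set.mem_Ici, Set.mem_Icc]
    exact ⟨fun h => ⟨h.2, h.1.2⟩, fun h => ⟨⟨hs.1.trans h.1, h.2⟩, h.1⟩⟩
  rw [lintegral_add_left (measurable_const.indicator measurableSet_Iio),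
    lintegral_indicator_const measurableSet_Iio, lintegral_indicator_const measurableSet_Ici,
    Measure.restrict_apply measurableSet_Iio, Measure.restrict_apply measurableSet_Ici,
    Set.inter_comm, h1, Set.inter_comm, h2]
  simp

lemma integral_linear_mul_exp (v : ℝ) {N : ℝ} (hN : N ≠ 0) :
    ∫ s in (0 : ℝ)..1, (1 - v * s) * Real.exp (-(s * N))
      = (1 - Real.exp (-N)) / N - v * ((1 - Real.exp (-N)) / N ^ 2 - Real.exp (-N) / N) := by
  rw [intervalIntegral.integral_eq_sub_of_hasDerivAt
    (f := fun s => (v * s / N + v / N ^ 2 - 1 / N) * Real.exp (-(s * N)))]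
  · simp; field_simp; ring
  · intro s _
    have h1 : HasDerivAt (fun s : ℝ => Real.exp (-(s * N))) (Real.exp (-(s * N)) * -N) s := by
      simpa using (((hasDerivAt_id s).mul_const N).neg).exp
    have h2 : HasDerivAt (fun s : ℝ => v * s / N + v / N ^ 2 - 1 / N) (v / N) s := by
      simpa using ((((hasDerivAt_id s).const_mul v).div_const N).add_const (v / N ^ 2)).sub_const
        (1 / N)
    refine (h2.mul h1).congr_deriv ?_
    field_simp
    ring
  · exact (by fun_prop :
      Continuous fun s => (1 - v * s) * Real.exp (-(s * N))).intervalIntegrable _ _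

/-- Only the eNB is required to be cleared: integral over the two timers. -/
lemma lintegral_mutualProb_right {u e N : ℝ} (hu : 0 ≤ u) (he : 0 ≤ e) (hN : N ≠ 0) :
    0 < (1 - Real.exp (-N)) / N - (1 - u) * ((1 - Real.exp (-N)) / N ^ 2 - Real.exp (-N) / N) ∧
    ∫⁻ s in Set.Icc (0 : ℝ) 1, ∫⁻ t in Set.Icc (0 : ℝ) 1,
        mutualProb (ENNReal.ofReal u) 1 t s * ENNReal.ofReal (e * Real.exp (-(s * N)))
      = ENNReal.ofReal (e * ((1 - Real.exp (-N)) / N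
          - (1 - u) * ((1 - Real.exp (-N)) / N ^ 2 - Real.exp (-N) / N))) := by
  have hc : Continuous fun s => (1 - (1 - u) * s) * Real.exp (-(s * N)) := by fun_prop
  have h0 : ∀ s ∈ Set.Icc (0 : ℝ) 1, 0 ≤ 1 - (1 - u) * s := fun s hs => by
    nlinarith [mul_nonneg hu hs.1, hs.2]
  rw [← integral_linear_mul_exp (1 - u) hN]
  refine ⟨?_, ?_⟩
  -- Here `1 - (1 - u) * s = (1 - s) + u * s` is positive for `s < 1`, even when `u = 0`. This
  -- positivity makes the conditioning event nonnull.
  · refine intervalIntegral.intervalIntegral_pos_of_pos_on (hc.intervalIntegrable _ _)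
      (fun s hs => mul_pos ?_ (Real.exp_pos _)) zero_lt_one
    nlinarith [mul_nonneg hu hs.1.le, hs.2]
  · have hin : ∀ s ∈ Set.Icc (0 : ℝ) 1, ∫⁻ t in Set.Icc (0 : ℝ) 1,
        mutualProb (ENNReal.ofReal u) 1 t s * ENNReal.ofReal (e * Real.exp (-(s * N)))
        = ENNReal.ofReal (e * ((1 - (1 - u) * s) * Real.exp (-(s * N)))) := fun s hs => by
      have hm : ∀ t, mutualProb (ENNReal.ofReal u) 1 t s = if t < s then ENNReal.ofReal u else 1 :=
        fun t => by simp [mutualProb]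
      simp only [hm]
      rw [lintegral_mul_const' _ _ ENNReal.ofReal_ne_top, lintegral_ite_lt _ hs,
        ← ENNReal.ofReal_mul hu, ← ENNReal.ofReal_add (mul_nonneg hu hs.1) (sub_nonneg.2 hs.2),
        ← ENNReal.ofReal_mul (add_nonneg (mul_nonneg hu hs.1) (sub_nonneg.2 hs.2))]
      ring_nf
    rw [setLIntegral_congr_fun measurableSet_Icc hin, ← intervalIntegral.integral_const_mul]
    exact lintegral_Icc_ofReal zero_le_one (by fun_prop)
      fun s hs => mul_nonneg he (mul_nonneg (h0 s hs) (Real.exp_nonneg _))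

/-! ### The mean numbers of blocking nodes -/

lemma setIntegral_compl_closedBall_zero (f : Plane → ℝ) :
    ∫ w in (Metric.closedBall (0 : Plane) 0)ᶜ, f w = ∫ w, f w := by
  rw [Metric.closedBall_zero, restrict_compl_singleton]

/-- Tagging does not constrain the APs, so the integral runs over the plane up to a null set and
translation invariance makes it independent of `z`. -/
lemma Params.NW0_origin (p : Params) (G : ℝ) (z : Plane) :
    p.lamW * ∫ w in (Metric.closedBall (0 : Plane) 0)ᶜ, radVal (p.rate (G / p.PW)) p.alpha ‖w - z‖
      = p.NW0 0 0 G := by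
  rw [NW0, setIntegral_compl_closedBall_zero, setIntegral_compl_closedBall_zero]
  simp only [p.exp_neg_loss, sub_zero]
  rw [integral_sub_right_eq_self fun w : Plane => radVal (p.rate (G / p.PW)) p.alpha ‖w‖]

/-- Translation by `-x` carries the pair `(x, y)` to `(0, y - x)`; this explains the argument `y₀ -
x` in `N₃`. -/
lemma Params.CW0_origin (p : Params) (G₁ G₂ : ℝ) (x y : Plane) :
    p.lamW * ∫ w in (Metric.closedBall (0 : Plane) 0)ᶜ,
        radVal (p.rate (G₂ / p.PW)) p.alpha ‖w - x‖ * radVal (p.rate (G₁ / p.PW)) p.alpha ‖w - y‖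
      = p.CW0 (y - x) G₁ 0 G₂ := by
  rw [CW0, norm_zero, setIntegral_compl_closedBall_zero, setIntegral_compl_closedBall_zero]
  have h : ∀ a b : ℝ, Real.exp (-a - b) = Real.exp (-a) * Real.exp (-b) := fun a b => by
    rw [← Real.exp_add, sub_eq_add_neg]
  simp only [h, p.exp_neg_loss]
  rw [← integral_add_right_eq_self _ x]
  simp only [sub_zero, add_sub_cancel_right, sub_sub_eq_add_sub, mul_comm]

lemma Params.NL0_eq (p : Params) (G r : ℝ) (z : Plane) :
    p.lamL * ∫ w in (Metric.closedBall (0 : Plane) r)ᶜ, radVal (p.rate (G / p.PL)) p.alpha ‖w - z‖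
      = p.NL0 z r G := by
  rw [NL0]
  simp only [p.exp_neg_loss]

lemma Params.CL0_eq (p : Params) (G₁ G₂ : ℝ) (x y : Plane) :
    p.lamL * ∫ w in (Metric.closedBall (0 : Plane) ‖y‖)ᶜ,
        radVal (p.rate (G₁ / p.PL)) p.alpha ‖w - x‖ * radVal (p.rate (G₂ / p.PL)) p.alpha ‖w - y‖
      = p.CL0 x G₁ y G₂ := by
  rw [CL0]
  have h : ∀ a b : ℝ, Real.exp (-a - b) = Real.exp (-a) * Real.exp (-b) := fun a b => by
    rw [← Real.exp_add, sub_eq_add_neg]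
  simp only [h, p.exp_neg_loss]

/-- The second factor is below one except at `y`, the first is positive, and the complement of a
disc has positive measure. The strict inequality yields `N₃ < N₁` and `N₃ < N₂`, so that the
denominators in `M` do not vanish. -/
lemma integral_mul_radVal_lt {α c₁ c₂ : ℝ} (hc₁ : 0 < c₁) (hc₂ : 0 < c₂) (hα : 0 < α) (r : ℝ)
    (x y : Plane) :
    ∫ w in (Metric.closedBall (0 : Plane) r)ᶜ, radVal c₁ α ‖w - x‖ * radVal c₂ α ‖w - y‖
      < ∫ w in (Metric.closedBall (0 : Plane) r)ᶜ, radVal c₁ α ‖w - x‖ := by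
  have hlt : ∀ w : Plane, w ≠ y →
      radVal c₁ α ‖w - x‖ * radVal c₂ α ‖w - y‖ < radVal c₁ α ‖w - x‖ := fun w hw => by
    have h1 : radVal c₂ α ‖w - y‖ < 1 := by
      rw [radVal, Real.exp_lt_one_iff, neg_lt_zero]
      exact mul_pos hc₂ (Real.rpow_pos_of_pos (norm_pos_iff.2 (sub_ne_zero.2 hw)) _)
    have h2 : 0 < radVal c₁ α ‖w - x‖ := Real.exp_pos _
    nlinarith
  have hvol : volume (Metric.closedBall (0 : Plane) r)ᶜ ≠ 0 := by
    obtain ⟨w, hw⟩ := NormedSpace.exists_lt_norm ℝ Plane r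
    exact (Metric.isClosed_closedBall.isOpen_compl.measure_pos volume ⟨w, by simpa using hw⟩).ne'
  rw [← sub_pos, ← integral_sub (integrable_radVal hc₁ hα x).integrableOn
    (integrable_radVal_mul hc₁ hc₂ hα x y).integrableOn, setIntegral_pos_iff_support_of_nonneg_ae]
  · refine (pos_iff_ne_zero.2 hvol).trans_le ?_
    rw [← measure_sdiff_null (measure_singleton y)]
    exact measure_mono fun w hw => ⟨(sub_pos.2 (hlt w hw.2)).ne', hw.1⟩
  · refine ae_restrict_of_ae ?_
    filter_upwards [compl_mem_ae_iff.2 (measure_singleton y)] with w hw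
      using (sub_pos.2 (hlt w hw)).le
  · exact ((integrable_radVal hc₁ hα x).sub (integrable_radVal_mul hc₁ hc₂ hα x y)).integrableOn

/-- The mean number of nodes that would block the eNB at `y`. -/
noncomputable def meanEnb (p : Params) (y : Plane) : ℝ := p.NW0 0 0 p.thrL + p.NL0 y ‖y‖ p.thrL

/-- The mean number of nodes that would block the AP at `x`. -/
noncomputable def meanAp (p : Params) (x y : Plane) : ℝ :=
  p.NW0 0 0 p.thrCS + p.NL0 x ‖y‖ p.thrED

/-- The mean number of nodes that would block both the AP at `x` and the eNB at `y`. -/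
noncomputable def meanBoth (p : Params) (x y : Plane) : ℝ :=
  p.CW0 (y - x) p.thrL 0 p.thrCS + p.CL0 x p.thrED y p.thrL

lemma meanBoth_nonneg (p : Params) (x y : Plane) : 0 ≤ meanBoth p x y :=
  add_nonneg (mul_nonneg p.lamW_pos.le (integral_nonneg fun _ => Real.exp_nonneg _))
    (mul_nonneg p.lamL_pos.le (integral_nonneg fun _ => Real.exp_nonneg _))

lemma meanBoth_lt_meanAp (p : Params) (x y : Plane) : meanBoth p x y < meanAp p x y := by
  have hc : ∀ {G Q : ℝ}, 0 < G → 0 < Q → 0 < p.rate (G / Q) :=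
    fun hG hQ => p.rate_pos (div_pos hG hQ)
  rw [meanBoth, meanAp, ← p.CW0_origin, ← p.CL0_eq, ← p.NW0_origin _ x, ← p.NL0_eq]
  refine add_lt_add (mul_lt_mul_of_pos_left ?_ p.lamW_pos) (mul_lt_mul_of_pos_left ?_ p.lamL_pos)
  · exact integral_mul_radVal_lt (hc p.thrCS_pos p.PW_pos) (hc p.thrL_pos p.PW_pos)
      p.alpha_pos _ _ _
  · exact integral_mul_radVal_lt (hc p.thrED_pos p.PL_pos) (hc p.thrL_pos p.PL_pos)
      p.alpha_pos _ _ _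

lemma meanBoth_lt_meanEnb (p : Params) (x y : Plane) : meanBoth p x y < meanEnb p y := by
  have hc : ∀ {G Q : ℝ}, 0 < G → 0 < Q → 0 < p.rate (G / Q) :=
    fun hG hQ => p.rate_pos (div_pos hG hQ)
  rw [meanBoth, meanEnb, ← p.CW0_origin, ← p.CL0_eq, ← p.NW0_origin _ y, ← p.NL0_eq]
  refine add_lt_add (mul_lt_mul_of_pos_left ?_ p.lamW_pos) (mul_lt_mul_of_pos_left ?_ p.lamL_pos)
  · have h := integral_mul_radVal_lt (hc p.thrL_pos p.PW_pos) (hc p.thrCS_pos p.PW_pos)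
      p.alpha_pos 0 y x
    simpa only [mul_comm] using h
  · have h := integral_mul_radVal_lt (hc p.thrL_pos p.PL_pos) (hc p.thrED_pos p.PL_pos)
      p.alpha_pos ‖y‖ y x
    simpa only [mul_comm] using h

/-- The probability that no eNB is closer to the origin than `y`. -/
noncomputable def voidProb (p : Params) (y : Plane) : ℝ :=
  Real.exp (-(p.lamL * (volume (Metric.closedBall (0 : Plane) ‖y‖)).toReal))

lemma voidProb_pos (p : Params) (y : Plane) : 0 < voidProb p y := Real.exp_pos _

/-- The area of the disc separates as a factor free of the timers and of `b`; it is therefore common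
to the numerator and the denominator of the conditional probability. -/
lemma clearProb_eq (p : Params) (b : Bool) (x y : Plane) (t s : ℝ) :
    clearProb p b x y t s = voidProb p y * Real.exp (-(boolWeight b * t * meanAp p x y
      + s * meanEnb p y - boolWeight b * min t s * meanBoth p x y)) := by
  rw [clearProb, voidProb, ← Real.exp_add, ← Real.exp_add, meanBoth, meanAp, meanEnb, meanVal,
    meanVal,
    ← p.CW0_origin, ← p.CL0_eq, ← p.NW0_origin p.thrL y,
    ← p.NW0_origin p.thrCS x, ← p.NL0_eq, ← p.NL0_eq]
  ring_nf

/-! ### The Palm probabilities -/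

section
variable {Ω : Type*} [MeasurableSpace Ω] {P : Measure Ω} [IsProbabilityMeasure P] {p : Params}
  {ap enb : ℕ → Ω → Plane} {mark : Mark → Ω → ℝ} {A B : Set Plane} {x y : Plane}

lemma measurable_clearProb (p : Params) (b : Bool) (x y : Plane) :
    Measurable fun u : ℝ × ℝ => ENNReal.ofReal (clearProb p b x y u.1 u.2) := by
  simp only [clearProb_eq]
  fun_prop

lemma Params.clear_nonneg (p : Params) {θ d : ℝ} (hθ : 0 < θ) (hd : 0 < d) :
    0 ≤ 1 - Real.exp (-(p.mu * θ * p.loss d)) := by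
  rw [sub_nonneg, Real.exp_le_one_iff, neg_nonpos]
  exact (mul_pos (mul_pos p.mu_pos hθ) (p.loss_pos hd)).le

/-- The Palm probability that the eNB is tagged and transmits. -/
lemma IsLBTNetwork.palm_enb (hnet : IsLBTNetwork p 0 1 P ap enb mark)
    (hA : MeasurableSet A) (hB : MeasurableSet B)
    (hA0 : volume A ≠ 0) (hA1 : volume A ≠ ∞) (hB0 : volume B ≠ 0) (hB1 : volume B ≠ ∞)
    (hxy : x ≠ y) :
    0 < p.U (x - y) (p.thrL / p.PW) (meanEnb p y) ∧
    palm p P ap enb mark A B x y (palmEvent p false)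
      = ENNReal.ofReal (voidProb p y * p.U (x - y) (p.thrL / p.PW) (meanEnb p y)) := by
  have hd : 0 < ‖y - x‖ := norm_pos_iff.2 (sub_ne_zero.2 hxy.symm)
  have hθ := div_pos p.thrL_pos p.PW_pos
  have := isProbabilityMeasure_expMeasure p.mu_pos
  have hN : meanEnb p y ≠ 0 := ((meanBoth_nonneg p x y).trans_lt (meanBoth_lt_meanEnb p x y)).ne'
  obtain ⟨h1, h2⟩ := lintegral_mutualProb_right (p.clear_nonneg hθ hd)
    (voidProb_pos p y).le hN
  rw [sub_sub_cancel, norm_sub_rev] at h1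
  rw [sub_sub_cancel, norm_sub_rev] at h2
  refine ⟨h1, ?_⟩
  rw [hnet.palm_palmEvent false hA hB hA0 hA1 hB0 hB1, lintegral_mutualSet p false x y
    (measurable_clearProb p false x y), expMeasure_div_le p hθ (p.loss_pos hd), Params.U, ← h2]
  simp [clearProb_eq, boolWeight, norm_sub_rev y x]

/-- The Palm probability that the eNB is tagged and transmits and that the AP transmits. -/
lemma IsLBTNetwork.palm_enb_ap (hnet : IsLBTNetwork p 0 1 P ap enb mark)
    (hA : MeasurableSet A) (hB : MeasurableSet B)
    (hA0 : volume A ≠ 0) (hA1 : volume A ≠ ∞) (hB0 : volume B ≠ 0) (hB1 : volume B ≠ ∞)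
    (hxy : x ≠ y) :
    0 ≤ p.V (x - y) (p.thrL / p.PW) (p.thrED / p.PL) (meanEnb p y) (meanAp p x y) (meanBoth p x y) ∧
    palm p P ap enb mark A B x y (palmEvent p true)
      = ENNReal.ofReal (voidProb p y * p.V (x - y) (p.thrL / p.PW) (p.thrED / p.PL)
          (meanEnb p y) (meanAp p x y) (meanBoth p x y)) := by
  have hd : 0 < ‖y - x‖ := norm_pos_iff.2 (sub_ne_zero.2 hxy.symm)
  have hθ₁ := div_pos p.thrL_pos p.PW_pos
  have hθ₂ := div_pos p.thrED_pos p.PL_pos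
  obtain ⟨h1, h2⟩ := lintegral_mutualProb_both (p.clear_nonneg hθ₁ hd) (p.clear_nonneg hθ₂ hd)
    (voidProb_pos p y).le (meanBoth_nonneg p x y) (meanBoth_lt_meanEnb p x y)
    (meanBoth_lt_meanAp p x y)
  rw [Params.V, norm_sub_rev x y]
  refine ⟨h1, ?_⟩
  rw [hnet.palm_palmEvent true hA hB hA0 hA1 hB0 hB1, lintegral_mutualSet p true x y
    (measurable_clearProb p true x y), ← h2, ← expMeasure_div_le p hθ₁ (p.loss_pos hd),
    ← expMeasure_div_le p hθ₂ (p.loss_pos hd)]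
  simp [clearProb_eq, boolWeight]

lemma taggedEnbEvent_eq (p : Params) : taggedEnbEvent p = palmEvent p false := by
  ext q; simp [taggedEnbEvent, palmEvent, jointEvent]

lemma taggedEnbEvent_inter_apEvent (p : Params) :
    taggedEnbEvent p ∩ apEvent p = palmEvent p true := by
  ext q; simp [taggedEnbEvent, apEvent, palmEvent, jointEvent, and_assoc]

end

end Coexist

/-! ### The conditional medium access probability. -/

theorem mainTheorem8 (p : Coexist.Params) {Ω : Type*} [MeasurableSpace Ω]
    (P : Measure Ω) [IsProbabilityMeasure P]
    (ap enb : ℕ → Ω → Coexist.Plane) (mark : Coexist.Mark → Ω → ℝ)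
    (hnet : Coexist.IsLBTNetwork p 0 1 P ap enb mark)
    (A B : Set Coexist.Plane) (hA : MeasurableSet A) (hB : MeasurableSet B)
    (hA0 : volume A ≠ 0) (hA1 : volume A ≠ ∞) (hB0 : volume B ≠ 0) (hB1 : volume B ≠ ∞)
    (r₀ : ℝ) (hr₀ : 0 < r₀) (x : Coexist.Plane)
    (hx : x ∉ Metric.closedBall (0 : Coexist.Plane) r₀) :
    Coexist.palm p P ap enb mark A B x !₂[r₀, 0] (Coexist.taggedEnbEvent p) ≠ 0 ∧
    (ProbabilityTheory.cond (Coexist.palm p P ap enb mark A B x !₂[r₀, 0])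
      (Coexist.taggedEnbEvent p)).real (Coexist.apEvent p) = Coexist.h3W p r₀ x := by
  have hnorm : ‖(!₂[r₀, 0] : Coexist.Plane)‖ = r₀ := by
    simp [EuclideanSpace.norm_eq, Fin.sum_univ_two, Real.sqrt_sq hr₀.le]
  -- The eNB lies on the boundary of the disc that excludes `x`, so the distance between the Palm
  -- nodes is positive.
  have hxy : x ≠ !₂[r₀, 0] := fun h => hx (by simp [h, hnorm])
  obtain ⟨hU, h1⟩ := hnet.palm_enb hA hB hA0 hA1 hB0 hB1 hxy
  obtain ⟨hV, h2⟩ := hnet.palm_enb_ap hA hB hA0 hA1 hB0 hB1 hxy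
  have he : 0 < Coexist.voidProb p !₂[r₀, 0] := Coexist.voidProb_pos p _
  have hmeas := Coexist.taggedEnbEvent_eq p ▸ Coexist.measurableSet_palmEvent p false
  rw [← Coexist.taggedEnbEvent_eq] at h1
  rw [← Coexist.taggedEnbEvent_inter_apEvent] at h2
  refine ⟨by rw [h1]; simpa using mul_pos he hU, ?_⟩
  -- The void probability is a nonzero common factor and cancels, leaving `V / U`.
  rw [measureReal_def, cond_apply hmeas, h1, h2, ENNReal.toReal_mul, ENNReal.toReal_inv,
    ENNReal.toReal_ofReal (mul_pos he hU).le, ENNReal.toReal_ofReal (mul_nonneg he.le hV),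
    ← div_eq_inv_mul, mul_div_mul_left _ _ he.ne', Coexist.h3W]
  simp only [Coexist.meanEnb, Coexist.meanAp, Coexist.meanBoth, Coexist.Params.NW3,
    Coexist.Params.NL1, Coexist.Params.NW, hnorm]
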